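/- Let $d\ge 0$ be an integer, let $E_0,E_1,E_2$ be complex Banach spaces and let $\bullet:E_0\times E_1\to E_2$ be a multiplication, i.e. a continuous bilinear map with $|x\bullet y|_{E_2}\le |x|_{E_0}|y|_{E_1}$. Write $\mathcal S'(\mathbb R^d,E)$ for the continuous linear maps $\mathcal S(\mathbb R^d)\to E$ and $\langle x\rangle=(1+|x|^2)^{1/2}$. For a window $g\in\mathcal S(\mathbb R^d)\setminus\{0\}$ and $f\in\mathcal S'(\mathbb R^d,E)$ let $V_gf(x,\xi)=\langle f, e^{2\pi i \xi\cdot}g(\cdot-x)\rangle$ be the short-time Fourier transform (the bracket being conjugate-linear in the second entry). For $1\le p,q\le\infty$ and $r,s\in\mathbb R$ put $$\|f\|_{M^{p,q}_{r,s}}=\Big(\int\Big(\int |V_gf(x,\xi)|_E^p\langle x\rangle^{rp}dx\Big)^{q/p}\langle\xi\rangle^{sq}d\xi\Big)^{1/q},\qquad \|f\|_{W^{p,q}_{r,s}}=\Big(\int\Big(\int |V_gf(x,\xi)|_E^p\langle \xi\rangle^{rp}d\xi\Big)^{q/p}\langle x\rangle^{sq}dx\Big)^{1/q},$$ with the usual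 modification if $p$ or $q$ is $\infty$, and let $M^{p,q}_{r,s}(\mathbb R^d,E)$ and $W^{p,q}_{r,s}(\mathbb R^d,E)$ be the spaces of $f\in\mathcal S'(\mathbb R^d,E)$ for which the respective norm is finite for some window $g\ne0$. For $u\in\mathcal S'(\mathbb R^d,E_0)$ and $v\in\mathcal S'(\mathbb R^d,E_1)$, the product $u\bullet v\in\mathcal S'(\mathbb R^d,E_2)$ is said to exist, and to be equal to $w$, if for all $\rho,\sigma\in\mathcal S(\mathbb R^d)$ with $\int\rho=\int\sigma=1$ one has $(u*\rho_\varepsilon)\bullet(v*\sigma_\varepsilon)\to w$ in the sense of tempered distributions (tested against each Schwartz function) as $\varepsilon\to0^+$, where $\rho_\varepsilon=\varepsilon^{-d}\rho(\cdot/\varepsilon)$ and likewise $\sigma_\varepsilon$. With $\mathcal Ff(\xi)=\int e^{-2\pi i x\cdot\xi}f(x)\,dx$, the Fourier multiplier with symbol $\mu\in\mathcal S'(\mathbb R^d,E_0)$ is the linear map $\mu(D)f=\mathcal F^{-1}(\mu\bullet\mathcal Ff)$, whose domain consists of all $f\in\mathcal S'(\mathbb R^d,E_1)$ for which the product $\mu\bullet\mathcal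 F f$ exists. **Proposition.** Let $1\le p,q\le\infty$ and $r,s,\delta\in\mathbb R$, and let nonzero windows $g_0,g_1,g_2$ be fixed, used for the norms of $\mu$, $f$ and $\mu(D)f$ respectively. There is a constant $C>0$ such that for every $\mu\in M^{\infty,1}_{\delta,|s|}(\mathbb R^d,E_0)$ the space $W^{p,q}_{r,s}(\mathbb R^d,E_1)$ is contained in the domain of $\mu(D)$, and for every $f\in W^{p,q}_{r,s}(\mathbb R^d,E_1)$ one has $\mu(D)f\in W^{p,q}_{r+\delta,s}(\mathbb R^d,E_2)$ and $$\|\mu(D)f\|_{W^{p,q}_{r+\delta,s}}\le C\,\|\mu\|_{M^{\infty,1}_{\delta,|s|}}\,\|f\|_{W^{p,q}_{r,s}}.$$ -/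

import Mathlib

open MeasureTheory Filter Topology SchwartzMap FourierTransform
open scoped ENNReal

noncomputable section

/-- The Euclidean space `ℝᵈ`. -/
abbrev Rd (d : ℕ) : Type := EuclideanSpace ℝ (Fin d)

/-! ### Test functions -/

section TestFunctions

variable {d : ℕ}

/-- The function `y ↦ exp (-2πi y·ξ)`. -/
def negCharacter (ξ : Rd d) (y : Rd d) : ℂ :=
  Complex.exp (((-(2 * Real.pi * inner ℝ y ξ) : ℝ) : ℂ) * Complex.I)

theorem hasTemperateGrowth_exp_mul_I :
    Function.HasTemperateGrowth (fun t : ℝ => Complex.exp ((t : ℂ) * Complex.I)) := by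
  have hder : ∀ n : ℕ, iteratedDeriv n (fun t : ℝ => Complex.exp ((t : ℂ) * Complex.I))
      = fun t : ℝ => Complex.I ^ n * Complex.exp ((t : ℂ) * Complex.I) := by
    intro n
    induction n with
    | zero => simp
    | succ n ih =>
      rw [iteratedDeriv_succ, ih]
      funext t
      have h1 : HasDerivAt (fun t : ℝ => (t : ℂ) * Complex.I) (1 * Complex.I) t :=
        (Complex.ofRealCLM.hasDerivAt (x := t)).mul_const Complex.I
      have h2 := (h1.cexp).const_mul (Complex.I ^ n)
      rw [h2.deriv]
      ring
  refine ⟨?_, fun n => ⟨0, 1, fun t => ?_⟩⟩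
  · exact (Complex.ofRealCLM.contDiff.mul contDiff_const).cexp
  · rw [norm_iteratedFDeriv_eq_norm_iteratedDeriv, hder]
    simp [Complex.norm_exp_ofReal_mul_I]

theorem hasTemperateGrowth_negCharacter (ξ : Rd d) :
    Function.HasTemperateGrowth (negCharacter ξ) := by
  have h : Function.HasTemperateGrowth (fun y : Rd d => (-(2 * Real.pi * inner ℝ y ξ) : ℝ)) := by
    fun_prop
  exact hasTemperateGrowth_exp_mul_I.comp h

/-- The test function `y ↦ exp (-2πi y·ξ) * conj (g (y - x))`, the complex conjugate of the
time-frequency shift `M_ξ T_x g` of the window `g`. -/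
def conjTFShift (g : 𝓢(Rd d, ℂ)) (x ξ : Rd d) : 𝓢(Rd d, ℂ) :=
  smulLeftCLM ℂ (negCharacter ξ)
    (compSubConstCLM ℂ x (postcompCLM (𝕜 := ℝ) (Complex.conjCLE : ℂ →L[ℝ] ℂ) g))

theorem conjTFShift_apply (g : 𝓢(Rd d, ℂ)) (x ξ y : Rd d) :
    conjTFShift g x ξ y = negCharacter ξ y * (starRingEnd ℂ) (g (y - x)) := by
  simp [conjTFShift, smulLeftCLM_apply_apply (hasTemperateGrowth_negCharacter ξ)]

/-- The test function `y ↦ ε⁻ᵈ ρ (ε⁻¹ (x - y))` for `ε ≠ 0` (and `0` for `ε = 0`). -/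
def reflDilate (ρ : 𝓢(Rd d, ℂ)) (ε : ℝ) (x : Rd d) : 𝓢(Rd d, ℂ) :=
  if h : ε = 0 then 0 else
    ((ε ^ d)⁻¹ : ℝ) • compSubConstCLM ℂ x
      (compCLMOfContinuousLinearEquiv ℂ
        (ContinuousLinearEquiv.smulLeft (R₁ := ℝ) (Units.mk0 (-ε⁻¹) (by simpa using h))) ρ)

theorem reflDilate_apply (ρ : 𝓢(Rd d, ℂ)) {ε : ℝ} (h : ε ≠ 0) (x y : Rd d) :
    reflDilate ρ ε x y = (((ε ^ d)⁻¹ : ℝ) : ℂ) * ρ (ε⁻¹ • (x - y)) := by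
  have h1 : (-ε⁻¹) • (y - x) = ε⁻¹ • (x - y) := by
    rw [neg_smul, ← smul_neg, neg_sub]
  simp only [reflDilate, h, dite_false, _root_.smul_apply, compSubConstCLM_apply,
    compCLMOfContinuousLinearEquiv_apply, Function.comp_apply, Complex.real_smul]
  rw [← h1]
  rfl

end TestFunctions

/-! ### Time-frequency analysis of vector-valued tempered distributions

Tempered distributions are `ℂ`-linear maps on the Schwartz space here; the sesquilinear bracket
`⟨f, g⟩` of a distribution and a test function is therefore `f (conj g)`. -/

section TimeFrequency

variable {d : ℕ} {E : Type*} [NormedAddCommGroup E] [NormedSpace ℂ E]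

/-- The short-time Fourier transform `V_g f (x, ξ) = ⟨f, M_ξ T_x g⟩`. -/
def stft (g : 𝓢(Rd d, ℂ)) (f : 𝓢'(Rd d, E)) (x ξ : Rd d) : E :=
  f (conjTFShift g x ξ)

/-- The weight `⟨x⟩ ^ r = (1 + |x|²) ^ (r / 2)`. -/
def bracketPow (r : ℝ) (x : Rd d) : ℝ := (1 + ‖x‖ ^ 2) ^ (r / 2)

/-- The modulation space norm with window `g`, as an extended nonnegative number: the `L^q_s` norm
in `ξ` of the `L^p_r` norm in `x` of `V_g f (x, ξ)`. -/
def modulationNorm (p q : ℝ≥0∞) (r s : ℝ) (g : 𝓢(Rd d, ℂ)) (f : 𝓢'(Rd d, E)) : ℝ≥0∞ :=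
  eLpNorm (fun ξ : Rd d =>
    ENNReal.ofReal (bracketPow s ξ) *
      eLpNorm (fun x : Rd d => bracketPow r x * ‖stft g f x ξ‖) p volume) q volume

/-- The Wiener amalgam space norm with window `g`: the `L^q_s` norm in `x` of the `L^p_r` norm
in `ξ` of `V_g f (x, ξ)`. -/
def amalgamNorm (p q : ℝ≥0∞) (r s : ℝ) (g : 𝓢(Rd d, ℂ)) (f : 𝓢'(Rd d, E)) : ℝ≥0∞ :=
  eLpNorm (fun x : Rd d =>
    ENNReal.ofReal (bracketPow s x) *
      eLpNorm (fun ξ : Rd d => bracketPow r ξ * ‖stft g f x ξ‖) p volume) q volume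

/-- Membership in the modulation space `M^{p,q}_{r,s}(ℝᵈ, E)`. -/
def MemModulation (p q : ℝ≥0∞) (r s : ℝ) (f : 𝓢'(Rd d, E)) : Prop :=
  ∃ g : 𝓢(Rd d, ℂ), g ≠ 0 ∧ modulationNorm p q r s g f < ∞

/-- Membership in the Wiener amalgam space `W^{p,q}_{r,s}(ℝᵈ, E)`. -/
def MemAmalgam (p q : ℝ≥0∞) (r s : ℝ) (f : 𝓢'(Rd d, E)) : Prop :=
  ∃ g : 𝓢(Rd d, ℂ), g ≠ 0 ∧ amalgamNorm p q r s g f < ∞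

/-- The regularization `f * ρ_ε` with `ρ_ε = ε⁻ᵈ ρ(·/ε)`, as a function:
`(f * ρ_ε)(x) = f (ρ_ε (x - ·))`. -/
def regularize (f : 𝓢'(Rd d, E)) (ρ : 𝓢(Rd d, ℂ)) (ε : ℝ) (x : Rd d) : E :=
  f (reflDilate ρ ε x)

end TimeFrequency

/-! ### Products of distributions and Fourier multipliers -/

section Multipliers

variable {d : ℕ} {E₀ E₁ E₂ : Type*}
  [NormedAddCommGroup E₀] [NormedSpace ℂ E₀] [NormedAddCommGroup E₁] [NormedSpace ℂ E₁]
  [NormedAddCommGroup E₂] [NormedSpace ℂ E₂]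

/-- `w` is the product `u • v` of the tempered distributions `u` and `v` with respect to the
bilinear map `B`: for all Schwartz mollifiers `ρ`, `σ` with integral one, the pointwise products
`(u * ρ_ε) • (v * σ_ε)` of the regularizations converge to `w` in the sense of tempered
distributions as `ε → 0+`. -/
def IsDistribProduct (B : E₀ →L[ℂ] E₁ →L[ℂ] E₂)
    (u : 𝓢'(Rd d, E₀)) (v : 𝓢'(Rd d, E₁)) (w : 𝓢'(Rd d, E₂)) : Prop :=
  ∀ ρ σ : 𝓢(Rd d, ℂ), ∫ x, ρ x = 1 → ∫ x, σ x = 1 → ∀ φ : 𝓢(Rd d, ℂ),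
    (∀ᶠ ε in 𝓝[>] (0 : ℝ),
      Integrable (fun x => φ x • B (regularize u ρ ε x) (regularize v σ ε x))) ∧
    Tendsto (fun ε : ℝ => ∫ x, φ x • B (regularize u ρ ε x) (regularize v σ ε x))
      (𝓝[>] 0) (𝓝 (w φ))

theorem exists_mollifier (d : ℕ) : ∃ ρ : 𝓢(Rd d, ℂ), ∫ x, ρ x = 1 := by
  let b : ContDiffBump (0 : Rd d) := ⟨1, 2, one_pos, one_lt_two⟩
  have h1 : HasCompactSupport (Complex.ofRealCLM ∘ b.normed volume) :=
    b.hasCompactSupport_normed.comp_left rfl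
  have h2 : ContDiff ℝ (⊤ : ℕ∞) (Complex.ofRealCLM ∘ b.normed volume) :=
    Complex.ofRealCLM.contDiff.comp b.contDiff_normed
  refine ⟨h1.toSchwartzMap h2, ?_⟩
  have h3 : ∫ x, ((b.normed volume x : ℝ) : ℂ) = 1 := by
    rw [integral_complex_ofReal, b.integral_normed, Complex.ofReal_one]
  exact h3

theorem IsDistribProduct.unique {B : E₀ →L[ℂ] E₁ →L[ℂ] E₂}
    {u : 𝓢'(Rd d, E₀)} {v : 𝓢'(Rd d, E₁)} {w w' : 𝓢'(Rd d, E₂)}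
    (h : IsDistribProduct B u v w) (h' : IsDistribProduct B u v w') : w = w' := by
  obtain ⟨ρ, hρ⟩ := exists_mollifier d
  ext φ
  exact tendsto_nhds_unique (h ρ ρ hρ hρ φ).2 (h' ρ ρ hρ hρ φ).2

theorem IsDistribProduct.zero_right (B : E₀ →L[ℂ] E₁ →L[ℂ] E₂) (u : 𝓢'(Rd d, E₀)) :
    IsDistribProduct B u 0 0 := by
  intro ρ σ _ _ φ
  simp [regularize]

theorem IsDistribProduct.add_right {B : E₀ →L[ℂ] E₁ →L[ℂ] E₂}
    {u : 𝓢'(Rd d, E₀)} {v v' : 𝓢'(Rd d, E₁)} {w w' : 𝓢'(Rd d, E₂)}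
    (h : IsDistribProduct B u v w) (h' : IsDistribProduct B u v' w') :
    IsDistribProduct B u (v + v') (w + w') := by
  intro ρ σ hρ hσ φ
  obtain ⟨hi, ht⟩ := h ρ σ hρ hσ φ
  obtain ⟨hi', ht'⟩ := h' ρ σ hρ hσ φ
  have key : ∀ ε x, φ x • B (regularize u ρ ε x) (regularize (v + v') σ ε x)
      = φ x • B (regularize u ρ ε x) (regularize v σ ε x)
        + φ x • B (regularize u ρ ε x) (regularize v' σ ε x) := by
    intro ε x
    have : regularize (v + v') σ ε x = regularize v σ ε x + regularize v' σ ε x := rfl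
    rw [this, map_add, smul_add]
  simp only [key]
  refine ⟨by filter_upwards [hi, hi'] with ε a b using a.add b, ?_⟩
  refine (ht.add ht').congr' ?_
  filter_upwards [hi, hi'] with ε a b
  exact (integral_add a b).symm

theorem IsDistribProduct.smul_right {B : E₀ →L[ℂ] E₁ →L[ℂ] E₂}
    {u : 𝓢'(Rd d, E₀)} {v : 𝓢'(Rd d, E₁)} {w : 𝓢'(Rd d, E₂)} (c : ℂ)
    (h : IsDistribProduct B u v w) : IsDistribProduct B u (c • v) (c • w) := by
  intro ρ σ hρ hσ φ
  obtain ⟨hi, ht⟩ := h ρ σ hρ hσ φ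
  have key : ∀ ε x, φ x • B (regularize u ρ ε x) (regularize (c • v) σ ε x)
      = c • (φ x • B (regularize u ρ ε x) (regularize v σ ε x)) := by
    intro ε x
    have : regularize (c • v) σ ε x = c • regularize v σ ε x := rfl
    rw [this, map_smul, smul_comm]
  simp only [key, integral_smul]
  exact ⟨by filter_upwards [hi] with ε a using a.smul c, ht.const_smul c⟩

/-- The Fourier multiplier `μ(D) f = 𝓕⁻¹ (μ • 𝓕 f)` with symbol `μ`, as a partially defined linear
map on tempered distributions. Its domain consists of those `f` for which the product `μ • 𝓕 f`
exists as a tempered distribution. -/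
def fourierMultiplier (B : E₀ →L[ℂ] E₁ →L[ℂ] E₂) (μ : 𝓢'(Rd d, E₀)) :
    𝓢'(Rd d, E₁) →ₗ.[ℂ] 𝓢'(Rd d, E₂) where
  domain :=
    { carrier := {f | ∃ w, IsDistribProduct B μ (𝓕 f) w}
      zero_mem' := ⟨0, by
        have h : 𝓕 (0 : 𝓢'(Rd d, E₁)) = 0 := by ext; simp
        rw [h]; exact IsDistribProduct.zero_right B μ⟩
      add_mem' := by
        rintro f f' ⟨w, h⟩ ⟨w', h'⟩
        exact ⟨w + w', by rw [FourierAdd.fourier_add]; exact h.add_right h'⟩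
      smul_mem' := by
        rintro c f ⟨w, h⟩
        exact ⟨c • w, by rw [fourier_smul]; exact h.smul_right c⟩ }
  toFun :=
    { toFun := fun f => 𝓕⁻ (Classical.choose f.2)
      map_add' := by
        intro f f'
        rw [← fourierInv_add]
        congr 1
        refine (Classical.choose_spec (f + f').2).unique ?_
        have := (Classical.choose_spec f.2).add_right (Classical.choose_spec f'.2)
        rwa [← FourierAdd.fourier_add] at this
      map_smul' := by
        intro c f
        rw [RingHom.id_apply, ← fourierInv_smul]
        congr 1
        refine (Classical.choose_spec (c • f).2).unique ?_
        have := (Classical.choose_spec f.2).smul_right c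
        rwa [← fourier_smul] at this }

theorem fourierMultiplier_eq {B : E₀ →L[ℂ] E₁ →L[ℂ] E₂} {μ : 𝓢'(Rd d, E₀)}
    {f : 𝓢'(Rd d, E₁)} {w : 𝓢'(Rd d, E₂)} (h : IsDistribProduct B μ (𝓕 f) w) :
    fourierMultiplier B μ ⟨f, ⟨w, h⟩⟩ = 𝓕⁻ w := by
  have hf : f ∈ (fourierMultiplier B μ).domain := ⟨w, h⟩
  change 𝓕⁻ (Classical.choose hf) = 𝓕⁻ w
  rw [(Classical.choose_spec hf).unique h]

end Multipliers

end

/-! The Fourier transform turns the claim into one about products. Since `𝓕⁻` exchanges time and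
frequency up to a reflection and a unimodular phase, the amalgam norm of `𝓕⁻ v` is the modulation
norm of `v` with a transformed window. It therefore suffices to show that the product of `u ∈
M^{∞,1}_{δ,|s|}` and `v ∈ M^{p,q}_{r,s}` exists and lies in `M^{p,q}_{r+δ,s}`, with the norm
estimate.

Let `Vu`, `Vv` be the short-time Fourier transforms with windows `γ₀`, `γ₁`, and choose dual windows
with `∫ h₀ γ₀ = ∫ h₁ γ₁ = 1`. The reproducing formula `clm_apply_eq_integral_tfCoeff_smul` writes
each distribution as a superposition of time-frequency shifts, so that formally `(u • v)(φ) = ∫∫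
K_φ(z, z') B(Vu z, Vv z') dz dz'`. Here `K_φ` is an inverse Fourier transform of `φ · h₀(· - x) ·
h₁(· - x')` evaluated at `ξ + ξ'`, hence decays rapidly in `x`, `x'` and `ξ + ξ'`.

The definition of the product by mollification fits this formula: by `mollifiedKernel_eq`,
mollifying only averages `K_φ` over small shifts of `x` and `x'`, with unimodular phases. The
mollified kernels thus converge pointwise and obey one rapidly decreasing bound for all `ε ≤ 1`.
Dominated convergence yields existence of the product and the formula for it, as soon as the bound
is integrable against `‖Vu‖ ‖Vv‖` (`exists_isDistribProduct`).

For the estimate, test with a time-frequency shift by `(x₀, ξ₀)`, which centres the decay of the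
kernel at `x = x' = x₀`, `ξ + ξ' = ξ₀`. Peetre's inequality moves `⟨x₀⟩^δ` to `x`, `⟨x₀⟩^r` to `x'`
and `⟨ξ₀⟩^s` to `⟨ξ⟩^{|s|} ⟨ξ'⟩^s`, at the expense of finitely many powers of the decay. With the
supremum over `x` of the weighted `Vu` taken at each `ξ`, the weighted transform of the product is
bounded by a superposition of translates of the weighted `Vv`, with respect to a measure of total
mass at most a constant times the norm of `u`. Minkowski's inequality and translation invariance of
mixed Lebesgue norms conclude (`exists_isDistribProduct_mixedNorm_le`). No equivalence of norms for
different windows is needed. -/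

/-! ### Schwartz seminorms, translations and multiplication by translates -/

section SchwartzNorms

variable {d : ℕ}

/-- The supremum of the Schwartz seminorms of orders `(k, n)` with `k, n ≤ m`. -/
noncomputable def schwartzNorm (d m : ℕ) : Seminorm ℂ 𝓢(Rd d, ℂ) :=
  (Finset.Iic (m, m)).sup (schwartzSeminormFamily ℂ (Rd d) ℂ)

theorem schwartzNorm_nonneg (m : ℕ) (φ : 𝓢(Rd d, ℂ)) : 0 ≤ schwartzNorm d m φ :=
  apply_nonneg _ _

theorem one_add_pow_mul_norm_iteratedFDeriv_le (φ : 𝓢(Rd d, ℂ)) {k n m : ℕ} (hk : k ≤ m)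
    (hn : n ≤ m) (y : Rd d) :
    (1 + ‖y‖) ^ k * ‖iteratedFDeriv ℝ n φ y‖ ≤ 2 ^ m * schwartzNorm d m φ :=
  one_add_le_sup_seminorm_apply (𝕜 := ℂ) (m := (m, m)) hk hn φ y

theorem one_add_pow_mul_norm_le (φ : 𝓢(Rd d, ℂ)) (m : ℕ) (y : Rd d) :
    (1 + ‖y‖) ^ m * ‖φ y‖ ≤ 2 ^ m * schwartzNorm d m φ := by
  have h := one_add_pow_mul_norm_iteratedFDeriv_le φ le_rfl (Nat.zero_le m) y
  rwa [norm_iteratedFDeriv_zero] at h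

theorem schwartzNorm_le_of_bound {m : ℕ} {φ : 𝓢(Rd d, ℂ)} {M : ℝ} (hM : 0 ≤ M)
    (h : ∀ k ≤ m, ∀ n ≤ m, ∀ y, ‖y‖ ^ k * ‖iteratedFDeriv ℝ n φ y‖ ≤ M) :
    schwartzNorm d m φ ≤ M := by
  refine Seminorm.finset_sup_apply_le hM fun i hi => ?_
  have hi' := Finset.mem_Iic.1 hi
  exact seminorm_le_bound ℂ i.1 i.2 φ hM (h i.1 hi'.1 i.2 hi'.2)

theorem schwartzNorm_mono {m m' : ℕ} (h : m ≤ m') (φ : 𝓢(Rd d, ℂ)) :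
    schwartzNorm d m φ ≤ schwartzNorm d m' φ :=
  Finset.sup_mono (f := schwartzSeminormFamily ℂ (Rd d) ℂ)
    (Finset.Iic_subset_Iic.2 (Prod.mk_le_mk.2 ⟨h, h⟩)) φ

theorem continuous_schwartzNorm (d m : ℕ) : Continuous (schwartzNorm d m) :=
  Seminorm.continuous_finsetSup fun i _ =>
    (schwartz_withSeminorms ℂ (Rd d) ℂ).continuous_seminorm i

/-- A finite set of index pairs lies below some `(m, m)`, so the increasing sequence `schwartzNorm d
m` is cofinal among continuous seminorms. -/
theorem exists_le_schwartzNorm (q : Seminorm ℂ 𝓢(Rd d, ℂ)) (hq : Continuous q) :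
    ∃ (m : ℕ) (C : ℝ), 0 ≤ C ∧ ∀ φ, q φ ≤ C * schwartzNorm d m φ := by
  obtain ⟨s, C, -, hC⟩ := Seminorm.bound_of_continuous (schwartz_withSeminorms ℂ (Rd d) ℂ) q hq
  obtain ⟨b, hb⟩ := s.bddAbove
  refine ⟨max b.1 b.2, C, C.2, fun φ => (hC φ).trans ?_⟩
  have : s.sup (schwartzSeminormFamily ℂ (Rd d) ℂ) ≤ schwartzNorm d (max b.1 b.2) :=
    Finset.sup_mono fun i hi => Finset.mem_Iic.2
      ⟨(hb hi).1.trans (le_max_left _ _), (hb hi).2.trans (le_max_right _ _)⟩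
  exact mul_le_mul_of_nonneg_left (this φ) C.2

theorem exists_norm_le_schwartzNorm {E : Type*} [NormedAddCommGroup E] [NormedSpace ℂ E]
    (v : 𝓢(Rd d, ℂ) →L[ℂ] E) :
    ∃ (m : ℕ) (C : ℝ), 0 ≤ C ∧ ∀ φ, ‖v φ‖ ≤ C * schwartzNorm d m φ :=
  exists_le_schwartzNorm ((normSeminorm ℂ E).comp v.toLinearMap) (by
    change Continuous fun φ => ‖v φ‖
    fun_prop)

theorem exists_schwartzNorm_map_le (T : 𝓢(Rd d, ℂ) →L[ℂ] 𝓢(Rd d, ℂ)) (m : ℕ) :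
    ∃ (m' : ℕ) (C : ℝ), 0 ≤ C ∧ ∀ φ, schwartzNorm d m (T φ) ≤ C * schwartzNorm d m' φ :=
  exists_le_schwartzNorm ((schwartzNorm d m).comp T.toLinearMap)
    ((continuous_schwartzNorm d m).comp T.continuous)

theorem tendsto_of_tendsto_schwartzNorm {X : Type*} {l : Filter X} {Φ : X → 𝓢(Rd d, ℂ)}
    {φ : 𝓢(Rd d, ℂ)} (h : ∀ m, Tendsto (fun x => schwartzNorm d m (Φ x - φ)) l (𝓝 0)) :
    Tendsto Φ l (𝓝 φ) := by
  refine ((schwartz_withSeminorms ℂ (Rd d) ℂ).tendsto_nhds Φ φ).2 fun i ε hε => ?_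
  filter_upwards [(h (max i.1 i.2)).eventually (gt_mem_nhds hε)] with x hx
  refine lt_of_le_of_lt ?_ hx
  exact Finset.le_sup (f := schwartzSeminormFamily ℂ (Rd d) ℂ)
    (Finset.mem_Iic.2 (show i ≤ (max i.1 i.2, max i.1 i.2) from
      ⟨le_max_left _ _, le_max_right _ _⟩)) (Φ x - φ)

theorem one_add_norm_le_mul (x y : Rd d) : 1 + ‖y‖ ≤ (1 + ‖y - x‖) * (1 + ‖x‖) := by
  have : ‖y‖ ≤ ‖y - x‖ + ‖x‖ := by simpa using norm_add_le (y - x) x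
  nlinarith [norm_nonneg (y - x), norm_nonneg x]

theorem iteratedFDeriv_compSubConst (ψ : 𝓢(Rd d, ℂ)) (n : ℕ) (x y : Rd d) :
    iteratedFDeriv ℝ n (compSubConstCLM ℂ x ψ) y = iteratedFDeriv ℝ n ψ (y - x) := by
  have : (compSubConstCLM ℂ x ψ : Rd d → ℂ) = fun y => ψ (y - x) := by
    ext y; simp
  rw [this, iteratedFDeriv_comp_sub]

theorem schwartzNorm_compSubConst_le (m : ℕ) (x : Rd d) (ψ : 𝓢(Rd d, ℂ)) :
    schwartzNorm d m (compSubConstCLM ℂ x ψ) ≤ 2 ^ m * (1 + ‖x‖) ^ m * schwartzNorm d m ψ := by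
  have h0 := schwartzNorm_nonneg m ψ
  refine schwartzNorm_le_of_bound (by positivity) fun k hk n hn y => ?_
  rw [iteratedFDeriv_compSubConst]
  calc ‖y‖ ^ k * ‖iteratedFDeriv ℝ n ψ (y - x)‖
      ≤ ((1 + ‖y - x‖) * (1 + ‖x‖)) ^ k * ‖iteratedFDeriv ℝ n ψ (y - x)‖ := by
        gcongr
        linarith [one_add_norm_le_mul x y]
    _ = (1 + ‖x‖) ^ k * ((1 + ‖y - x‖) ^ k * ‖iteratedFDeriv ℝ n ψ (y - x)‖) := by
        rw [mul_pow]; ring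
    _ ≤ (1 + ‖x‖) ^ m * (2 ^ m * schwartzNorm d m ψ) :=
        mul_le_mul (pow_le_pow_right₀ (by linarith [norm_nonneg x]) hk)
          (one_add_pow_mul_norm_iteratedFDeriv_le ψ hk hn _) (by positivity) (by positivity)
    _ = _ := by ring

/-- Mean value inequality on the unit ball around `y`: it costs one derivative, and the weight at
`y` is controlled by `1 + ‖w‖` for `w` in that ball. -/
theorem schwartzNorm_compSubConst_sub_le (m : ℕ) {x : Rd d} (hx : ‖x‖ ≤ 1) (ψ : 𝓢(Rd d, ℂ)) :
    schwartzNorm d m (compSubConstCLM ℂ x ψ - ψ)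
      ≤ 2 ^ (m + 1) * schwartzNorm d (m + 1) ψ * ‖x‖ := by
  have h0 := schwartzNorm_nonneg (m + 1) ψ
  refine schwartzNorm_le_of_bound (by positivity) fun k hk n hn y => ?_
  have h1 : iteratedFDeriv ℝ n (compSubConstCLM ℂ x ψ - ψ : 𝓢(Rd d, ℂ)) y
      = iteratedFDeriv ℝ n ψ (y - x) - iteratedFDeriv ℝ n ψ y := by
    rw [← iteratedFDeriv_compSubConst]
    exact iteratedFDeriv_sub_apply ((compSubConstCLM ℂ x ψ).contDiffAt _) (ψ.contDiffAt _)
  have hdiff : Differentiable ℝ (iteratedFDeriv ℝ n ψ) :=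
    (ψ.smooth ⊤).differentiable_iteratedFDeriv (mod_cast WithTop.coe_lt_top _)
  have hseg : Convex ℝ (Metric.closedBall y 1) := convex_closedBall y 1
  -- The weight `‖y‖ ^ k` is frozen at the centre, so that only the derivative of `ψ` is
  -- differentiated.
  have hmv := hseg.norm_image_sub_le_of_norm_fderiv_le (𝕜 := ℝ)
    (f := fun w => ‖y‖ ^ k • iteratedFDeriv ℝ n ψ w)
    (C := 2 ^ (m + 1) * schwartzNorm d (m + 1) ψ) (x := y) (y := y - x)
    (fun w _ => (hdiff w).fun_const_smul _) (fun w hw => ?_) (by simp) (by simpa using hx)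
  · rw [← smul_sub, norm_smul, norm_pow, norm_norm] at hmv
    rw [h1]
    simpa using hmv
  · rw [fderiv_fun_const_smul (hdiff w), norm_smul, norm_pow, norm_norm,
      norm_fderiv_iteratedFDeriv]
    refine le_trans ?_ (one_add_pow_mul_norm_iteratedFDeriv_le ψ (k := k) (n := n + 1)
      (m := m + 1) (by omega) (by omega) w)
    gcongr
    have h2 : ‖w - y‖ ≤ 1 := by simpa [dist_eq_norm] using hw
    have h3 := norm_sub_norm_le y w
    rw [norm_sub_rev] at h3
    linarith

theorem tendsto_compSubConst (ψ : 𝓢(Rd d, ℂ)) (x₀ : Rd d) :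
    Tendsto (fun x => compSubConstCLM ℂ x ψ) (𝓝 x₀) (𝓝 (compSubConstCLM ℂ x₀ ψ)) := by
  refine tendsto_of_tendsto_schwartzNorm fun m => ?_
  have hlim : Tendsto (fun x : Rd d => 2 ^ m * (1 + ‖x₀‖) ^ m *
      (2 ^ (m + 1) * schwartzNorm d (m + 1) ψ * ‖x - x₀‖)) (𝓝 x₀) (𝓝 0) := by
    have : Continuous (fun x : Rd d => 2 ^ m * (1 + ‖x₀‖) ^ m *
      (2 ^ (m + 1) * schwartzNorm d (m + 1) ψ * ‖x - x₀‖)) := by fun_prop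
    simpa using this.tendsto x₀
  refine squeeze_zero' (Eventually.of_forall fun x => schwartzNorm_nonneg _ _) ?_ hlim
  filter_upwards [Metric.closedBall_mem_nhds x₀ one_pos] with x hx
  have hx' : ‖x - x₀‖ ≤ 1 := by simpa [dist_eq_norm] using hx
  have h1 : compSubConstCLM ℂ x ψ - compSubConstCLM ℂ x₀ ψ
      = compSubConstCLM ℂ x₀ (compSubConstCLM ℂ (x - x₀) ψ - ψ) := by
    ext y
    simp
  rw [h1]
  refine (schwartzNorm_compSubConst_le _ _ _).trans ?_
  gcongr
  exact schwartzNorm_compSubConst_sub_le m hx' ψ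

theorem continuous_compSubConst_comp {X : Type*} [TopologicalSpace X] {f : X → Rd d}
    {Ψ : X → 𝓢(Rd d, ℂ)} (hf : Continuous f) (hΨ : Continuous Ψ) :
    Continuous fun p => compSubConstCLM ℂ (f p) (Ψ p) := by
  refine continuous_iff_continuousAt.2 fun p₀ => tendsto_of_tendsto_schwartzNorm fun m => ?_
  have h1 : Tendsto (fun p => 2 ^ m * (1 + ‖f p‖) ^ m * schwartzNorm d m (Ψ p - Ψ p₀))
      (𝓝 p₀) (𝓝 0) := by
    have hc : Continuous
        (fun p => 2 ^ m * (1 + ‖f p‖) ^ m * schwartzNorm d m (Ψ p - Ψ p₀)) := by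
      have := (continuous_schwartzNorm d m).comp (hΨ.sub (continuous_const (y := Ψ p₀)))
      exact (continuous_const.mul ((continuous_const.add hf.norm).pow m)).mul this
    simpa using hc.tendsto p₀
  have h2 : Tendsto (fun p => schwartzNorm d m
      (compSubConstCLM ℂ (f p) (Ψ p₀) - compSubConstCLM ℂ (f p₀) (Ψ p₀))) (𝓝 p₀) (𝓝 0) := by
    have := ((tendsto_compSubConst (Ψ p₀) (f p₀)).comp (hf.tendsto p₀)).sub_const
      (compSubConstCLM ℂ (f p₀) (Ψ p₀))
    rw [sub_self] at this
    simpa [Function.comp_def] using ((continuous_schwartzNorm d m).tendsto 0).comp this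
  have h3 := h1.add h2
  rw [add_zero] at h3
  refine squeeze_zero (fun p => schwartzNorm_nonneg _ _) (fun p => ?_) h3
  have h4 : compSubConstCLM ℂ (f p) (Ψ p) - compSubConstCLM ℂ (f p₀) (Ψ p₀)
      = compSubConstCLM ℂ (f p) (Ψ p - Ψ p₀)
        + (compSubConstCLM ℂ (f p) (Ψ p₀) - compSubConstCLM ℂ (f p₀) (Ψ p₀)) := by
    rw [map_sub]; abel
  rw [h4]
  refine (map_add_le_add _ _ _).trans ?_
  gcongr
  exact schwartzNorm_compSubConst_le _ _ _

/-- Multiplication of Schwartz functions by the translate `h (· - x)`. -/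
noncomputable def mulShift (h : 𝓢(Rd d, ℂ)) (x : Rd d) : 𝓢(Rd d, ℂ) →L[ℂ] 𝓢(Rd d, ℂ) :=
  pairing (ContinuousLinearMap.mul ℂ ℂ) (compSubConstCLM ℂ x h)

theorem mulShift_apply (h : 𝓢(Rd d, ℂ)) (x : Rd d) (φ : 𝓢(Rd d, ℂ)) (y : Rd d) :
    mulShift h x φ y = h (y - x) * φ y := by
  simp [mulShift]

/-- Since `1 + ‖x‖ ≤ (1 + ‖y - x‖) (1 + ‖y‖)`, the polynomial weight in `x` can be shared between `h
(y - x)` and `φ y` in each term of the Leibniz formula. The price is `N` further orders of the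
seminorm of `φ`. -/
theorem schwartzNorm_mulShift_le (h : 𝓢(Rd d, ℂ)) (m N : ℕ) :
    ∃ C : ℝ, 0 ≤ C ∧ ∀ (x : Rd d) (φ : 𝓢(Rd d, ℂ)),
      (1 + ‖x‖) ^ N * schwartzNorm d m (mulShift h x φ) ≤ C * schwartzNorm d (m + N) φ := by
  have hh := schwartzNorm_nonneg (m + N) h
  refine ⟨2 ^ m * ((2 ^ (m + N) * schwartzNorm d (m + N) h) * 2 ^ (m + N)), by positivity,
    fun x φ => ?_⟩
  have hφ := schwartzNorm_nonneg (m + N) φ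
  rw [mul_comm, ← le_div_iff₀ (by positivity)]
  refine schwartzNorm_le_of_bound (by positivity) fun k hk n hn y => ?_
  rw [le_div_iff₀ (by positivity)]
  have h1 : ‖iteratedFDeriv ℝ n (mulShift h x φ) y‖ ≤ ∑ i ∈ Finset.range (n + 1),
      (n.choose i : ℝ) * ‖iteratedFDeriv ℝ i h (y - x)‖ * ‖iteratedFDeriv ℝ (n - i) φ y‖ := by
    have h2 : (mulShift h x φ : Rd d → ℂ) = fun y => (compSubConstCLM ℂ x h) y * φ y := by
      ext y; simp [mulShift]
    rw [h2]
    refine (norm_iteratedFDeriv_mul_le ((compSubConstCLM ℂ x h).smooth ⊤) (φ.smooth ⊤) y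
      (n := n) (mod_cast le_top)).trans (le_of_eq ?_)
    simp only [iteratedFDeriv_compSubConst]
  have h3 : (1 + ‖x‖) ≤ (1 + ‖y - x‖) * (1 + ‖y‖) := by
    have := one_add_norm_le_mul y x
    rwa [norm_sub_rev] at this
  calc ‖y‖ ^ k * ‖iteratedFDeriv ℝ n (mulShift h x φ) y‖ * (1 + ‖x‖) ^ N
      ≤ (1 + ‖y‖) ^ k * (∑ i ∈ Finset.range (n + 1),
          (n.choose i : ℝ) * ‖iteratedFDeriv ℝ i h (y - x)‖ * ‖iteratedFDeriv ℝ (n - i) φ y‖)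
          * ((1 + ‖y - x‖) * (1 + ‖y‖)) ^ N := by
        gcongr
        linarith
    _ = ∑ i ∈ Finset.range (n + 1), (n.choose i : ℝ) *
          (((1 + ‖y - x‖) ^ N * ‖iteratedFDeriv ℝ i h (y - x)‖) *
          ((1 + ‖y‖) ^ (k + N) * ‖iteratedFDeriv ℝ (n - i) φ y‖)) := by
        rw [Finset.mul_sum, Finset.sum_mul]
        refine Finset.sum_congr rfl fun i _ => ?_
        rw [mul_pow, pow_add]
        ring
    _ ≤ ∑ i ∈ Finset.range (n + 1), (n.choose i : ℝ) *
          ((2 ^ (m + N) * schwartzNorm d (m + N) h) *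
          (2 ^ (m + N) * schwartzNorm d (m + N) φ)) := by
        refine Finset.sum_le_sum fun i hi => ?_
        have hi' : i ≤ n := Nat.lt_succ_iff.1 (Finset.mem_range.1 hi)
        exact mul_le_mul_of_nonneg_left (mul_le_mul
          (one_add_pow_mul_norm_iteratedFDeriv_le h (by omega) (by omega) _)
          (one_add_pow_mul_norm_iteratedFDeriv_le φ (by omega) (by omega) _)
          (by positivity) (by positivity)) (by positivity)
    _ = 2 ^ n * ((2 ^ (m + N) * schwartzNorm d (m + N) h) *
          (2 ^ (m + N) * schwartzNorm d (m + N) φ)) := by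
        rw [← Finset.sum_mul]
        congr 1
        exact_mod_cast Nat.sum_range_choose n
    _ ≤ 2 ^ m * ((2 ^ (m + N) * schwartzNorm d (m + N) h) *
          (2 ^ (m + N) * schwartzNorm d (m + N) φ)) := by
        gcongr
        norm_num
    _ = _ := by ring

end SchwartzNorms

/-! ### Characters and the Fourier transform of Schwartz functions -/

section Characters

variable {d : ℕ}

@[simp]
theorem norm_negCharacter (ξ y : Rd d) : ‖negCharacter ξ y‖ = 1 :=
  Complex.norm_exp_ofReal_mul_I _

theorem negCharacter_comm (ξ y : Rd d) : negCharacter ξ y = negCharacter y ξ := by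
  simp only [negCharacter, real_inner_comm]

theorem negCharacter_add_left (ξ η y : Rd d) :
    negCharacter (ξ + η) y = negCharacter ξ y * negCharacter η y := by
  simp only [negCharacter, ← Complex.exp_add, inner_add_right]
  congr 1
  push_cast
  ring

theorem negCharacter_add_right (ξ x y : Rd d) :
    negCharacter ξ (x + y) = negCharacter ξ x * negCharacter ξ y := by
  simp only [negCharacter_comm ξ, negCharacter_add_left]

theorem negCharacter_neg_left (ξ y : Rd d) : negCharacter (-ξ) y = negCharacter ξ (-y) := by
  simp [negCharacter]

@[simp]
theorem negCharacter_zero_left (y : Rd d) : negCharacter 0 y = 1 := by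
  simp [negCharacter]

theorem continuous_negCharacter : Continuous fun p : Rd d × Rd d => negCharacter p.1 p.2 := by
  unfold negCharacter
  fun_prop

@[fun_prop]
theorem Continuous.negCharacter {X : Type*} [TopologicalSpace X] {f g : X → Rd d}
    (hf : Continuous f) (hg : Continuous g) : Continuous fun x => negCharacter (f x) (g x) :=
  continuous_negCharacter.comp (hf.prodMk hg)

theorem fourierInv_schwartz_apply (φ : 𝓢(Rd d, ℂ)) (t : Rd d) :
    (𝓕⁻ φ) t = ∫ y, negCharacter (-t) y * φ y := by
  rw [fourierInv_coe, Real.fourierInv_eq']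
  refine integral_congr_ae (Eventually.of_forall fun y => ?_)
  simp [negCharacter, inner_neg_right]

theorem fourier_schwartz_apply (φ : 𝓢(Rd d, ℂ)) (t : Rd d) :
    (𝓕 φ) t = ∫ y, negCharacter t y * φ y := by
  rw [fourier_coe, Real.fourier_eq']
  refine integral_congr_ae (Eventually.of_forall fun y => ?_)
  simp [negCharacter]

end Characters

/-! ### Time-frequency shifts and Fourier coefficients of localized test functions -/

section TimeFrequencyShifts

variable {d : ℕ}

/-- The test function `y ↦ exp (-2πi y·ξ) * γ (y - x)`. -/
noncomputable def tfShift (γ : 𝓢(Rd d, ℂ)) (x ξ : Rd d) : 𝓢(Rd d, ℂ) :=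
  smulLeftCLM ℂ (negCharacter ξ) (compSubConstCLM ℂ x γ)

theorem tfShift_apply (γ : 𝓢(Rd d, ℂ)) (x ξ y : Rd d) :
    tfShift γ x ξ y = negCharacter ξ y * γ (y - x) := by
  simp [tfShift, smulLeftCLM_apply_apply (hasTemperateGrowth_negCharacter ξ)]

theorem fourierInv_tfShift (γ : 𝓢(Rd d, ℂ)) (x ξ : Rd d) :
    𝓕⁻ (tfShift γ x ξ) = negCharacter ξ x • tfShift (𝓕⁻ γ) ξ (-x) := by
  ext t
  have h : (𝓕⁻ (tfShift γ x ξ)) t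
      = ∫ y, negCharacter (-t) (y + x) * tfShift γ x ξ (y + x) := by
    rw [fourierInv_schwartz_apply]
    exact (integral_add_right_eq_self (fun y => negCharacter (-t) y * tfShift γ x ξ y) x).symm
  rw [h]
  simp only [_root_.smul_apply, tfShift_apply, smul_eq_mul]
  rw [fourierInv_schwartz_apply, ← integral_const_mul, ← integral_const_mul]
  refine integral_congr_ae (Eventually.of_forall fun y => ?_)
  have h1 : -(t - ξ) = -t + ξ := by abel
  simp only [add_sub_cancel_right, h1, negCharacter_add_right, negCharacter_add_left]
  rw [negCharacter_neg_left t x, negCharacter_comm t (-x)]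
  ring

theorem tfShift_zero_right (γ : 𝓢(Rd d, ℂ)) (x : Rd d) :
    tfShift γ x 0 = compSubConstCLM ℂ x γ := by
  ext y
  simp [tfShift_apply]

/-- Modulation is translation conjugated by the Fourier transform. Continuity and polynomial growth
of modulations on the Schwartz space are thereby reduced to those of translations. -/
theorem tfShift_zero_left (γ : 𝓢(Rd d, ℂ)) (ξ : Rd d) :
    tfShift γ 0 ξ = 𝓕 (compSubConstCLM ℂ ξ (𝓕⁻ γ)) := by
  have h := fourierInv_tfShift γ 0 ξ
  rw [neg_zero, negCharacter_comm, negCharacter_zero_left, one_smul, tfShift_zero_right] at h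
  rw [← h, FourierTransform.fourier_fourierInv_eq]

theorem tfShift_eq (γ : 𝓢(Rd d, ℂ)) (x ξ : Rd d) :
    tfShift γ x ξ = negCharacter ξ x • compSubConstCLM ℂ x (tfShift γ 0 ξ) := by
  ext y
  simp only [tfShift_apply, _root_.smul_apply, compSubConstCLM_apply, sub_zero, smul_eq_mul]
  rw [← mul_assoc, ← negCharacter_add_right]
  simp

theorem continuous_tfShift (γ : 𝓢(Rd d, ℂ)) :
    Continuous fun p : Rd d × Rd d => tfShift γ p.1 p.2 := by
  have h : Continuous fun p : Rd d × Rd d => compSubConstCLM ℂ p.1 (tfShift γ 0 p.2) := by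
    refine continuous_compSubConst_comp continuous_fst ?_
    simp only [tfShift_zero_left]
    exact (fourierCLM ℂ 𝓢(Rd d, ℂ)).continuous.comp
      (continuous_compSubConst_comp continuous_snd continuous_const)
  have h1 : (fun p : Rd d × Rd d => tfShift γ p.1 p.2)
      = fun p => negCharacter p.2 p.1 • compSubConstCLM ℂ p.1 (tfShift γ 0 p.2) :=
    funext fun p => tfShift_eq γ p.1 p.2
  rw [h1]
  have h2 : Continuous fun p : Rd d × Rd d => negCharacter p.2 p.1 := by fun_prop
  exact h2.smul h

theorem exists_schwartzNorm_tfShift_le (γ : 𝓢(Rd d, ℂ)) (m : ℕ) :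
    ∃ (N : ℕ) (C : ℝ), 0 ≤ C ∧ ∀ x ξ : Rd d,
      schwartzNorm d m (tfShift γ x ξ) ≤ C * (1 + ‖x‖) ^ N * (1 + ‖ξ‖) ^ N := by
  obtain ⟨m', C, hC, h⟩ := exists_schwartzNorm_map_le (fourierCLM ℂ 𝓢(Rd d, ℂ)) m
  have h0 := schwartzNorm_nonneg m' (𝓕⁻ γ)
  refine ⟨max m m', 2 ^ m * (C * (2 ^ m' * schwartzNorm d m' (𝓕⁻ γ))), by positivity,
    fun x ξ => ?_⟩
  rw [tfShift_eq, map_smul_eq_mul, norm_negCharacter, one_mul]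
  have hx : (1 + ‖x‖) ^ m ≤ (1 + ‖x‖) ^ max m m' :=
    pow_le_pow_right₀ (by linarith [norm_nonneg x]) (le_max_left _ _)
  have hξ : (1 + ‖ξ‖) ^ m' ≤ (1 + ‖ξ‖) ^ max m m' :=
    pow_le_pow_right₀ (by linarith [norm_nonneg ξ]) (le_max_right _ _)
  calc schwartzNorm d m (compSubConstCLM ℂ x (tfShift γ 0 ξ))
      ≤ 2 ^ m * (1 + ‖x‖) ^ m * schwartzNorm d m (tfShift γ 0 ξ) :=
        schwartzNorm_compSubConst_le _ _ _
    _ ≤ 2 ^ m * (1 + ‖x‖) ^ m *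
          (C * (2 ^ m' * (1 + ‖ξ‖) ^ m' * schwartzNorm d m' (𝓕⁻ γ))) := by
        rw [tfShift_zero_left]
        gcongr
        refine (h _).trans ?_
        gcongr
        exact schwartzNorm_compSubConst_le _ _ _
    _ ≤ 2 ^ m * (1 + ‖x‖) ^ max m m' *
          (C * (2 ^ m' * (1 + ‖ξ‖) ^ max m m' * schwartzNorm d m' (𝓕⁻ γ))) := by
        gcongr
    _ = _ := by ring

theorem mulShift_tfShift (h γ : 𝓢(Rd d, ℂ)) (x x₀ ξ₀ : Rd d) :
    mulShift h x (tfShift γ x₀ ξ₀) = tfShift (mulShift h (x - x₀) γ) x₀ ξ₀ := by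
  ext y
  simp only [mulShift_apply, tfShift_apply, sub_sub_sub_cancel_right]
  ring

/-- The Fourier coefficient `∫ φ (y) h (y - x) exp (2πi y·ξ) dy`. -/
noncomputable def tfCoeff (h φ : 𝓢(Rd d, ℂ)) (x ξ : Rd d) : ℂ :=
  (𝓕⁻ (mulShift h x φ)) ξ

theorem tfCoeff_eq (h φ : 𝓢(Rd d, ℂ)) (x ξ : Rd d) :
    tfCoeff h φ x ξ = ∫ y, negCharacter (-ξ) y * (h (y - x) * φ y) := by
  rw [tfCoeff, fourierInv_schwartz_apply]
  simp only [mulShift_apply]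

/-- Covariance: shifting the test function in phase space only shifts the argument of its
coefficients, up to a phase. -/
theorem norm_tfCoeff_tfShift (h γ : 𝓢(Rd d, ℂ)) (x ξ x₀ ξ₀ : Rd d) :
    ‖tfCoeff h (tfShift γ x₀ ξ₀) x ξ‖ = ‖tfCoeff h γ (x - x₀) (ξ - ξ₀)‖ := by
  rw [tfCoeff, mulShift_tfShift, fourierInv_tfShift]
  simp [tfShift_apply, tfCoeff]

/-- Decay in `x` comes from the separation of `h (· - x)` and `φ`, decay in `ξ` from the inverse
Fourier transform being Schwartz, with seminorms controlled by those of the product. -/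
theorem exists_norm_tfCoeff_le (h : 𝓢(Rd d, ℂ)) (N : ℕ) :
    ∃ (m : ℕ) (C : ℝ), 0 ≤ C ∧ ∀ (φ : 𝓢(Rd d, ℂ)) (x ξ : Rd d),
      (1 + ‖x‖) ^ N * (1 + ‖ξ‖) ^ N * ‖tfCoeff h φ x ξ‖ ≤ C * schwartzNorm d m φ := by
  obtain ⟨m, C, hC, hm⟩ := exists_schwartzNorm_map_le (fourierInvCLM ℂ 𝓢(Rd d, ℂ)) N
  obtain ⟨C', hC', hm'⟩ := schwartzNorm_mulShift_le h m N
  refine ⟨m + N, 2 ^ N * (C * C'), by positivity, fun φ x ξ => ?_⟩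
  calc (1 + ‖x‖) ^ N * (1 + ‖ξ‖) ^ N * ‖tfCoeff h φ x ξ‖
      = (1 + ‖x‖) ^ N * ((1 + ‖ξ‖) ^ N * ‖tfCoeff h φ x ξ‖) := by ring
    _ ≤ (1 + ‖x‖) ^ N * (2 ^ N * (C * schwartzNorm d m (mulShift h x φ))) := by
        refine mul_le_mul_of_nonneg_left ((one_add_pow_mul_norm_le _ N ξ).trans ?_)
          (by positivity)
        exact mul_le_mul_of_nonneg_left (hm _) (by positivity)
    _ = 2 ^ N * (C * ((1 + ‖x‖) ^ N * schwartzNorm d m (mulShift h x φ))) := by ring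
    _ ≤ 2 ^ N * (C * (C' * schwartzNorm d (m + N) φ)) := by
        have := hm' x φ
        gcongr 2 ^ N * (C * ?_)
    _ = _ := by ring

theorem exists_norm_le (h : 𝓢(Rd d, ℂ)) : ∃ C : ℝ, 0 ≤ C ∧ ∀ y, ‖h y‖ ≤ C :=
  ⟨schwartzNorm d 0 h, schwartzNorm_nonneg 0 h, fun y => by
    simpa using one_add_pow_mul_norm_le h 0 y⟩

theorem continuous_tfCoeff_mulShift (h h' φ : 𝓢(Rd d, ℂ)) :
    Continuous fun p : Rd d × Rd d × Rd d => tfCoeff h (mulShift h' p.2.1 φ) p.1 p.2.2 := by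
  obtain ⟨C, hC, hh⟩ := exists_norm_le h
  obtain ⟨C', hC', hh'⟩ := exists_norm_le h'
  simp only [tfCoeff_eq, mulShift_apply]
  refine continuous_of_dominated (bound := fun y => C * (C' * ‖φ y‖))
    (fun p => Continuous.aestronglyMeasurable ?_)
    (fun p => Eventually.of_forall fun y => ?_) ?_ (Eventually.of_forall fun y => ?_)
  · fun_prop
  · rw [norm_mul, norm_negCharacter, one_mul, norm_mul, norm_mul]
    gcongr
    · exact hh _
    · exact hh' _
  · exact (φ.integrable.norm.const_mul _).const_mul _
  · fun_prop

theorem continuous_tfCoeff (h φ : 𝓢(Rd d, ℂ)) :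
    Continuous fun p : Rd d × Rd d => tfCoeff h φ p.1 p.2 := by
  obtain ⟨C, hC, hh⟩ := exists_norm_le h
  simp only [tfCoeff_eq]
  refine continuous_of_dominated (bound := fun y => C * ‖φ y‖)
    (fun p => Continuous.aestronglyMeasurable ?_)
    (fun p => Eventually.of_forall fun y => ?_) ?_ (Eventually.of_forall fun y => ?_)
  · fun_prop
  · rw [norm_mul, norm_negCharacter, one_mul, norm_mul]
    gcongr
    exact hh _
  · exact φ.integrable.norm.const_mul _
  · fun_prop

end TimeFrequencyShifts

attribute [irreducible] tfCoeff

/-! ### Interchanging distributions and integrals of Schwartz functions -/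

section IntegralOfSchwartz

open scoped BoundedContinuousFunction

variable {d : ℕ}

theorem norm_one_add_pow_smul_iteratedFDeriv_le (φ : 𝓢(Rd d, ℂ)) {m n : ℕ} (hn : n ≤ m)
    (y : Rd d) :
    ‖(1 + ‖y‖) ^ m • iteratedFDeriv ℝ n φ y‖ ≤ 2 ^ m * schwartzNorm d m φ := by
  rw [norm_smul, norm_pow, Real.norm_of_nonneg (by positivity)]
  exact one_add_pow_mul_norm_iteratedFDeriv_le φ le_rfl hn y

/-- The space of `ℝ`-multilinear forms on `ℝᵈ` with values in `ℂ`. -/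
abbrev MultilinForm (d n : ℕ) : Type := ContinuousMultilinearMap ℝ (fun _ : Fin n => Rd d) ℂ

/-- Tuples of bounded continuous functions with values in multilinear forms of order at most
`m`. -/
def DerivTuple (d m : ℕ) : Type := ∀ n : Fin (m + 1), Rd d →ᵇ MultilinForm d n

noncomputable instance (d m : ℕ) : NormedAddCommGroup (DerivTuple d m) :=
  inferInstanceAs (NormedAddCommGroup (∀ n : Fin (m + 1), Rd d →ᵇ MultilinForm d n))

noncomputable instance (d m : ℕ) : NormedSpace ℂ (DerivTuple d m) :=
  inferInstanceAs (NormedSpace ℂ (∀ n : Fin (m + 1), Rd d →ᵇ MultilinForm d n))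

instance (d m : ℕ) : CompleteSpace (DerivTuple d m) :=
  inferInstanceAs (CompleteSpace (∀ n : Fin (m + 1), Rd d →ᵇ MultilinForm d n))

/-- Evaluation of a component of a tuple at a point. -/
noncomputable def DerivTuple.eval {d m : ℕ} (n : Fin (m + 1)) (y : Rd d) :
    DerivTuple d m →L[ℂ] MultilinForm d n :=
  LinearMap.mkContinuous
    { toFun := fun F => F n y
      map_add' := fun _ _ => rfl
      map_smul' := fun _ _ => rfl } 1 (fun F => by
        rw [one_mul]
        exact ((F n).norm_coe_le_norm y).trans
          (norm_le_pi_norm (show ∀ n : Fin (m + 1), Rd d →ᵇ MultilinForm d n from F) n))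

theorem DerivTuple.ext {d m : ℕ} {F G : DerivTuple d m}
    (h : ∀ n y, DerivTuple.eval n y F = DerivTuple.eval n y G) : F = G :=
  funext fun n => BoundedContinuousFunction.ext fun y => h n y

theorem DerivTuple.norm_le {d m : ℕ} {F : DerivTuple d m} {C : ℝ} (hC : 0 ≤ C)
    (h : ∀ n y, ‖DerivTuple.eval n y F‖ ≤ C) : ‖F‖ ≤ C :=
  (pi_norm_le_iff_of_nonneg (x := show ∀ n : Fin (m + 1), Rd d →ᵇ MultilinForm d n from F) hC).2
    fun n => (BoundedContinuousFunction.norm_le hC).2 (h n)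

theorem DerivTuple.norm_eval_le {d m : ℕ} (n : Fin (m + 1)) (y : Rd d) (F : DerivTuple d m) :
    ‖DerivTuple.eval n y F‖ ≤ ‖F‖ :=
  ((F n).norm_coe_le_norm y).trans
    (norm_le_pi_norm (show ∀ n : Fin (m + 1), Rd d →ᵇ MultilinForm d n from F) n)

/-- The weighted derivatives of order at most `m` of a Schwartz function, as a tuple of bounded
continuous functions. -/
noncomputable def weightedDerivs (d m : ℕ) : 𝓢(Rd d, ℂ) →L[ℂ] DerivTuple d m :=
  mkCLMtoNormedSpace
    (fun φ (n : Fin (m + 1)) => BoundedContinuousFunction.ofNormedAddCommGroup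
      (fun y => (1 + ‖y‖) ^ m • iteratedFDeriv ℝ n φ y)
      (by
        have := (φ.smooth ⊤).continuous_iteratedFDeriv (m := n) (mod_cast le_top)
        fun_prop)
      (2 ^ m * schwartzNorm d m φ)
      (norm_one_add_pow_smul_iteratedFDeriv_le φ (Nat.lt_succ_iff.1 n.2)))
    (by
      intro f g
      refine DerivTuple.ext fun n y => ?_
      change (1 + ‖y‖) ^ m • iteratedFDeriv ℝ n (f + g : 𝓢(Rd d, ℂ)) y
        = (1 + ‖y‖) ^ m • iteratedFDeriv ℝ n f y + (1 + ‖y‖) ^ m • iteratedFDeriv ℝ n g y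
      rw [← smul_add]
      exact congrArg _ (iteratedFDeriv_add_apply (f.contDiffAt _) (g.contDiffAt _)))
    (by
      intro a f
      refine DerivTuple.ext fun n y => ?_
      change (1 + ‖y‖) ^ m • iteratedFDeriv ℝ n (a • f : 𝓢(Rd d, ℂ)) y
        = a • (1 + ‖y‖) ^ m • iteratedFDeriv ℝ n f y
      rw [smul_comm]
      exact congrArg _ (iteratedFDeriv_const_smul_apply (f.contDiffAt _)))
    ⟨Finset.Iic (m, m), 2 ^ m, by positivity, fun f =>
      DerivTuple.norm_le (mul_nonneg (by positivity) (apply_nonneg _ _)) fun n y =>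
        norm_one_add_pow_smul_iteratedFDeriv_le f (Nat.lt_succ_iff.1 n.2) y⟩

theorem eval_weightedDerivs (m : ℕ) (φ : 𝓢(Rd d, ℂ)) (n : Fin (m + 1)) (y : Rd d) :
    DerivTuple.eval n y (weightedDerivs d m φ) = (1 + ‖y‖) ^ m • iteratedFDeriv ℝ n φ y := rfl

theorem schwartzNorm_le_norm_weightedDerivs (m : ℕ) (φ : 𝓢(Rd d, ℂ)) :
    schwartzNorm d m φ ≤ ‖weightedDerivs d m φ‖ := by
  refine schwartzNorm_le_of_bound (norm_nonneg _) fun k hk n hn y => ?_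
  have h1 := DerivTuple.norm_eval_le ⟨n, Nat.lt_succ_iff.2 hn⟩ y (weightedDerivs d m φ)
  rw [eval_weightedDerivs, norm_smul, norm_pow, Real.norm_of_nonneg (by positivity)] at h1
  refine le_trans ?_ h1
  gcongr
  calc ‖y‖ ^ k ≤ (1 + ‖y‖) ^ k := by gcongr; linarith
    _ ≤ (1 + ‖y‖) ^ m := pow_le_pow_right₀ (by linarith [norm_nonneg y]) hk

/-- The functional is bounded by a single seminorm, so it is bounded on the image of the Schwartz
space in the Banach space `DerivTuple d m`, and Hahn–Banach extends it. Integrals of Schwartz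
functions can then be treated as Bochner integrals in that Banach space. -/
theorem exists_dual_weightedDerivs (l : 𝓢(Rd d, ℂ) →L[ℂ] ℂ) :
    ∃ (m : ℕ) (L : StrongDual ℂ (DerivTuple d m)),
      ∀ φ, L (weightedDerivs d m φ) = l φ := by
  obtain ⟨m, C, hC, hl⟩ := exists_norm_le_schwartzNorm l
  have hinj : Function.Injective (weightedDerivs d m).toLinearMap := by
    refine (injective_iff_map_eq_zero _).2 fun φ hφ => ?_
    have h1 := schwartzNorm_le_norm_weightedDerivs m φ
    have hφ' : weightedDerivs d m φ = 0 := hφ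
    rw [hφ', norm_zero] at h1
    ext y
    have h2 := (one_add_pow_mul_norm_le φ 0 y).trans
      (mul_le_mul_of_nonneg_left (schwartzNorm_mono (Nat.zero_le m) φ) (by positivity))
    simp only [pow_zero, one_mul] at h2
    simpa using norm_le_zero_iff.1 (h2.trans h1)
  let e := LinearEquiv.ofInjective (weightedDerivs d m).toLinearMap hinj
  let f : StrongDual ℂ (LinearMap.range (weightedDerivs d m).toLinearMap) :=
    (l.toLinearMap ∘ₗ e.symm.toLinearMap).mkContinuous C (by
      intro x
      obtain ⟨φ, rfl⟩ := e.surjective x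
      simp only [LinearMap.comp_apply, LinearEquiv.coe_coe, LinearEquiv.symm_apply_apply]
      refine (hl φ).trans ?_
      gcongr
      exact schwartzNorm_le_norm_weightedDerivs m φ)
  obtain ⟨L, hL, -⟩ := exists_extension_norm_eq _ f
  refine ⟨m, L, fun φ => ?_⟩
  have := hL (e φ)
  change L (weightedDerivs d m φ) = _ at this
  rw [this]
  change l (e.symm (e φ)) = l φ
  rw [LinearEquiv.symm_apply_apply]

variable {Z : Type*} [MeasurableSpace Z] [TopologicalSpace Z] [OpensMeasurableSpace Z]
  [SecondCountableTopology Z] {ν : Measure Z} {Φ : Z → 𝓢(Rd d, ℂ)} {φ : 𝓢(Rd d, ℂ)}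

theorem integrable_clm_comp {E : Type*} [NormedAddCommGroup E] [NormedSpace ℂ E]
    (v : 𝓢(Rd d, ℂ) →L[ℂ] E) (hΦ : Continuous Φ)
    (hint : ∀ m, Integrable (fun z => schwartzNorm d m (Φ z)) ν) :
    Integrable (fun z => v (Φ z)) ν := by
  obtain ⟨m, C, hC, hv⟩ := exists_norm_le_schwartzNorm v
  exact ((hint m).const_mul C).mono' (v.continuous.comp hΦ).aestronglyMeasurable
    (Eventually.of_forall fun z => hv _)

/-- Evaluation of the `n`-th derivative at a point. -/
noncomputable def iteratedFDerivEval (n : ℕ) (y : Rd d) :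
    𝓢(Rd d, ℂ) →L[ℂ] MultilinForm d n :=
  (((1 + ‖y‖) ^ n)⁻¹ : ℝ) • ((DerivTuple.eval (Fin.last n) y).comp (weightedDerivs d n))

theorem iteratedFDerivEval_apply (n : ℕ) (y : Rd d) (ψ : 𝓢(Rd d, ℂ)) :
    iteratedFDerivEval n y ψ = iteratedFDeriv ℝ n ψ y := by
  have h : (1 + ‖y‖) ^ n ≠ 0 := by positivity
  change ((1 + ‖y‖) ^ n)⁻¹ • ((1 + ‖y‖) ^ n • iteratedFDeriv ℝ n ψ y) = _
  rw [smul_smul, inv_mul_cancel₀ h, one_smul]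

/-- Integrability of every seminorm of `Φ` provides the dominating functions for repeated
differentiation under the integral, so the pointwise identity for `φ` passes to all derivatives. -/
theorem iteratedFDeriv_eq_integral (hΦ : Continuous Φ)
    (hint : ∀ m, Integrable (fun z => schwartzNorm d m (Φ z)) ν)
    (hφ : ∀ y, φ y = ∫ z, Φ z y ∂ν) (n : ℕ) :
    ∀ y, iteratedFDeriv ℝ n φ y = ∫ z, iteratedFDeriv ℝ n (Φ z) y ∂ν := by
  have hI : ∀ n y, Integrable (fun z => iteratedFDeriv ℝ n (Φ z) y) ν := fun n y => by
    simpa only [iteratedFDerivEval_apply] using integrable_clm_comp (iteratedFDerivEval n y) hΦ hint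
  induction n with
  | zero =>
    intro y
    ext t
    rw [ContinuousMultilinearMap.integral_apply (hI 0 y)]
    simpa using hφ y
  | succ n ih =>
    intro y
    let c : MultilinForm d (n + 1) ≃ₗᵢ[ℝ] (Rd d →L[ℝ] MultilinForm d n) :=
      continuousMultilinearCurryLeftEquiv ℝ (fun _ : Fin (n + 1) => Rd d) ℂ
    have hfd : ∀ (ψ : 𝓢(Rd d, ℂ)) (w : Rd d),
        fderiv ℝ (iteratedFDeriv ℝ n ψ) w = c (iteratedFDeriv ℝ (n + 1) ψ w) := by
      intro ψ w
      rw [iteratedFDeriv_succ_eq_comp_left, Function.comp_apply]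
      exact (c.apply_symm_apply _).symm
    have hdiff : ∀ ψ : 𝓢(Rd d, ℂ), Differentiable ℝ (iteratedFDeriv ℝ n ψ) := fun ψ =>
      (ψ.smooth ⊤).differentiable_iteratedFDeriv (mod_cast WithTop.coe_lt_top _)
    have hder : HasFDerivAt (fun w => ∫ z, iteratedFDeriv ℝ n (Φ z) w ∂ν)
        (∫ z, c (iteratedFDeriv ℝ (n + 1) (Φ z) y) ∂ν) y := by
      refine hasFDerivAt_integral_of_dominated_of_fderiv_le (𝕜 := ℝ) (s := Set.univ)
        (F := fun w z => iteratedFDeriv ℝ n (Φ z) w)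
        (F' := fun w z => c (iteratedFDeriv ℝ (n + 1) (Φ z) w))
        (bound := fun z => 2 ^ (n + 1) * schwartzNorm d (n + 1) (Φ z)) univ_mem
        (Eventually.of_forall fun w => (hI n w).aestronglyMeasurable) (hI n y) ?_
        (Eventually.of_forall fun z w _ => ?_) ((hint _).const_mul _)
        (Eventually.of_forall fun z w _ => ?_)
      · exact c.continuous.comp_aestronglyMeasurable (hI (n + 1) y).aestronglyMeasurable
      · rw [LinearIsometryEquiv.norm_map]
        simpa using one_add_pow_mul_norm_iteratedFDeriv_le (Φ z) (Nat.zero_le _) le_rfl w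
      · rw [← hfd]
        exact (hdiff _ w).hasFDerivAt
    have h2 := hder.fderiv
    rw [← funext ih, hfd] at h2
    apply c.injective
    rw [h2]
    exact ContinuousLinearEquiv.integral_comp_comm (𝕜 := ℝ) (E := MultilinForm d (n + 1))
      (F := Rd d →L[ℝ] MultilinForm d n) c.toContinuousLinearEquiv
      (fun z => iteratedFDeriv ℝ (n + 1) (Φ z) y)

/-- A continuous linear map on the Schwartz space commutes with absolutely convergent integrals of
Schwartz functions. -/
theorem clm_apply_eq_integral {E : Type*} [NormedAddCommGroup E] [NormedSpace ℂ E]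
    [CompleteSpace E] (v : 𝓢(Rd d, ℂ) →L[ℂ] E) (hΦ : Continuous Φ)
    (hint : ∀ m, Integrable (fun z => schwartzNorm d m (Φ z)) ν)
    (hφ : ∀ y, φ y = ∫ z, Φ z y ∂ν) : v φ = ∫ z, v (Φ z) ∂ν := by
  -- Testing with functionals on `E` makes the problem scalar, as the Hahn–Banach extension
  -- requires.
  refine (SeparatingDual.eq_iff_forall_dual_eq (R := ℂ)).2 fun l => ?_
  rw [← l.integral_comp_comm (integrable_clm_comp v hΦ hint)]
  obtain ⟨m, L, hL⟩ := exists_dual_weightedDerivs (l.comp v)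
  have hJ : weightedDerivs d m φ = ∫ z, weightedDerivs d m (Φ z) ∂ν := by
    have hi := integrable_clm_comp (weightedDerivs d m) hΦ hint
    refine DerivTuple.ext fun n y => ?_
    rw [← ContinuousLinearMap.integral_comp_comm _ hi]
    simp only [eval_weightedDerivs]
    rw [integral_smul, iteratedFDeriv_eq_integral hΦ hint hφ]
  have h1 := hL φ
  rw [hJ, ← L.integral_comp_comm (integrable_clm_comp (weightedDerivs d m) hΦ hint)] at h1
  simp only [hL] at h1
  exact h1.symm

end IntegralOfSchwartz

/-! ### Weights, Peetre's inequality and integrability of brackets -/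

section Brackets

variable {d : ℕ}

theorem one_le_one_add_norm_sq (x : Rd d) : 1 ≤ 1 + ‖x‖ ^ 2 := by
  linarith [sq_nonneg ‖x‖]

theorem bracketPow_pos (r : ℝ) (x : Rd d) : 0 < bracketPow r x :=
  Real.rpow_pos_of_pos (by positivity) _

theorem bracketPow_nonneg (r : ℝ) (x : Rd d) : 0 ≤ bracketPow r x := (bracketPow_pos r x).le

@[fun_prop]
theorem continuous_bracketPow (r : ℝ) : Continuous (bracketPow r : Rd d → ℝ) := by
  unfold bracketPow
  refine Continuous.rpow_const (by fun_prop) fun x => Or.inl ?_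
  positivity

theorem bracketPow_add (r s : ℝ) (x : Rd d) :
    bracketPow (r + s) x = bracketPow r x * bracketPow s x := by
  simp only [bracketPow, add_div]
  exact Real.rpow_add (by positivity) _ _

theorem bracketPow_neg_mul (r : ℝ) (x : Rd d) : bracketPow (-r) x * bracketPow r x = 1 := by
  rw [← bracketPow_add]
  simp [bracketPow]

theorem bracketPow_neg_arg (r : ℝ) (x : Rd d) : bracketPow r (-x) = bracketPow r x := by
  simp [bracketPow]

theorem bracketPow_mono {r s : ℝ} (h : r ≤ s) (x : Rd d) : bracketPow r x ≤ bracketPow s x :=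
  Real.rpow_le_rpow_of_exponent_le (one_le_one_add_norm_sq x) (by linarith)

theorem bracketPow_zero (x : Rd d) : bracketPow 0 x = 1 := by
  simp [bracketPow]

theorem bracketPow_add_le_of_nonneg {r : ℝ} (hr : 0 ≤ r) (x y : Rd d) :
    bracketPow r (x + y) ≤ 2 ^ (r / 2) * bracketPow r x * bracketPow r y := by
  unfold bracketPow
  rw [← Real.mul_rpow (by positivity) (by positivity),
    ← Real.mul_rpow (by positivity) (by positivity)]
  refine Real.rpow_le_rpow (by positivity) ?_ (by linarith)
  have h1 : ‖x + y‖ ^ 2 ≤ (‖x‖ + ‖y‖) ^ 2 := by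
    gcongr
    exact norm_add_le x y
  nlinarith [sq_nonneg (‖x‖ - ‖y‖), mul_nonneg (sq_nonneg ‖x‖) (sq_nonneg ‖y‖)]

/-- Peetre's inequality. -/
theorem bracketPow_add_le (r : ℝ) (x y : Rd d) :
    bracketPow r (x + y) ≤ 2 ^ (|r| / 2) * bracketPow r x * bracketPow |r| y := by
  rcases le_total 0 r with hr | hr
  · rw [abs_of_nonneg hr]
    exact bracketPow_add_le_of_nonneg hr x y
  -- For negative `r`, apply the inequality with exponent `|r|` to `x = (x + y) + (-y)`, then
  -- multiply by the weights of exponent `r` at `x` and `x + y`.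
  · have h := bracketPow_add_le_of_nonneg (abs_nonneg r) (x + y) (-y)
    rw [add_neg_cancel_right, bracketPow_neg_arg] at h
    have hx := bracketPow_neg_mul r x
    have hxy := bracketPow_neg_mul r (x + y)
    rw [← abs_of_nonpos hr] at hx hxy
    have p1 := bracketPow_pos r x
    have p2 := bracketPow_pos r (x + y)
    calc bracketPow r (x + y) = bracketPow |r| x * bracketPow r x * bracketPow r (x + y) := by
          rw [hx, one_mul]
      _ ≤ 2 ^ (|r| / 2) * bracketPow |r| (x + y) * bracketPow |r| y * bracketPow r x
            * bracketPow r (x + y) := by gcongr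
      _ = 2 ^ (|r| / 2) * bracketPow r x * bracketPow |r| y
            * (bracketPow |r| (x + y) * bracketPow r (x + y)) := by ring
      _ = _ := by rw [hxy, mul_one]

theorem bracketPow_natCast_le (N : ℕ) (x : Rd d) : bracketPow N x ≤ (1 + ‖x‖) ^ N := by
  have h : (1 + ‖x‖) ^ N = ((1 + ‖x‖) ^ 2) ^ ((N : ℝ) / 2) := by
    rw [← Real.rpow_natCast, ← Real.rpow_natCast, ← Real.rpow_mul (by positivity)]
    congr 1
    push_cast
    ring
  rw [h]
  refine Real.rpow_le_rpow (by positivity) ?_ (by positivity)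
  nlinarith [norm_nonneg x]

theorem one_add_norm_pow_le (N : ℕ) (x : Rd d) :
    (1 + ‖x‖) ^ N ≤ 2 ^ ((N : ℝ) / 2) * bracketPow N x := by
  have h : (1 + ‖x‖) ^ N = ((1 + ‖x‖) ^ 2) ^ ((N : ℝ) / 2) := by
    rw [← Real.rpow_natCast, ← Real.rpow_natCast, ← Real.rpow_mul (by positivity)]
    congr 1
    push_cast
    ring
  rw [h, bracketPow, ← Real.mul_rpow (by positivity) (by positivity)]
  refine Real.rpow_le_rpow (by positivity) ?_ (by positivity)
  nlinarith [sq_nonneg (1 - ‖x‖)]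

theorem le_bracketPow_neg {N : ℕ} {x : Rd d} {a C : ℝ} (ha : 0 ≤ a)
    (h : (1 + ‖x‖) ^ N * a ≤ C) : a ≤ C * bracketPow (-N) x := by
  have h1 := bracketPow_neg_mul (N : ℝ) x
  have p1 := bracketPow_pos (-N : ℝ) x
  calc a = bracketPow (-N) x * (bracketPow N x * a) := by rw [← mul_assoc, h1, one_mul]
    _ ≤ bracketPow (-N) x * ((1 + ‖x‖) ^ N * a) := by
        gcongr
        exact bracketPow_natCast_le N x
    _ ≤ bracketPow (-N) x * C := by gcongr
    _ = _ := mul_comm _ _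

theorem integrable_bracketPow {r : ℝ} (hr : r < -d) :
    Integrable (bracketPow r : Rd d → ℝ) := by
  have h := integrable_rpow_neg_one_add_norm_sq (E := Rd d) (μ := volume) (r := -r)
    (by rw [finrank_euclideanSpace_fin]; linarith)
  rw [neg_neg] at h
  exact h

theorem integrable_schwartz_mul_bracketPow (φ : 𝓢(Rd d, ℂ)) (r : ℝ) :
    Integrable fun x => ‖φ x‖ * bracketPow r x := by
  obtain ⟨N, hN⟩ := exists_nat_gt (r + d)
  have h := (integrable_bracketPow (d := d) (r := r - N) (by linarith)).const_mul
    (2 ^ N * schwartzNorm d N φ)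
  have hc : Continuous fun x => ‖φ x‖ * bracketPow r x := by fun_prop
  refine h.mono' hc.aestronglyMeasurable (Eventually.of_forall fun x => ?_)
  have hr := bracketPow_nonneg r x
  rw [Real.norm_of_nonneg (by positivity)]
  have h1 := le_bracketPow_neg (norm_nonneg _) (one_add_pow_mul_norm_le φ N x)
  calc ‖φ x‖ * bracketPow r x
      ≤ (2 ^ N * schwartzNorm d N φ * bracketPow (-N) x) * bracketPow r x := by gcongr
    _ = _ := by rw [sub_eq_add_neg, bracketPow_add]; ring

end Brackets

/-! ### The reproducing formula -/

section Reproducing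

variable {d : ℕ}

theorem exists_norm_tfCoeff_le_bracketPow (h : 𝓢(Rd d, ℂ)) (N : ℕ) :
    ∃ (m : ℕ) (C : ℝ), 0 ≤ C ∧ ∀ (φ : 𝓢(Rd d, ℂ)) (x ξ : Rd d),
      ‖tfCoeff h φ x ξ‖ ≤ C * schwartzNorm d m φ * (bracketPow (-N) x * bracketPow (-N) ξ) := by
  obtain ⟨m, C, hC, hb⟩ := exists_norm_tfCoeff_le h N
  refine ⟨m, C, hC, fun φ x ξ => ?_⟩
  have h1 := hb φ x ξ
  rw [mul_assoc] at h1
  have h2 := le_bracketPow_neg (by positivity) h1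
  have h3 := le_bracketPow_neg (by positivity) h2
  linarith

/-- Integrability over phase space of rapidly decreasing multiples of quantities of polynomial
growth. -/
theorem integrable_bracketPow_prod {r : ℝ} (hr : r < -d) :
    Integrable fun z : Rd d × Rd d => bracketPow r z.1 * bracketPow r z.2 :=
  (integrable_bracketPow hr).mul_prod (integrable_bracketPow hr)

theorem exists_schwartzNorm_tfShift_le_bracketPow (γ : 𝓢(Rd d, ℂ)) (m : ℕ) :
    ∃ (N : ℕ) (C : ℝ), 0 ≤ C ∧ ∀ x ξ : Rd d,
      schwartzNorm d m (tfShift γ x ξ) ≤ C * (bracketPow N x * bracketPow N ξ) := by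
  obtain ⟨N, C, hC, h⟩ := exists_schwartzNorm_tfShift_le γ m
  refine ⟨N, C * 2 ^ ((N : ℝ) / 2) * 2 ^ ((N : ℝ) / 2), by positivity, fun x ξ => ?_⟩
  have p := bracketPow_nonneg (N : ℝ) x
  calc schwartzNorm d m (tfShift γ x ξ) ≤ C * (1 + ‖x‖) ^ N * (1 + ‖ξ‖) ^ N := h x ξ
    _ ≤ C * (2 ^ ((N : ℝ) / 2) * bracketPow N x) * (2 ^ ((N : ℝ) / 2) * bracketPow N ξ) := by
        gcongr
        · exact one_add_norm_pow_le N x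
        · exact one_add_norm_pow_le N ξ
    _ = _ := by ring

theorem integrable_schwartzNorm_tfCoeff_smul (h γ φ : 𝓢(Rd d, ℂ)) (m : ℕ) :
    Integrable fun z : Rd d × Rd d =>
      schwartzNorm d m (tfCoeff h φ z.1 z.2 • tfShift γ z.1 z.2) := by
  obtain ⟨N, C, hC, hN⟩ := exists_schwartzNorm_tfShift_le_bracketPow γ m
  -- The exponent `N` cancels the growth of the time-frequency shifts; the remaining `d + 1` makes
  -- the bracket integrable in each variable.
  obtain ⟨m', C', hC', hm⟩ := exists_norm_tfCoeff_le_bracketPow h (N + d + 1)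
  have h0 := schwartzNorm_nonneg m' φ
  refine ((integrable_bracketPow_prod (d := d) (r := -(d + 1)) (by linarith)).const_mul
    (C' * schwartzNorm d m' φ * C)).mono' (Continuous.aestronglyMeasurable ?_)
    (Eventually.of_forall fun z => ?_)
  · exact (continuous_schwartzNorm d m).comp ((continuous_tfCoeff h φ).smul (continuous_tfShift γ))
  · rw [Real.norm_of_nonneg (schwartzNorm_nonneg _ _), map_smul_eq_mul]
    have hb : ∀ x : Rd d, bracketPow (-((N + d + 1 : ℕ) : ℝ)) x * bracketPow N x
        = bracketPow (-(d + 1)) x := fun x => by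
      rw [← bracketPow_add]
      congr 1
      push_cast
      ring
    have p1 := bracketPow_nonneg (-((N + d + 1 : ℕ) : ℝ)) z.1
    have p2 := bracketPow_nonneg (-((N + d + 1 : ℕ) : ℝ)) z.2
    calc _ ≤ C' * schwartzNorm d m' φ * (bracketPow (-((N + d + 1 : ℕ) : ℝ)) z.1
          * bracketPow (-((N + d + 1 : ℕ) : ℝ)) z.2) *
            (C * (bracketPow N z.1 * bracketPow N z.2)) := by
          gcongr
          · exact hm φ z.1 z.2
          · exact hN z.1 z.2
      _ = C' * schwartzNorm d m' φ * C *
          ((bracketPow (-((N + d + 1 : ℕ) : ℝ)) z.1 * bracketPow N z.1) *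
          (bracketPow (-((N + d + 1 : ℕ) : ℝ)) z.2 * bracketPow N z.2)) := by ring
      _ = _ := by rw [hb, hb]

theorem continuous_tfCoeff_smul_tfShift (h γ φ : 𝓢(Rd d, ℂ)) :
    Continuous fun z : Rd d × Rd d => tfCoeff h φ z.1 z.2 • tfShift γ z.1 z.2 :=
  (continuous_tfCoeff h φ).smul (continuous_tfShift γ)

variable {E : Type*} [NormedAddCommGroup E] [NormedSpace ℂ E]

theorem integrable_tfCoeff_smul (v : 𝓢(Rd d, ℂ) →L[ℂ] E) (h γ φ : 𝓢(Rd d, ℂ)) :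
    Integrable fun z : Rd d × Rd d => tfCoeff h φ z.1 z.2 • v (tfShift γ z.1 z.2) := by
  have := integrable_clm_comp v (continuous_tfCoeff_smul_tfShift h γ φ)
    (integrable_schwartzNorm_tfCoeff_smul h γ φ)
  simpa only [map_smul] using this

/-- The reproducing formula for the short-time Fourier transform of a vector-valued tempered
distribution. -/
theorem clm_apply_eq_integral_tfCoeff_smul [CompleteSpace E] (v : 𝓢(Rd d, ℂ) →L[ℂ] E)
    {h γ : 𝓢(Rd d, ℂ)} (hγ : ∫ y, h y * γ y = 1) (φ : 𝓢(Rd d, ℂ)) :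
    v φ = ∫ z : Rd d × Rd d, tfCoeff h φ z.1 z.2 • v (tfShift γ z.1 z.2) := by
  have key := clm_apply_eq_integral v (φ := φ) (ν := volume)
    (continuous_tfCoeff_smul_tfShift h γ φ) (integrable_schwartzNorm_tfCoeff_smul h γ φ)
    (fun y => ?_)
  · simpa only [map_smul] using key
  · have hi : Integrable fun z : Rd d × Rd d => tfCoeff h φ z.1 z.2 • tfShift γ z.1 z.2 y :=
      integrable_tfCoeff_smul ((BoundedContinuousFunction.evalCLM ℂ y).comp
        (toBoundedContinuousFunctionCLM ℂ (Rd d) ℂ)) h γ φ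
    simp only [_root_.smul_apply]
    rw [Measure.volume_eq_prod, integral_prod _ hi]
    -- Integrating over `ξ` first is Fourier inversion for `h (· - x) φ`; the integral over `x` is
    -- then the normalization `∫ h γ = 1`.
    have h1 : ∀ x : Rd d, ∫ ξ, tfCoeff h φ x ξ • tfShift γ x ξ y
        = (h (y - x) * γ (y - x)) * φ y := by
      intro x
      have h2 := fourier_schwartz_apply (𝓕⁻ (mulShift h x φ)) y
      rw [FourierTransform.fourier_fourierInv_eq, mulShift_apply] at h2
      calc ∫ ξ, tfCoeff h φ x ξ • tfShift γ x ξ y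
          = ∫ ξ, γ (y - x) * (negCharacter y ξ * (𝓕⁻ (mulShift h x φ)) ξ) := by
            refine integral_congr_ae (Eventually.of_forall fun ξ => ?_)
            simp only [tfShift_apply, tfCoeff, smul_eq_mul, negCharacter_comm ξ y]
            ring
        _ = _ := by
            rw [integral_const_mul, ← h2]
            ring
    simp only [h1]
    rw [integral_mul_const, integral_sub_left_eq_self (fun t => h t * γ t) volume y, hγ, one_mul]

/-- Take the conjugate of `γ` divided by `∫ ‖γ‖ ^ 2`. -/
theorem exists_dual_window {γ : 𝓢(Rd d, ℂ)} (hγ : γ ≠ 0) :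
    ∃ h : 𝓢(Rd d, ℂ), ∫ y, h y * γ y = 1 := by
  let γ' : 𝓢(Rd d, ℂ) := postcompCLM (𝕜 := ℝ) (Complex.conjCLE : ℂ →L[ℝ] ℂ) γ
  have hγ' : ∀ y, γ' y * γ y = ((‖γ y‖ ^ 2 : ℝ) : ℂ) := fun y => by
    have : γ' y = (starRingEnd ℂ) (γ y) := by simp [γ']
    rw [this, mul_comm, Complex.mul_conj, Complex.normSq_eq_norm_sq]
  have hint : Integrable fun y => ‖γ y‖ ^ 2 := by
    obtain ⟨C, hC, hb⟩ := exists_norm_le γ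
    refine (γ.integrable.norm.const_mul C).mono' (by fun_prop) (Eventually.of_forall fun y => ?_)
    rw [Real.norm_of_nonneg (by positivity), sq]
    exact mul_le_mul_of_nonneg_right (hb y) (norm_nonneg _)
  have hne : ∫ y, ‖γ y‖ ^ 2 ≠ 0 := by
    intro h0
    rw [integral_eq_zero_iff_of_nonneg (fun y => by positivity) hint] at h0
    have h1 : (fun y => ‖γ y‖ ^ 2) = 0 :=
      (Continuous.ae_eq_iff_eq volume (by fun_prop) continuous_zero).1 h0
    refine hγ (SchwartzMap.ext fun y => ?_)
    simpa using congrFun h1 y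
  refine ⟨(((∫ y, ‖γ y‖ ^ 2 : ℝ) : ℂ)⁻¹) • γ', ?_⟩
  simp only [_root_.smul_apply, smul_eq_mul, mul_assoc, hγ']
  rw [integral_const_mul, integral_complex_ofReal, inv_mul_cancel₀]
  exact_mod_cast hne

end Reproducing

/-! ### The kernel of a product and its decay -/

section Kernel

variable {d : ℕ}

/-- The weight `⟨x⟩^r ⟨x'⟩^r ⟨ξ + ξ'⟩^r` on pairs of points of phase space. -/
noncomputable def pairWeight (r : ℝ) (p : (Rd d × Rd d) × (Rd d × Rd d)) : ℝ :=
  bracketPow r p.1.1 * bracketPow r p.2.1 * bracketPow r (p.1.2 + p.2.2)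

theorem pairWeight_nonneg (r : ℝ) (p : (Rd d × Rd d) × (Rd d × Rd d)) : 0 ≤ pairWeight r p :=
  mul_nonneg (mul_nonneg (bracketPow_nonneg _ _) (bracketPow_nonneg _ _)) (bracketPow_nonneg _ _)

/-- The kernel `∫ φ (y) h₀ (y - x) h₁ (y - x') exp (2πi y·(ξ + ξ')) dy` through which products
act on pairs of short-time Fourier transforms. -/
noncomputable def productKernel (h₀ h₁ φ : 𝓢(Rd d, ℂ)) (p : (Rd d × Rd d) × (Rd d × Rd d)) : ℂ :=
  tfCoeff h₀ (mulShift h₁ p.2.1 φ) p.1.1 (p.1.2 + p.2.2)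

@[fun_prop]
theorem continuous_productKernel (h₀ h₁ φ : 𝓢(Rd d, ℂ)) : Continuous (productKernel h₀ h₁ φ) := by
  have h : Continuous fun p : (Rd d × Rd d) × (Rd d × Rd d) =>
      ((p.1.1, p.2.1, p.1.2 + p.2.2) : Rd d × Rd d × Rd d) := by fun_prop
  unfold productKernel
  have key := (continuous_tfCoeff_mulShift h₀ h₁ φ).comp h
  simpa only [Function.comp_def] using key

theorem productKernel_eq (h₀ h₁ φ : 𝓢(Rd d, ℂ)) (x ξ x' ξ' : Rd d) :
    productKernel h₀ h₁ φ ((x, ξ), (x', ξ'))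
      = ∫ y, (negCharacter (-ξ) y * h₀ (y - x)) * ((negCharacter (-ξ') y * h₁ (y - x')) * φ y) := by
  rw [productKernel, tfCoeff_eq]
  refine integral_congr_ae (Eventually.of_forall fun y => ?_)
  simp only [mulShift_apply, neg_add, negCharacter_add_left]
  ring

/-- For shifted test functions the decay is centred at `x = x' = x₀` and `ξ + ξ' = ξ₀`, with
constants depending only on the unshifted `γ`. -/
theorem norm_productKernel_tfShift (h₀ h₁ γ : 𝓢(Rd d, ℂ)) (x₀ ξ₀ x ξ x' ξ' : Rd d) :
    ‖productKernel h₀ h₁ (tfShift γ x₀ ξ₀) ((x, ξ), (x', ξ'))‖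
      = ‖tfCoeff h₀ (mulShift h₁ (x' - x₀) γ) (x - x₀) (ξ + ξ' - ξ₀)‖ := by
  rw [productKernel, mulShift_tfShift, norm_tfCoeff_tfShift]

/-- The separation of `h₁ (· - x')` and `φ` makes the seminorms of their product decay in `x'`; the
coefficient bound contributes the decay in `x` and `ω`. -/
theorem exists_norm_tfCoeff_mulShift_le (h₀ h₁ : 𝓢(Rd d, ℂ)) (N : ℕ) :
    ∃ (m : ℕ) (C : ℝ), 0 ≤ C ∧ ∀ (φ : 𝓢(Rd d, ℂ)) (x x' ω : Rd d),
      ‖tfCoeff h₀ (mulShift h₁ x' φ) x ω‖ ≤ C * schwartzNorm d m φ *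
        (bracketPow (-N) x * bracketPow (-N) x' * bracketPow (-N) ω) := by
  obtain ⟨m, C, hC, h⟩ := exists_norm_tfCoeff_le_bracketPow h₀ N
  obtain ⟨C', hC', h'⟩ := schwartzNorm_mulShift_le h₁ m N
  refine ⟨m + N, C * C', by positivity, fun φ x x' ω => ?_⟩
  have h1 := le_bracketPow_neg (schwartzNorm_nonneg _ _) (h' x' φ)
  have p1 := bracketPow_nonneg (-(N : ℝ)) x
  have p2 := bracketPow_nonneg (-(N : ℝ)) ω
  calc _ ≤ C * schwartzNorm d m (mulShift h₁ x' φ) * (bracketPow (-N) x * bracketPow (-N) ω) :=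
        h _ x ω
    _ ≤ C * (C' * schwartzNorm d (m + N) φ * bracketPow (-N) x')
          * (bracketPow (-N) x * bracketPow (-N) ω) := by gcongr
    _ = _ := by ring

theorem exists_norm_productKernel_le (h₀ h₁ : 𝓢(Rd d, ℂ)) (N : ℕ) :
    ∃ (m : ℕ) (C : ℝ), 0 ≤ C ∧ ∀ (φ : 𝓢(Rd d, ℂ)) p,
      ‖productKernel h₀ h₁ φ p‖ ≤ C * schwartzNorm d m φ * pairWeight (-N) p := by
  obtain ⟨m, C, hC, h⟩ := exists_norm_tfCoeff_mulShift_le h₀ h₁ N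
  exact ⟨m, C, hC, fun φ p => h φ p.1.1 p.2.1 (p.1.2 + p.2.2)⟩

end Kernel

/-! ### Kernels of mollified products -/

section Mollification

variable {d : ℕ}

theorem reflDilate_eq_tfShift (ρ : 𝓢(Rd d, ℂ)) {ε : ℝ} (hε : ε ≠ 0) (y : Rd d) :
    reflDilate ρ ε y = tfShift (reflDilate ρ ε 0) y 0 := by
  ext t
  rw [tfShift_zero_right, compSubConstCLM_apply, reflDilate_apply ρ hε, reflDilate_apply ρ hε]
  simp

theorem tfCoeff_tfShift_zero (h γ : 𝓢(Rd d, ℂ)) (x₀ x ξ : Rd d) :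
    tfCoeff h (tfShift γ x₀ 0) x ξ = negCharacter (-x₀) ξ * tfCoeff h γ (x - x₀) ξ := by
  rw [tfCoeff, mulShift_tfShift, fourierInv_tfShift]
  simp [tfShift_apply, tfCoeff]

theorem continuous_tfCoeff_reflDilate (h ρ : 𝓢(Rd d, ℂ)) {ε : ℝ} (hε : ε ≠ 0) :
    Continuous fun p : Rd d × (Rd d × Rd d) =>
      tfCoeff h (reflDilate ρ ε p.1) p.2.1 p.2.2 := by
  have h1 : (fun p : Rd d × (Rd d × Rd d) => tfCoeff h (reflDilate ρ ε p.1) p.2.1 p.2.2)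
      = fun p => negCharacter (-p.1) p.2.2 *
        tfCoeff h (reflDilate ρ ε 0) (p.2.1 - p.1) p.2.2 := by
    ext p
    rw [reflDilate_eq_tfShift ρ hε, tfCoeff_tfShift_zero]
  have h2 : Continuous fun p : Rd d × (Rd d × Rd d) =>
      ((p.2.1 - p.1, p.2.2) : Rd d × Rd d) := by fun_prop
  have h3 := (continuous_tfCoeff h (reflDilate ρ ε 0)).comp h2
  have h4 : Continuous fun p : Rd d × (Rd d × Rd d) => negCharacter (-p.1) p.2.2 := by fun_prop
  rw [h1]
  exact h4.mul h3

/-- The constant depends on `ε`. This suffices for Fubini's theorem at a fixed `ε`; the bound needed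
as `ε → 0` is `exists_norm_mollifiedKernel_le`. -/
theorem exists_norm_tfCoeff_reflDilate_le (h ρ : 𝓢(Rd d, ℂ)) {ε : ℝ} (hε : ε ≠ 0) (N : ℕ) :
    ∃ C : ℝ, 0 ≤ C ∧ ∀ y x ξ : Rd d, ‖tfCoeff h (reflDilate ρ ε y) x ξ‖ ≤
      C * (bracketPow N y * (bracketPow (-N) x * bracketPow (-N) ξ)) := by
  obtain ⟨m, C, hC, hb⟩ := exists_norm_tfCoeff_le_bracketPow h N
  have h0 := schwartzNorm_nonneg m (reflDilate ρ ε 0)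
  refine ⟨C * schwartzNorm d m (reflDilate ρ ε 0) * 2 ^ ((N : ℝ) / 2), by positivity,
    fun y x ξ => ?_⟩
  rw [reflDilate_eq_tfShift ρ hε, norm_tfCoeff_tfShift, sub_zero]
  have h1 := bracketPow_add_le (-(N : ℝ)) x (-y)
  rw [abs_neg, abs_of_nonneg (Nat.cast_nonneg N), bracketPow_neg_arg, ← sub_eq_add_neg] at h1
  have p := bracketPow_nonneg (-(N : ℝ)) ξ
  calc _ ≤ C * schwartzNorm d m (reflDilate ρ ε 0) *
          (bracketPow (-N) (x - y) * bracketPow (-N) ξ) := hb _ _ _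
    _ ≤ C * schwartzNorm d m (reflDilate ρ ε 0) *
          ((2 ^ ((N : ℝ) / 2) * bracketPow (-N) x * bracketPow N y) * bracketPow (-N) ξ) := by
        gcongr
    _ = _ := by ring

theorem integral_comp_sub_smul (G : Rd d → ℂ) {ε : ℝ} (hε : 0 < ε) (y : Rd d) :
    ∫ t, G t = ((ε ^ d : ℝ) : ℂ) * ∫ τ, G (y - ε • τ) := by
  have h1 := Measure.integral_comp_smul (volume : Measure (Rd d)) (fun s => G (y - s)) ε
  rw [integral_sub_left_eq_self G volume y, finrank_euclideanSpace_fin,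
    abs_of_pos (by positivity)] at h1
  rw [h1, Complex.real_smul, ← mul_assoc, ← Complex.ofReal_mul, mul_inv_cancel₀ (by positivity),
    Complex.ofReal_one, one_mul]

theorem tfCoeff_reflDilate_eq (h ρ : 𝓢(Rd d, ℂ)) {ε : ℝ} (hε : 0 < ε) (y x ξ : Rd d) :
    tfCoeff h (reflDilate ρ ε y) x ξ
      = ∫ τ, ρ τ * (negCharacter (-ξ) (y - ε • τ) * h (y - ε • τ - x)) := by
  rw [tfCoeff_eq, integral_comp_sub_smul _ hε y, ← integral_const_mul]
  refine integral_congr_ae (Eventually.of_forall fun τ => ?_)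
  have h0 : ((ε ^ d : ℝ) : ℂ) ≠ 0 := by exact_mod_cast (pow_pos hε d).ne'
  simp only
  rw [reflDilate_apply ρ hε.ne', sub_sub_cancel, smul_smul, inv_mul_cancel₀ hε.ne', one_smul,
    Complex.ofReal_inv]
  field_simp

/-- The kernel of the product of two mollified distributions. -/
noncomputable def mollifiedKernel (h₀ h₁ ρ σ φ : 𝓢(Rd d, ℂ)) (ε : ℝ)
    (p : (Rd d × Rd d) × (Rd d × Rd d)) : ℂ :=
  ∫ y, φ y * (tfCoeff h₀ (reflDilate ρ ε y) p.1.1 p.1.2 *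
    tfCoeff h₁ (reflDilate σ ε y) p.2.1 p.2.2)

/-- Substituting `y - ε • τ` in both coefficients and integrating over `y` first exhibits the
mollified kernel as an average of the product kernel at shifted positions, multiplied by unimodular
phases. Both the uniform bound and the limit are read off from this form. -/
theorem mollifiedKernel_eq (h₀ h₁ ρ σ φ : 𝓢(Rd d, ℂ)) {ε : ℝ} (hε : 0 < ε) (x ξ x' ξ' : Rd d) :
    mollifiedKernel h₀ h₁ ρ σ φ ε ((x, ξ), (x', ξ'))
      = ∫ t : Rd d × Rd d, (ρ t.1 * σ t.2) *
        ((negCharacter (-ξ) (-(ε • t.1)) * negCharacter (-ξ') (-(ε • t.2))) *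
          productKernel h₀ h₁ φ ((x + ε • t.1, ξ), (x' + ε • t.2, ξ'))) := by
  obtain ⟨C₀, hC₀, hh₀⟩ := exists_norm_le h₀
  obtain ⟨C₁, hC₁, hh₁⟩ := exists_norm_le h₁
  let f : Rd d → Rd d × Rd d → ℂ := fun y t => φ y *
    ((ρ t.1 * (negCharacter (-ξ) (y - ε • t.1) * h₀ (y - ε • t.1 - x))) *
      (σ t.2 * (negCharacter (-ξ') (y - ε • t.2) * h₁ (y - ε • t.2 - x'))))
  have hf : Integrable (Function.uncurry f) := by
    have h1 : Integrable fun q : Rd d × (Rd d × Rd d) =>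
        ‖φ q.1‖ * ((C₀ * ‖ρ q.2.1‖) * (C₁ * ‖σ q.2.2‖)) :=
      φ.integrable.norm.mul_prod
        ((ρ.integrable.norm.const_mul C₀).mul_prod (σ.integrable.norm.const_mul C₁))
    have hc : Continuous (Function.uncurry f) := by
      simp only [f, Function.uncurry_def]
      fun_prop
    refine h1.mono' hc.aestronglyMeasurable (Eventually.of_forall fun q => ?_)
    simp only [f, Function.uncurry_def, norm_mul, norm_negCharacter, one_mul]
    rw [mul_comm C₀, mul_comm C₁]
    gcongr
    · exact hh₀ _
    · exact hh₁ _
  have h2 : mollifiedKernel h₀ h₁ ρ σ φ ε ((x, ξ), (x', ξ')) = ∫ y, ∫ t, f y t := by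
    unfold mollifiedKernel
    refine integral_congr_ae (Eventually.of_forall fun y => ?_)
    simp only [f]
    rw [integral_const_mul, tfCoeff_reflDilate_eq h₀ ρ hε, tfCoeff_reflDilate_eq h₁ σ hε]
    congr 1
    exact (integral_prod_mul _ _).symm
  rw [h2, integral_integral_swap hf]
  refine integral_congr_ae (Eventually.of_forall fun t => ?_)
  simp only
  rw [productKernel_eq, ← integral_const_mul, ← integral_const_mul]
  refine integral_congr_ae (Eventually.of_forall fun y => ?_)
  simp only [f, sub_eq_add_neg, negCharacter_add_right, neg_add]
  have e1 : y + -(ε • t.1) + -x = y + (-x + -(ε • t.1)) := by abel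
  have e2 : y + -(ε • t.2) + -x' = y + (-x' + -(ε • t.2)) := by abel
  rw [e1, e2]
  ring

theorem bracketPow_add_smul_le (N : ℕ) (x τ : Rd d) {ε : ℝ} (hε : 0 ≤ ε) (hε' : ε ≤ 1) :
    bracketPow (-N) (x + ε • τ) ≤ 2 ^ ((N : ℝ) / 2) * bracketPow (-N) x * bracketPow N τ := by
  have h1 := bracketPow_add_le (-(N : ℝ)) x (ε • τ)
  rw [abs_neg, abs_of_nonneg (Nat.cast_nonneg N)] at h1
  refine h1.trans ?_
  have p := bracketPow_nonneg (-(N : ℝ)) x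
  gcongr
  refine Real.rpow_le_rpow (by positivity) ?_ (by positivity)
  have : ‖ε • τ‖ ≤ ‖τ‖ := by
    rw [norm_smul, Real.norm_of_nonneg hε]
    exact mul_le_of_le_one_left (norm_nonneg _) hε'
  gcongr

/-- For `ε ≤ 1`, a shift by `ε • τ` changes the decay by at most a constant times `⟨τ⟩^N`, which the
Schwartz functions `ρ` and `σ` absorb. -/
theorem exists_norm_mollifiedKernel_le (h₀ h₁ ρ σ φ : 𝓢(Rd d, ℂ)) (N : ℕ) :
    ∃ C : ℝ, 0 ≤ C ∧ ∀ ε, 0 < ε → ε ≤ 1 → ∀ p,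
      ‖mollifiedKernel h₀ h₁ ρ σ φ ε p‖ ≤ C * pairWeight (-N) p := by
  obtain ⟨m, C, hC, hb⟩ := exists_norm_productKernel_le h₀ h₁ N
  have h0 := schwartzNorm_nonneg m φ
  let I : (𝓢(Rd d, ℂ)) → ℝ := fun ρ => ∫ τ, ‖ρ τ‖ * bracketPow N τ
  have hI : ∀ ρ, 0 ≤ I ρ := fun ρ =>
    integral_nonneg fun τ => mul_nonneg (norm_nonneg _) (bracketPow_nonneg _ _)
  have hI' : ∀ ρ : 𝓢(Rd d, ℂ), Integrable fun τ => ‖ρ τ‖ * bracketPow N τ := fun ρ =>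
    integrable_schwartz_mul_bracketPow ρ N
  let K : ℝ := C * schwartzNorm d m φ * (2 ^ ((N : ℝ) / 2) * 2 ^ ((N : ℝ) / 2))
  have hK : 0 ≤ K := by positivity
  refine ⟨K * (I ρ * I σ), mul_nonneg hK (mul_nonneg (hI ρ) (hI σ)), fun ε hε hε' p => ?_⟩
  obtain ⟨⟨x, ξ⟩, ⟨x', ξ'⟩⟩ := p
  rw [mollifiedKernel_eq h₀ h₁ ρ σ φ hε]
  have hint : Integrable fun t : Rd d × Rd d => (K * pairWeight (-N) ((x, ξ), (x', ξ'))) *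
      ((‖ρ t.1‖ * bracketPow N t.1) * (‖σ t.2‖ * bracketPow N t.2)) :=
    ((hI' ρ).mul_prod (hI' σ)).const_mul _
  refine (norm_integral_le_of_norm_le hint (Eventually.of_forall fun t => ?_)).trans (le_of_eq ?_)
  · simp only [norm_mul, norm_negCharacter, one_mul]
    have h1 := hb φ ((x + ε • t.1, ξ), (x' + ε • t.2, ξ'))
    have h2 := bracketPow_add_smul_le N x t.1 hε.le hε'
    have h3 := bracketPow_add_smul_le N x' t.2 hε.le hε'
    have p1 := bracketPow_nonneg (-(N : ℝ)) (ξ + ξ')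
    have p2 := bracketPow_nonneg (-(N : ℝ)) (x' + ε • t.2)
    have p3 := bracketPow_nonneg (-(N : ℝ)) (x)
    have p4 := bracketPow_nonneg (N : ℝ) t.1
    calc ‖ρ t.1‖ * ‖σ t.2‖ * ‖productKernel h₀ h₁ φ ((x + ε • t.1, ξ), (x' + ε • t.2, ξ'))‖
        ≤ ‖ρ t.1‖ * ‖σ t.2‖ * (C * schwartzNorm d m φ *
          pairWeight (-N) ((x + ε • t.1, ξ), (x' + ε • t.2, ξ'))) := by gcongr
      _ ≤ ‖ρ t.1‖ * ‖σ t.2‖ * (C * schwartzNorm d m φ *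
          ((2 ^ ((N : ℝ) / 2) * bracketPow (-N) x * bracketPow N t.1) *
          (2 ^ ((N : ℝ) / 2) * bracketPow (-N) x' * bracketPow N t.2) *
          bracketPow (-N) (ξ + ξ'))) := by
          unfold pairWeight
          gcongr
      _ = _ := by
          simp only [K, pairWeight]
          ring
  · rw [integral_const_mul, Measure.volume_eq_prod,
      integral_prod_mul (fun τ => ‖ρ τ‖ * bracketPow N τ) (fun τ => ‖σ τ‖ * bracketPow N τ)]
    ring

theorem tendsto_mollifiedKernel (h₀ h₁ φ : 𝓢(Rd d, ℂ)) {ρ σ : 𝓢(Rd d, ℂ)} (hρ : ∫ x, ρ x = 1)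
    (hσ : ∫ x, σ x = 1) (p : (Rd d × Rd d) × (Rd d × Rd d)) :
    Tendsto (fun ε => mollifiedKernel h₀ h₁ ρ σ φ ε p) (𝓝[>] 0)
      (𝓝 (productKernel h₀ h₁ φ p)) := by
  obtain ⟨⟨x, ξ⟩, ⟨x', ξ'⟩⟩ := p
  -- With exponent `0` all weights are `1`: only boundedness of the kernel is needed, because `ρ`
  -- and `σ` are integrable.
  obtain ⟨m, C, hC, hb⟩ := exists_norm_productKernel_le h₀ h₁ 0
  have h0 := schwartzNorm_nonneg m φ
  have hb' : ∀ p, ‖productKernel h₀ h₁ φ p‖ ≤ C * schwartzNorm d m φ := fun p => by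
    simpa [pairWeight, bracketPow_zero] using hb φ p
  have h1 : productKernel h₀ h₁ φ ((x, ξ), (x', ξ'))
      = ∫ t : Rd d × Rd d, (ρ t.1 * σ t.2) * productKernel h₀ h₁ φ ((x, ξ), (x', ξ')) := by
    rw [integral_mul_const, Measure.volume_eq_prod, integral_prod_mul, hρ, hσ]
    ring
  have hcont : Continuous fun q : ℝ × (Rd d × Rd d) => (ρ q.2.1 * σ q.2.2) *
        ((negCharacter (-ξ) (-(q.1 • q.2.1)) * negCharacter (-ξ') (-(q.1 • q.2.2))) *
          productKernel h₀ h₁ φ ((x + q.1 • q.2.1, ξ), (x' + q.1 • q.2.2, ξ'))) := by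
    fun_prop
  rw [h1]
  refine Tendsto.congr' (f₁ := fun ε => ∫ t : Rd d × Rd d, (ρ t.1 * σ t.2) *
        ((negCharacter (-ξ) (-(ε • t.1)) * negCharacter (-ξ') (-(ε • t.2))) *
          productKernel h₀ h₁ φ ((x + ε • t.1, ξ), (x' + ε • t.2, ξ')))) ?_ ?_
  · filter_upwards [self_mem_nhdsWithin] with ε hε
    exact (mollifiedKernel_eq h₀ h₁ ρ σ φ hε x ξ x' ξ').symm
  refine tendsto_integral_filter_of_dominated_convergence
    (fun t => (‖ρ t.1‖ * ‖σ t.2‖) * (C * schwartzNorm d m φ))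
    (Eventually.of_forall fun ε => ?_) (Eventually.of_forall fun ε =>
      Eventually.of_forall fun t => ?_) ?_ (Eventually.of_forall fun t => ?_)
  · exact (hcont.comp (Continuous.prodMk_right ε)).aestronglyMeasurable
  · simp only [norm_mul, norm_negCharacter, one_mul]
    gcongr
    exact hb' _
  · exact (ρ.integrable.norm.mul_prod σ.integrable.norm).mul_const _
  · have := (hcont.comp (Continuous.prodMk_left t)).tendsto 0
    refine Tendsto.mono_left ?_ nhdsWithin_le_nhds
    simpa [Function.comp_def, negCharacter_comm (-ξ), negCharacter_comm (-ξ')] using this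

end Mollification

/-! ### Existence of the product as a superposition -/

section Products

variable {d : ℕ} {E E₀ E₁ E₂ : Type*}
  [NormedAddCommGroup E] [NormedSpace ℂ E]
  [NormedAddCommGroup E₀] [NormedSpace ℂ E₀] [NormedAddCommGroup E₁] [NormedSpace ℂ E₁]
  [NormedAddCommGroup E₂] [NormedSpace ℂ E₂]

/-- The function `(x, ξ) ↦ v (exp (-2πi y·ξ) γ (y - x))`. -/
noncomputable def clmSTFT (γ : 𝓢(Rd d, ℂ)) (v : 𝓢(Rd d, ℂ) →L[ℂ] E) (z : Rd d × Rd d) : E :=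
  v (tfShift γ z.1 z.2)

theorem continuous_clmSTFT (γ : 𝓢(Rd d, ℂ)) (v : 𝓢(Rd d, ℂ) →L[ℂ] E) :
    Continuous (clmSTFT γ v) :=
  v.continuous.comp (continuous_tfShift γ)

/-- A tempered distribution is bounded by one seminorm, and the seminorms of time-frequency shifts
grow polynomially; so does the short-time Fourier transform. -/
theorem exists_integrable_clmSTFT (γ : 𝓢(Rd d, ℂ)) (v : 𝓢(Rd d, ℂ) →L[ℂ] E) :
    ∃ M : ℕ, ∀ N : ℕ, M ≤ N → Integrable fun z : Rd d × Rd d =>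
      bracketPow (-N) z.1 * bracketPow (-N) z.2 * ‖clmSTFT γ v z‖ := by
  obtain ⟨m, C, hC, hv⟩ := exists_norm_le_schwartzNorm v
  obtain ⟨M, C', hC', hM⟩ := exists_schwartzNorm_tfShift_le_bracketPow γ m
  refine ⟨M + d + 1, fun N hN => ?_⟩
  have hN' : (M : ℝ) + d + 1 ≤ N := by exact_mod_cast hN
  have hc := continuous_clmSTFT γ v
  refine ((integrable_bracketPow_prod (d := d) (r := M - N) (by linarith)).const_mul
    (C * C')).mono' (Continuous.aestronglyMeasurable (by fun_prop))
    (Eventually.of_forall fun z => ?_)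
  have p1 := bracketPow_nonneg (-(N : ℝ)) z.1
  have p2 := bracketPow_nonneg (-(N : ℝ)) z.2
  rw [Real.norm_of_nonneg (by positivity)]
  calc _ ≤ bracketPow (-N) z.1 * bracketPow (-N) z.2 *
        (C * (C' * (bracketPow M z.1 * bracketPow M z.2))) := by
        gcongr
        exact (hv _).trans (by gcongr; exact hM _ _)
    _ = _ := by
        rw [sub_eq_add_neg, bracketPow_add, bracketPow_add]
        ring

/-- A continuous bilinear map applied to two Bochner integrals. -/
theorem clm_integral_integral {X Y : Type*} [MeasurableSpace X] [MeasurableSpace Y]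
    {μ : Measure X} {ν : Measure Y} [SFinite μ] [SFinite ν]
    [CompleteSpace E₀] [CompleteSpace E₁] [CompleteSpace E₂]
    (B : E₀ →L[ℂ] E₁ →L[ℂ] E₂) {f : X → E₀} {g : Y → E₁} (hf : Integrable f μ)
    (hg : Integrable g ν) :
    Integrable (fun p : X × Y => B (f p.1) (g p.2)) (μ.prod ν) ∧
    B (∫ x, f x ∂μ) (∫ y, g y ∂ν) = ∫ p : X × Y, B (f p.1) (g p.2) ∂(μ.prod ν) := by
  have hi : Integrable (fun p : X × Y => B (f p.1) (g p.2)) (μ.prod ν) := by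
    refine ((hf.norm.mul_prod hg.norm).const_mul ‖B‖).mono' ?_
      (Eventually.of_forall fun p => ?_)
    · exact B.aestronglyMeasurable_comp₂ hf.aestronglyMeasurable.comp_fst
        hg.aestronglyMeasurable.comp_snd
    · exact (B.le_opNorm₂ _ _).trans (le_of_eq (by ring))
  refine ⟨hi, ?_⟩
  rw [integral_prod _ hi]
  have h1 : ∀ x, ∫ y, B (f x) (g y) ∂ν = B (f x) (∫ y, g y ∂ν) := fun x =>
    (B (f x)).integral_comp_comm hg
  simp only [h1]
  exact ((B.flip (∫ y, g y ∂ν)).integral_comp_comm hf).symm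

variable (B : E₀ →L[ℂ] E₁ →L[ℂ] E₂) (u : 𝓢(Rd d, ℂ) →L[ℂ] E₀) (v : 𝓢(Rd d, ℂ) →L[ℂ] E₁)
  {γ₀ γ₁ h₀ h₁ : 𝓢(Rd d, ℂ)}

/-- The pairing through `B` of two short-time Fourier transforms. -/
noncomputable def pairSTFT (γ₀ γ₁ : 𝓢(Rd d, ℂ)) (p : (Rd d × Rd d) × (Rd d × Rd d)) : E₂ :=
  B (clmSTFT γ₀ u p.1) (clmSTFT γ₁ v p.2)

theorem continuous_pairSTFT (γ₀ γ₁ : 𝓢(Rd d, ℂ)) : Continuous (pairSTFT B u v γ₀ γ₁) := by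
  have h1 := continuous_clmSTFT γ₀ u
  have h2 := continuous_clmSTFT γ₁ v
  unfold pairSTFT
  fun_prop

theorem norm_pairSTFT_le (γ₀ γ₁ : 𝓢(Rd d, ℂ)) (p : (Rd d × Rd d) × (Rd d × Rd d)) :
    ‖pairSTFT B u v γ₀ γ₁ p‖ ≤ ‖B‖ * (‖clmSTFT γ₀ u p.1‖ * ‖clmSTFT γ₁ v p.2‖) :=
  (B.le_opNorm₂ _ _).trans (le_of_eq (by ring))

variable [CompleteSpace E₀] [CompleteSpace E₁] [CompleteSpace E₂]

theorem continuous_mollifiedKernel_integrand (h₀ h₁ ρ σ φ : 𝓢(Rd d, ℂ)) {ε : ℝ} (hε : ε ≠ 0) :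
    Continuous fun q : Rd d × ((Rd d × Rd d) × (Rd d × Rd d)) =>
      φ q.1 * (tfCoeff h₀ (reflDilate ρ ε q.1) q.2.1.1 q.2.1.2 *
        tfCoeff h₁ (reflDilate σ ε q.1) q.2.2.1 q.2.2.2) := by
  have e1 : Continuous fun q : Rd d × ((Rd d × Rd d) × (Rd d × Rd d)) => (q.1, q.2.1) := by
    fun_prop
  have e2 : Continuous fun q : Rd d × ((Rd d × Rd d) × (Rd d × Rd d)) => (q.1, q.2.2) := by
    fun_prop
  have k1 := (continuous_tfCoeff_reflDilate h₀ ρ hε).comp e1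
  have k2 := (continuous_tfCoeff_reflDilate h₁ σ hε).comp e2
  have k3 := (φ.continuous.comp continuous_fst).mul (k1.mul k2)
  simpa only [Function.comp_def, Pi.mul_def] using k3

theorem stronglyMeasurable_mollifiedKernel (h₀ h₁ ρ σ φ : 𝓢(Rd d, ℂ)) {ε : ℝ} (hε : ε ≠ 0) :
    StronglyMeasurable (mollifiedKernel h₀ h₁ ρ σ φ ε) := by
  have k := (continuous_mollifiedKernel_integrand h₀ h₁ ρ σ φ hε).stronglyMeasurable
  exact k.integral_prod_left (μ := volume)

/-- Insert the reproducing formula for `u` and for `v` at the mollifiers, combine the two integrals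
through `B`, and exchange with the integral over `y`. -/
theorem integral_mollified_product (hγ₀ : ∫ y, h₀ y * γ₀ y = 1) (hγ₁ : ∫ y, h₁ y * γ₁ y = 1)
    (ρ σ φ : 𝓢(Rd d, ℂ)) {ε : ℝ} (hε : ε ≠ 0) :
    Integrable (fun y => φ y • B (u (reflDilate ρ ε y)) (v (reflDilate σ ε y))) ∧
    ∫ y, φ y • B (u (reflDilate ρ ε y)) (v (reflDilate σ ε y))
      = ∫ p, mollifiedKernel h₀ h₁ ρ σ φ ε p • pairSTFT B u v γ₀ γ₁ p := by
  obtain ⟨M₀, hM₀⟩ := exists_integrable_clmSTFT γ₀ u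
  obtain ⟨M₁, hM₁⟩ := exists_integrable_clmSTFT γ₁ v
  let N := max M₀ M₁
  obtain ⟨C₀, hC₀, hA₀⟩ := exists_norm_tfCoeff_reflDilate_le h₀ ρ hε N
  obtain ⟨C₁, hC₁, hA₁⟩ := exists_norm_tfCoeff_reflDilate_le h₁ σ hε N
  let f : Rd d → (Rd d × Rd d) × (Rd d × Rd d) → E₂ := fun y p =>
    (φ y * (tfCoeff h₀ (reflDilate ρ ε y) p.1.1 p.1.2 *
      tfCoeff h₁ (reflDilate σ ε y) p.2.1 p.2.2)) • pairSTFT B u v γ₀ γ₁ p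
  have hcF := continuous_pairSTFT B u v γ₀ γ₁
  have hf : Integrable (Function.uncurry f) := by
    -- Each mollified factor costs `⟨y⟩^N`, and `φ` absorbs both; the decay of order `N` in phase
    -- space compensates the growth of the transforms.
    have hi := ((integrable_schwartz_mul_bracketPow φ (N + N)).mul_prod
      ((hM₀ N (le_max_left _ _)).mul_prod (hM₁ N (le_max_right _ _)))).const_mul (C₀ * C₁ * ‖B‖)
    have hc : Continuous (Function.uncurry f) := by
      have k1 := continuous_mollifiedKernel_integrand h₀ h₁ ρ σ φ hε
      have k2 := k1.smul (hcF.comp (continuous_snd (X := Rd d)))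
      simpa only [Function.comp_def, Pi.smul_def', f, Function.uncurry_def] using k2
    refine hi.mono' hc.aestronglyMeasurable (Eventually.of_forall fun q => ?_)
    obtain ⟨y, ⟨x, ξ⟩, ⟨x', ξ'⟩⟩ := q
    simp only [f, Function.uncurry_def, norm_smul, norm_mul]
    have p0 := bracketPow_nonneg (N : ℝ) y
    have p1 := bracketPow_nonneg (-(N : ℝ)) x
    have p2 := bracketPow_nonneg (-(N : ℝ)) ξ
    have p3 := bracketPow_nonneg (-(N : ℝ)) x'
    have p4 := bracketPow_nonneg (-(N : ℝ)) ξ'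
    calc _ ≤ ‖φ y‖ * ((C₀ * (bracketPow N y * (bracketPow (-N) x * bracketPow (-N) ξ))) *
          (C₁ * (bracketPow N y * (bracketPow (-N) x' * bracketPow (-N) ξ')))) *
          (‖B‖ * (‖clmSTFT γ₀ u (x, ξ)‖ * ‖clmSTFT γ₁ v (x', ξ')‖)) := by
          gcongr
          · exact hA₀ _ _ _
          · exact hA₁ _ _ _
          · exact norm_pairSTFT_le B u v γ₀ γ₁ _
      _ = _ := by
          rw [bracketPow_add]
          ring
  have hpt : ∀ y, φ y • B (u (reflDilate ρ ε y)) (v (reflDilate σ ε y)) = ∫ p, f y p := by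
    intro y
    rw [clm_apply_eq_integral_tfCoeff_smul u hγ₀, clm_apply_eq_integral_tfCoeff_smul v hγ₁,
      (clm_integral_integral B (integrable_tfCoeff_smul u h₀ γ₀ _)
        (integrable_tfCoeff_smul v h₁ γ₁ _)).2, ← integral_smul]
    refine integral_congr_ae (Eventually.of_forall fun p => ?_)
    simp only [f, pairSTFT, clmSTFT, map_smul, _root_.smul_apply, smul_smul]
    ring_nf
  simp only [hpt]
  refine ⟨hf.integral_prod_left, ?_⟩
  rw [integral_integral_swap hf]
  refine integral_congr_ae (Eventually.of_forall fun p => ?_)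
  simp only [f, mollifiedKernel]
  rw [integral_smul_const]

/-- The product of two tempered distributions, given as a superposition of products of
time-frequency shifts. -/
theorem exists_isDistribProduct (u : 𝓢'(Rd d, E₀)) (v : 𝓢'(Rd d, E₁))
    (hγ₀ : ∫ y, h₀ y * γ₀ y = 1) (hγ₁ : ∫ y, h₁ y * γ₁ y = 1) {N : ℕ}
    (hN : Integrable fun p : (Rd d × Rd d) × (Rd d × Rd d) =>
      pairWeight (-N) p * (‖clmSTFT γ₀ u p.1‖ * ‖clmSTFT γ₁ v p.2‖)) :
    ∃ w : 𝓢'(Rd d, E₂), IsDistribProduct B u v w ∧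
      ∀ φ, w φ = ∫ p, productKernel h₀ h₁ φ p • pairSTFT B u v γ₀ γ₁ p := by
  obtain ⟨m, C, hC, hb⟩ := exists_norm_productKernel_le h₀ h₁ N
  have hcF := continuous_pairSTFT B u v γ₀ γ₁
  let D : ℝ := ∫ p : (Rd d × Rd d) × (Rd d × Rd d),
    pairWeight (-N) p * (‖clmSTFT γ₀ u p.1‖ * ‖clmSTFT γ₁ v p.2‖)
  have hD : 0 ≤ D := integral_nonneg fun p =>
    mul_nonneg (pairWeight_nonneg _ p) (mul_nonneg (norm_nonneg _) (norm_nonneg _))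
  have hle : ∀ φ p, ‖productKernel h₀ h₁ φ p • pairSTFT B u v γ₀ γ₁ p‖
      ≤ (C * schwartzNorm d m φ * ‖B‖) *
        (pairWeight (-N) p * (‖clmSTFT γ₀ u p.1‖ * ‖clmSTFT γ₁ v p.2‖)) := by
    intro φ p
    have := pairWeight_nonneg (-N : ℝ) p
    have := schwartzNorm_nonneg m φ
    rw [norm_smul]
    calc _ ≤ (C * schwartzNorm d m φ * pairWeight (-N) p) *
          (‖B‖ * (‖clmSTFT γ₀ u p.1‖ * ‖clmSTFT γ₁ v p.2‖)) := by
          gcongr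
          · exact hb φ p
          · exact norm_pairSTFT_le B u v γ₀ γ₁ p
      _ = _ := by ring
  have hint : ∀ φ, Integrable fun p => productKernel h₀ h₁ φ p • pairSTFT B u v γ₀ γ₁ p :=
    fun φ => (hN.const_mul _).mono'
      (Continuous.aestronglyMeasurable (by fun_prop)) (Eventually.of_forall (hle φ))
  have hadd : ∀ φ ψ p, productKernel h₀ h₁ (φ + ψ) p
      = productKernel h₀ h₁ φ p + productKernel h₀ h₁ ψ p := fun φ ψ p => by
    simp [productKernel, tfCoeff, fourierInv_add]
  have hsmul : ∀ (a : ℂ) φ p, productKernel h₀ h₁ (a • φ) p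
      = a * productKernel h₀ h₁ φ p := fun a φ p => by
    simp [productKernel, tfCoeff, fourierInv_smul]
  let w : 𝓢(Rd d, ℂ) →L[ℂ] E₂ := mkCLMtoNormedSpace
    (fun φ => ∫ p, productKernel h₀ h₁ φ p • pairSTFT B u v γ₀ γ₁ p)
    (fun φ ψ => by
      rw [← integral_add (hint φ) (hint ψ)]
      simp only [hadd, add_smul])
    (fun a φ => by
      rw [RingHom.id_apply, ← integral_smul]
      simp only [hsmul, mul_smul])
    ⟨Finset.Iic (m, m), C * ‖B‖ * D, by positivity, fun φ => by
      refine (norm_integral_le_of_norm_le (hN.const_mul _)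
        (Eventually.of_forall (hle φ))).trans (le_of_eq ?_)
      rw [integral_const_mul]
      simp only [D, schwartzNorm]
      ring⟩
  refine ⟨ContinuousLinearMap.toPointwiseConvergenceCLM _ _ _ _ w, ?_, fun φ => rfl⟩
  intro ρ σ hρ hσ φ
  refine ⟨?_, ?_⟩
  · filter_upwards [self_mem_nhdsWithin] with ε hε
    exact (integral_mollified_product B u v hγ₀ hγ₁ ρ σ φ (ne_of_gt hε)).1
  · change Tendsto _ _ (𝓝 (∫ p, productKernel h₀ h₁ φ p • pairSTFT B u v γ₀ γ₁ p))
    obtain ⟨C', hC', hb'⟩ := exists_norm_mollifiedKernel_le h₀ h₁ ρ σ φ N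
    refine Tendsto.congr'
      (f₁ := fun ε => ∫ p, mollifiedKernel h₀ h₁ ρ σ φ ε p • pairSTFT B u v γ₀ γ₁ p) ?_ ?_
    · filter_upwards [self_mem_nhdsWithin] with ε hε
      exact (integral_mollified_product B u v hγ₀ hγ₁ ρ σ φ (ne_of_gt hε)).2.symm
    -- The bound on the mollified kernels is uniform for `ε ≤ 1`, so `hN` supplies an integrable
    -- majorant independent of `ε`.
    refine tendsto_integral_filter_of_dominated_convergence
      (fun p => (C' * ‖B‖) *
        (pairWeight (-N) p * (‖clmSTFT γ₀ u p.1‖ * ‖clmSTFT γ₁ v p.2‖)))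
      ?_ ?_ (hN.const_mul _) (Eventually.of_forall fun p => ?_)
    · filter_upwards [self_mem_nhdsWithin] with ε hε
      exact (stronglyMeasurable_mollifiedKernel h₀ h₁ ρ σ φ
        (ne_of_gt hε)).aestronglyMeasurable.smul hcF.aestronglyMeasurable
    · filter_upwards [self_mem_nhdsWithin, Ioo_mem_nhdsGT one_pos] with ε hε hε'
      refine Eventually.of_forall fun p => ?_
      have := pairWeight_nonneg (-N : ℝ) p
      rw [norm_smul]
      calc _ ≤ (C' * pairWeight (-N) p) *
            (‖B‖ * (‖clmSTFT γ₀ u p.1‖ * ‖clmSTFT γ₁ v p.2‖)) := by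
            gcongr
            · exact hb' ε hε hε'.2.le p
            · exact norm_pairSTFT_le B u v γ₀ γ₁ p
        _ = _ := by ring
    · exact (tendsto_mollifiedKernel h₀ h₁ φ hρ hσ p).smul_const _

end Products

/-! ### Minkowski's integral inequality for extended nonnegative functions -/

section Minkowski

variable {X Q : Type*} [MeasurableSpace X] [MeasurableSpace Q]

/-- Equality fails at `n = ∞`, where the left side is `0 * ∞ = 0`. -/
theorem ENNReal.rpow_neg_mul_rpow_le (n : ℝ≥0∞) {P : ℝ} (hP : 1 < P) :
    n ^ (-(P - 1)) * n ^ P ≤ n := by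
  rcases eq_or_ne n 0 with rfl | h0
  · rw [ENNReal.zero_rpow_of_pos (zero_lt_one.trans hP)]
    simp
  rcases eq_or_ne n ∞ with rfl | ht
  · exact le_top
  rw [← ENNReal.rpow_add _ _ h0 ht]
  simp

/-- Minkowski's integral inequality for finite exponents greater than one. -/
theorem lintegral_rpow_lintegral_le {μ : Measure X} {ν : Measure Q} [SFinite μ] [SFinite ν]
    {H : X → Q → ℝ≥0∞} (hH : Measurable (Function.uncurry H)) {P : ℝ} (hP : 1 < P) :
    (∫⁻ x, (∫⁻ q, H x q ∂ν) ^ P ∂μ) ^ (1 / P)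
      ≤ ∫⁻ q, (∫⁻ x, H x q ^ P ∂μ) ^ (1 / P) ∂ν := by
  have hP0 : 0 < P := by linarith
  let n : Q → ℝ≥0∞ := fun q => (∫⁻ x, H x q ^ P ∂μ) ^ (1 / P)
  have hHP : Measurable fun z : X × Q => H z.1 z.2 ^ P := hH.pow_const P
  have hHq : ∀ q, Measurable fun x => H x q ^ P := fun q => hHP.comp measurable_prodMk_right
  have hn : Measurable n := (hHP.lintegral_prod_left' (μ := μ)).pow_const _
  have hnP : ∀ q, ∫⁻ x, H x q ^ P ∂μ = n q ^ P := fun q => by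
    simp only [n]
    rw [← ENNReal.rpow_mul, one_div_mul_cancel hP0.ne', ENNReal.rpow_one]
  change _ ≤ ∫⁻ q, n q ∂ν
  rcases eq_or_ne (∫⁻ q, n q ∂ν) ∞ with hT | hT
  · rw [hT]; exact le_top
  have hfin : ∀ᵐ q ∂ν, n q ≠ ∞ := (ae_lt_top hn hT).mono fun q h => h.ne
  -- Where `n` vanishes its negative powers are infinite, so the factorization used below needs `H`
  -- to vanish there as well.
  have hzero : ∀ᵐ x ∂μ, ∀ᵐ q ∂ν, n q = 0 → H x q = 0 := by
    rw [Measure.ae_ae_comm]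
    · refine Eventually.of_forall fun q => ?_
      by_cases h0 : n q = 0
      · have h1 : ∫⁻ x, H x q ^ P ∂μ = 0 := by
          rw [hnP, h0, ENNReal.zero_rpow_of_pos hP0]
        rw [lintegral_eq_zero_iff (hHq q)] at h1
        filter_upwards [h1] with x hx _
        exact (ENNReal.rpow_eq_zero_iff_of_pos hP0).1 hx
      · exact Eventually.of_forall fun x h => absurd h h0
    · have : {z : X × Q | n z.2 = 0 → H z.1 z.2 = 0}
          = {z : X × Q | n z.2 = 0}ᶜ ∪ {z | H z.1 z.2 = 0} := by
        ext z
        simp [imp_iff_not_or]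
      rw [this]
      exact ((measurableSet_eq_fun (hn.comp measurable_snd) measurable_const).compl).union
        (measurableSet_eq_fun hH measurable_const)
  let P' : ℝ := P / (P - 1)
  have hPP : P.HolderConjugate P' := Real.HolderConjugate.conjExponent hP
  have hP1 : 0 < P - 1 := by linarith
  -- Hölder's inequality applied to `H = (n ^ (-(P - 1) / P) * H) * n ^ ((P - 1) / P)`. After
  -- integration over `x`, Tonelli's theorem and `∫ H ^ P = n ^ P` turn the last integral into at
  -- most `∫ n`.
  have hpt : ∀ᵐ x ∂μ, (∫⁻ q, H x q ∂ν) ^ P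
      ≤ (∫⁻ q, n q ∂ν) ^ (P - 1) * ∫⁻ q, n q ^ (-(P - 1)) * H x q ^ P ∂ν := by
    filter_upwards [hzero] with x hx
    have h1 : ∫⁻ q, H x q ∂ν
        = ∫⁻ q, ((fun q => n q ^ (-((P - 1) / P)) * H x q) * fun q => n q ^ ((P - 1) / P)) q ∂ν := by
      refine lintegral_congr_ae ?_
      filter_upwards [hx, hfin] with q hq hq'
      by_cases h0 : n q = 0
      · simp [hq h0]
      · simp only [Pi.mul_apply]
        rw [mul_right_comm, ← ENNReal.rpow_add _ _ h0 hq', neg_add_cancel, ENNReal.rpow_zero,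
          one_mul]
    have h2 := ENNReal.lintegral_mul_le_Lp_mul_Lq ν hPP
      (f := fun q => n q ^ (-((P - 1) / P)) * H x q) (g := fun q => n q ^ ((P - 1) / P))
      (((hn.pow_const _).mul (hH.comp measurable_prodMk_left)).aemeasurable)
      (hn.pow_const _).aemeasurable
    rw [← h1] at h2
    have h3 : ∀ q, (n q ^ ((P - 1) / P)) ^ P' = n q := fun q => by
      rw [← ENNReal.rpow_mul]
      have : (P - 1) / P * P' = 1 := by
        simp only [P']
        field_simp
      rw [this, ENNReal.rpow_one]
    have h4 : ∀ q, (n q ^ (-((P - 1) / P)) * H x q) ^ P = n q ^ (-(P - 1)) * H x q ^ P :=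
      fun q => by
        rw [ENNReal.mul_rpow_of_nonneg _ _ hP0.le, ← ENNReal.rpow_mul]
        have : -((P - 1) / P) * P = -(P - 1) := by field_simp
        rw [this]
    simp only [h3, h4] at h2
    calc (∫⁻ q, H x q ∂ν) ^ P
        ≤ ((∫⁻ q, n q ^ (-(P - 1)) * H x q ^ P ∂ν) ^ (1 / P) * (∫⁻ q, n q ∂ν) ^ (1 / P')) ^ P :=
          ENNReal.rpow_le_rpow h2 hP0.le
      _ = _ := by
          rw [ENNReal.mul_rpow_of_nonneg _ _ hP0.le, ← ENNReal.rpow_mul, ← ENNReal.rpow_mul,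
            one_div_mul_cancel hP0.ne', ENNReal.rpow_one, mul_comm]
          have : 1 / P' * P = P - 1 := by
            simp only [P']
            field_simp
          rw [this]
  have hmeas : Measurable fun z : X × Q => n z.2 ^ (-(P - 1)) * H z.1 z.2 ^ P :=
    ((hn.comp measurable_snd).pow_const _).mul hHP
  have hint : ∫⁻ x, (∫⁻ q, H x q ∂ν) ^ P ∂μ ≤ (∫⁻ q, n q ∂ν) ^ P := by
    calc ∫⁻ x, (∫⁻ q, H x q ∂ν) ^ P ∂μ
        ≤ ∫⁻ x, (∫⁻ q, n q ∂ν) ^ (P - 1) * ∫⁻ q, n q ^ (-(P - 1)) * H x q ^ P ∂ν ∂μ :=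
          lintegral_mono_ae hpt
      _ = (∫⁻ q, n q ∂ν) ^ (P - 1) * ∫⁻ q, ∫⁻ x, n q ^ (-(P - 1)) * H x q ^ P ∂μ ∂ν := by
          rw [lintegral_const_mul _ hmeas.lintegral_prod_right', lintegral_lintegral_swap
            (f := fun x q => n q ^ (-(P - 1)) * H x q ^ P) hmeas.aemeasurable]
      _ ≤ (∫⁻ q, n q ∂ν) ^ (P - 1) * ∫⁻ q, n q ∂ν := by
          gcongr with q
          rw [lintegral_const_mul _ (hHq q), hnP]
          exact ENNReal.rpow_neg_mul_rpow_le _ hP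
      _ = (∫⁻ q, n q ∂ν) ^ P := by
          nth_rewrite 2 [← ENNReal.rpow_one (∫⁻ q, n q ∂ν)]
          rw [← ENNReal.rpow_add_of_nonneg _ _ hP1.le zero_le_one, sub_add_cancel]
  calc _ ≤ ((∫⁻ q, n q ∂ν) ^ P) ^ (1 / P) := ENNReal.rpow_le_rpow hint (by positivity)
    _ = _ := by rw [← ENNReal.rpow_mul, mul_one_div_cancel hP0.ne', ENNReal.rpow_one]

/-- Minkowski's integral inequality. -/
theorem eLpNorm_lintegral_le {μ : Measure X} {ν : Measure Q} [SFinite μ] [SFinite ν]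
    {H : X → Q → ℝ≥0∞} (hH : Measurable (Function.uncurry H)) {p : ℝ≥0∞} (hp : 1 ≤ p)
    (hn : Measurable fun q => eLpNorm (fun x => H x q) p μ) :
    eLpNorm (fun x => ∫⁻ q, H x q ∂ν) p μ ≤ ∫⁻ q, eLpNorm (fun x => H x q) p μ ∂ν := by
  rcases eq_or_ne p ∞ with rfl | hpt
  · rw [eLpNorm_exponent_top, eLpNormEssSup]
    refine essSup_le_of_ae_le _ ?_
    -- For each `q` the bound holds for almost every `x`; the measurability hypothesis `hn` allows
    -- the two quantifiers to be exchanged.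
    have h1 : ∀ᵐ x ∂μ, ∀ᵐ q ∂ν, H x q ≤ eLpNorm (fun x => H x q) ∞ μ := by
      have hms : MeasurableSet {z : X × Q | H z.1 z.2 ≤ eLpNorm (fun x => H x z.2) ∞ μ} :=
        measurableSet_le hH (hn.comp measurable_snd)
      rw [Measure.ae_ae_comm hms]
      refine Eventually.of_forall fun q => ?_
      rw [eLpNorm_exponent_top]
      exact ae_le_essSup
    filter_upwards [h1] with x hx
    simp only [enorm_eq_self]
    exact lintegral_mono_ae hx
  · have hp0 : p ≠ 0 := (zero_lt_one.trans_le hp).ne'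
    simp only [eLpNorm_eq_lintegral_rpow_enorm_toReal hp0 hpt, enorm_eq_self]
    have hP : 1 ≤ p.toReal := by
      rw [← ENNReal.toReal_one]
      exact ENNReal.toReal_mono hpt hp
    rcases hP.eq_or_lt with h1 | h1
    · simp only [← h1, ENNReal.rpow_one, div_one]
      exact (lintegral_lintegral_swap hH.aemeasurable).le
    · exact lintegral_rpow_lintegral_le hH h1

end Minkowski

/-! ### Mixed Lebesgue norms and superpositions of translates -/

section MixedNorms

variable {d : ℕ}

theorem le_eLpNorm_top_of_continuous {f : Rd d → ℝ≥0∞} (hf : Continuous f) (x : Rd d) :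
    f x ≤ eLpNorm f ∞ volume := by
  by_contra h
  rw [not_le] at h
  have hae : ∀ᵐ x, f x ≤ eLpNorm f ∞ volume := by
    rw [eLpNorm_exponent_top]
    exact ae_le_essSup
  have h0 : volume {x | eLpNorm f ∞ volume < f x} = 0 := by
    simpa [ae_iff] using hae
  have ho : IsOpen {x | eLpNorm f ∞ volume < f x} := isOpen_lt continuous_const hf
  have he := ho.measure_eq_zero_iff volume |>.1 h0
  exact (he.subset h : x ∈ (∅ : Set (Rd d)))

theorem eLpNorm_top_eq_iSup_of_continuous {f : Rd d → ℝ≥0∞} (hf : Continuous f) :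
    eLpNorm f ∞ volume = ⨆ x, f x := by
  refine le_antisymm ?_ (iSup_le (le_eLpNorm_top_of_continuous hf))
  rw [eLpNorm_exponent_top, eLpNormEssSup]
  exact essSup_le_of_ae_le _ (Eventually.of_forall fun x => le_iSup f x)

/-- For `p = ∞`, continuity turns the essential supremum into a pointwise one, and a supremum of
continuous functions of `ω` is lower semicontinuous. For other nonzero `p` this is Tonelli's
theorem. -/
theorem measurable_eLpNorm_of_continuous {F : Rd d → Rd d → ℝ≥0∞}
    (hF : Continuous (Function.uncurry F)) (p : ℝ≥0∞) :
    Measurable fun ω => eLpNorm (fun x => F x ω) p volume := by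
  have hFx : ∀ ω, Continuous fun x => F x ω := fun ω => hF.comp (Continuous.prodMk_left ω)
  rcases eq_or_ne p 0 with rfl | hp0
  · simp
  rcases eq_or_ne p ∞ with rfl | hpt
  · simp only [eLpNorm_top_eq_iSup_of_continuous (hFx _)]
    exact (lowerSemicontinuous_iSup fun x =>
      (hF.comp (Continuous.prodMk_right x)).lowerSemicontinuous).measurable
  · simp only [eLpNorm_eq_lintegral_rpow_enorm_toReal hp0 hpt, enorm_eq_self]
    exact ((hF.measurable.pow_const p.toReal).lintegral_prod_left'
      (μ := volume)).pow_const _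

/-- The `L^q` norm in the second variable of the `L^p` norm in the first variable. -/
noncomputable def mixedNorm (p q : ℝ≥0∞) (F : Rd d → Rd d → ℝ≥0∞) : ℝ≥0∞ :=
  eLpNorm (fun ω => eLpNorm (fun x => F x ω) p volume) q volume

theorem eLpNorm_comp_add_right {f : Rd d → ℝ≥0∞} (hf : Measurable f) (p : ℝ≥0∞) (t : Rd d) :
    eLpNorm (fun x => f (x + t)) p volume = eLpNorm f p volume :=
  eLpNorm_comp_measurePreserving hf.aestronglyMeasurable (measurePreserving_add_right volume t)

/-- Superpositions of translates are bounded in mixed norm. -/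
theorem mixedNorm_lintegral_translate_le {Q : Type*} [MeasurableSpace Q] (ν : Measure Q)
    [SFinite ν] {F : Rd d → Rd d → ℝ≥0∞} (hF : Continuous (Function.uncurry F))
    {t o : Q → Rd d} (ht : Measurable t) (ho : Measurable o) {p q : ℝ≥0∞} (hp : 1 ≤ p)
    (hq : 1 ≤ q) :
    mixedNorm p q (fun x ω => ∫⁻ a, F (x + t a) (ω + o a) ∂ν)
      ≤ mixedNorm p q F * ν Set.univ := by
  let n : Rd d → ℝ≥0∞ := fun ω => eLpNorm (fun x => F x ω) p volume
  have hn : Measurable n := measurable_eLpNorm_of_continuous hF p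
  have htr : ∀ ω a, eLpNorm (fun x => F (x + t a) (ω + o a)) p volume = n (ω + o a) :=
    fun ω a => eLpNorm_comp_add_right (f := fun x => F x (ω + o a))
      (hF.comp (Continuous.prodMk_left _)).measurable p (t a)
  -- Minkowski's inequality is used twice, here in the inner variable and below in the outer one;
  -- translation invariance removes the shifts each time.
  have h1 : ∀ ω, eLpNorm (fun x => ∫⁻ a, F (x + t a) (ω + o a) ∂ν) p volume
      ≤ ∫⁻ a, n (ω + o a) ∂ν := by
    intro ω
    simp only [← htr]
    refine eLpNorm_lintegral_le ?_ hp ?_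
    · exact hF.measurable.comp ((measurable_fst.add (ht.comp measurable_snd)).prodMk
        (measurable_const.add (ho.comp measurable_snd)))
    · simp only [htr]
      exact hn.comp (measurable_const.add ho)
  calc mixedNorm p q (fun x ω => ∫⁻ a, F (x + t a) (ω + o a) ∂ν)
      ≤ eLpNorm (fun ω => ∫⁻ a, n (ω + o a) ∂ν) q volume :=
        eLpNorm_mono_enorm fun ω => by simpa only [enorm_eq_self] using h1 ω
    _ ≤ ∫⁻ a, eLpNorm (fun ω => n (ω + o a)) q volume ∂ν := by
        refine eLpNorm_lintegral_le ?_ hq ?_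
        · exact hn.comp (measurable_fst.add (ho.comp measurable_snd))
        · simp only [eLpNorm_comp_add_right hn]
          exact measurable_const
    _ = mixedNorm p q F * ν Set.univ := by
        simp only [eLpNorm_comp_add_right hn, lintegral_const]
        rfl

/-- Integration against an integrable bracket is bounded on every Lebesgue space. -/
theorem exists_lintegral_bracketPow_mul_le {r : ℝ} (hr : r < -d) (hr0 : r ≤ 0) {p : ℝ≥0∞}
    (hp : 1 ≤ p) :
    ∃ K : ℝ≥0∞, K ≠ ∞ ∧ ∀ f : Rd d → ℝ≥0∞, Measurable f →
      ∫⁻ x, ENNReal.ofReal (bracketPow r x) * f x ≤ K * eLpNorm f p volume := by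
  have hκ : Measurable fun x : Rd d => ENNReal.ofReal (bracketPow r x) :=
    (continuous_bracketPow r).measurable.ennreal_ofReal
  -- The measure `m` is finite and dominated by Lebesgue measure, so the claim follows from the
  -- inclusion of `L^p(m)` in `L^1(m)`.
  let m : Measure (Rd d) := volume.withDensity fun x => ENNReal.ofReal (bracketPow r x)
  have hm : m ≤ volume := by
    conv_rhs => rw [← withDensity_one (μ := (volume : Measure (Rd d)))]
    refine withDensity_mono (Eventually.of_forall fun x => ?_)
    refine ENNReal.ofReal_le_one.2 ?_
    simpa [bracketPow_zero] using bracketPow_mono hr0 x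
  have hfin : m Set.univ ≠ ∞ := by
    rw [withDensity_apply _ MeasurableSet.univ, Measure.restrict_univ]
    exact (integrable_bracketPow hr).lintegral_lt_top.ne
  -- The exponent is `1 - 1/p`. For `p = ∞` it is `1`, because `toReal` sends `∞` to `0` and `1 / 0
  -- = 0`.
  refine ⟨m Set.univ ^ (1 / (1 : ℝ≥0∞).toReal - 1 / p.toReal),
    ENNReal.rpow_ne_top_of_nonneg ?_ hfin, fun f hf => ?_⟩
  · rw [ENNReal.toReal_one, div_one, sub_nonneg]
    rcases eq_or_ne p ∞ with rfl | hpt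
    · simp
    · have : 1 ≤ p.toReal := by
        rw [← ENNReal.toReal_one]
        exact ENNReal.toReal_mono hpt hp
      rw [div_le_one (by linarith)]
      exact this
  · have h1 : ∫⁻ x, ENNReal.ofReal (bracketPow r x) * f x = eLpNorm f 1 m := by
      rw [eLpNorm_one_eq_lintegral_enorm]
      simp only [enorm_eq_self]
      rw [lintegral_withDensity_eq_lintegral_mul _ hκ hf]
      simp only [Pi.mul_apply]
    rw [h1, mul_comm]
    refine (eLpNorm_le_eLpNorm_mul_rpow_measure_univ hp hf.aestronglyMeasurable).trans ?_
    gcongr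

end MixedNorms

/-! ### The product estimate in mixed norms -/

section ProductEstimate

variable {d : ℕ}

theorem bracketPow_mul_bracketPow_neg_le {t n k : ℝ} (h : t + k ≤ n) (x : Rd d) :
    bracketPow t x * bracketPow (-n) x ≤ bracketPow (-k) x := by
  rw [← bracketPow_add]
  exact bracketPow_mono (by linarith) x

/-- Peetre's inequality for the weights attached to a product. -/
theorem exists_weight_mul_le (r s δ : ℝ) : ∃ (N : ℕ) (c : ℝ), 0 ≤ c ∧
    ∀ x₀ ξ₀ x ξ x' ξ' : Rd d,
      bracketPow (r + δ) x₀ * bracketPow s ξ₀ *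
        (bracketPow (-N) (x - x₀) * bracketPow (-N) (x' - x₀) * bracketPow (-N) (ξ + ξ' - ξ₀))
      ≤ c * ((bracketPow δ x * bracketPow |s| ξ) * (bracketPow r x' * bracketPow s ξ') *
        (bracketPow (-(d + 1)) (x - x₀) * bracketPow (-(d + 1)) (x' - x₀) *
          bracketPow (-(d + 1)) (ξ + ξ' - ξ₀))) := by
  obtain ⟨N, hN⟩ := exists_nat_ge (|r| + |δ| + |s| + (d + 1))
  have a1 := abs_nonneg r
  have a2 := abs_nonneg δ
  have a3 := abs_nonneg s
  refine ⟨N, 2 ^ (|δ| / 2) * 2 ^ (|r| / 2) * (2 ^ (|s| / 2) * 2 ^ (|s| / 2)), by positivity,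
    fun x₀ ξ₀ x ξ x' ξ' => ?_⟩
  have h1 : bracketPow δ x₀ ≤ 2 ^ (|δ| / 2) * bracketPow δ x * bracketPow |δ| (x - x₀) := by
    have := bracketPow_add_le δ x (-(x - x₀))
    rwa [bracketPow_neg_arg, neg_sub, add_sub_cancel] at this
  have h2 : bracketPow r x₀ ≤ 2 ^ (|r| / 2) * bracketPow r x' * bracketPow |r| (x' - x₀) := by
    have := bracketPow_add_le r x' (-(x' - x₀))
    rwa [bracketPow_neg_arg, neg_sub, add_sub_cancel] at this
  -- Write `ξ₀ = ξ' + ξ - (ξ + ξ' - ξ₀)`. The signed exponent `s` stays on `ξ'`, and the other two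
  -- terms carry `|s|`: this is why the symbol needs the weight `|s|`.
  have h3 : bracketPow s ξ₀ ≤ 2 ^ (|s| / 2) * bracketPow s ξ' * bracketPow |s| (ξ₀ - ξ') := by
    have := bracketPow_add_le s ξ' (ξ₀ - ξ')
    rwa [add_sub_cancel] at this
  have h4 : bracketPow |s| (ξ₀ - ξ')
      ≤ 2 ^ (|s| / 2) * bracketPow |s| ξ * bracketPow |s| (ξ + ξ' - ξ₀) := by
    have := bracketPow_add_le |s| ξ (-(ξ + ξ' - ξ₀))
    rw [bracketPow_neg_arg, abs_abs] at this
    refine le_trans (le_of_eq ?_) this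
    congr 1
    abel
  have k1 := bracketPow_mul_bracketPow_neg_le (t := |δ|) (n := N) (k := d + 1) (by linarith)
    (x - x₀)
  have k2 := bracketPow_mul_bracketPow_neg_le (t := |r|) (n := N) (k := d + 1) (by linarith)
    (x' - x₀)
  have k3 := bracketPow_mul_bracketPow_neg_le (t := |s|) (n := N) (k := d + 1) (by linarith)
    (ξ + ξ' - ξ₀)
  have p := fun t y => bracketPow_nonneg (d := d) t y
  rw [bracketPow_add]
  calc _ ≤ (2 ^ (|r| / 2) * bracketPow r x' * bracketPow |r| (x' - x₀)) *
        (2 ^ (|δ| / 2) * bracketPow δ x * bracketPow |δ| (x - x₀)) *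
        (2 ^ (|s| / 2) * bracketPow s ξ' *
          (2 ^ (|s| / 2) * bracketPow |s| ξ * bracketPow |s| (ξ + ξ' - ξ₀))) *
        (bracketPow (-N) (x - x₀) * bracketPow (-N) (x' - x₀) *
          bracketPow (-N) (ξ + ξ' - ξ₀)) := by
        have q1 := p r x₀
        have q2 := p δ x₀
        have q3 := p s ξ₀
        have q4 := p s ξ'
        have q5 := p (-N) (x - x₀)
        have q6 := p (-N) (x' - x₀)
        have q7 := p (-N) (ξ + ξ' - ξ₀)
        have h5 := h3.trans (mul_le_mul_of_nonneg_left h4 (by positivity))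
        refine mul_le_mul_of_nonneg_right ?_ (by positivity)
        refine mul_le_mul (mul_le_mul h2 h1 q2 (q1.trans h2)) h5 q3 ?_
        exact mul_nonneg (q1.trans h2) (q2.trans h1)
    _ = (2 ^ (|δ| / 2) * 2 ^ (|r| / 2) * (2 ^ (|s| / 2) * 2 ^ (|s| / 2))) *
        ((bracketPow δ x * bracketPow |s| ξ) * (bracketPow r x' * bracketPow s ξ') *
        ((bracketPow |δ| (x - x₀) * bracketPow (-N) (x - x₀)) *
        (bracketPow |r| (x' - x₀) * bracketPow (-N) (x' - x₀)) *
        (bracketPow |s| (ξ + ξ' - ξ₀) * bracketPow (-N) (ξ + ξ' - ξ₀)))) := by ring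
    _ ≤ _ := by
        have q1 := p r x'
        have q2 := p δ x
        have q3 := p |s| ξ
        have q4 := p s ξ'
        refine mul_le_mul_of_nonneg_left (mul_le_mul_of_nonneg_left ?_ (by positivity))
          (by positivity)
        refine mul_le_mul (mul_le_mul k1 k2 (mul_nonneg (p _ _) (p _ _)) (p _ _)) k3
          (mul_nonneg (p _ _) (p _ _)) (mul_nonneg (p _ _) (p _ _))

theorem lintegral_pair {G : (Rd d × Rd d) × (Rd d × Rd d) → ℝ≥0∞} (hG : Measurable G) :
    ∫⁻ p, G p = ∫⁻ x, ∫⁻ ξ, ∫⁻ x', ∫⁻ ξ', G ((x, ξ), (x', ξ')) := by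
  have e1 : ∫⁻ p, G p = ∫⁻ z, ∫⁻ z', G (z, z') :=
    lintegral_prod (μ := (volume : Measure (Rd d × Rd d))) (ν := volume) G hG.aemeasurable
  have e2 : ∀ z, ∫⁻ z', G (z, z') = ∫⁻ x', ∫⁻ ξ', G (z, (x', ξ')) := fun z =>
    lintegral_prod (μ := (volume : Measure (Rd d))) (ν := volume) (fun z' => G (z, z'))
      (hG.comp measurable_prodMk_left).aemeasurable
  have e3 : ∫⁻ z, ∫⁻ z', G (z, z') = ∫⁻ x, ∫⁻ ξ, ∫⁻ z', G ((x, ξ), z') :=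
    lintegral_prod (μ := (volume : Measure (Rd d))) (ν := volume) (fun z => ∫⁻ z', G (z, z'))
      hG.lintegral_prod_right'.aemeasurable
  rw [e1, e3]
  simp only [e2]

/-- The new variables are `x - x₀`, `ξ`, `x' - x₀` and `ξ + ξ' - ξ₀`. They free the density from the
base point and leave only a translate of the transform of `v`. The shift of `ξ'` depends on `ξ`, so
it is made in the innermost integral. -/
theorem lintegral_pair_translate {G : (Rd d × Rd d) × (Rd d × Rd d) → ℝ≥0∞}
    (hG : Measurable G) (x₀ ξ₀ : Rd d) :
    ∫⁻ p, G p = ∫⁻ a : (Rd d × Rd d) × (Rd d × Rd d),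
      G ((x₀ + a.1.1, a.1.2), (x₀ + a.2.1, ξ₀ + (a.2.2 - a.1.2))) := by
  have hm : Measurable fun a : (Rd d × Rd d) × (Rd d × Rd d) =>
      ((x₀ + a.1.1, a.1.2), (x₀ + a.2.1, ξ₀ + (a.2.2 - a.1.2))) := by fun_prop
  rw [lintegral_pair hG, lintegral_pair (G := fun a =>
    G ((x₀ + a.1.1, a.1.2), (x₀ + a.2.1, ξ₀ + (a.2.2 - a.1.2)))) (hG.comp hm)]
  rw [← lintegral_add_left_eq_self _ x₀]
  refine lintegral_congr fun x => lintegral_congr fun ξ => ?_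
  rw [← lintegral_add_left_eq_self _ x₀]
  refine lintegral_congr fun x' => ?_
  rw [← lintegral_add_left_eq_self _ (ξ₀ - ξ)]
  refine lintegral_congr fun ξ' => ?_
  have e : ξ₀ - ξ + ξ' = ξ₀ + (ξ' - ξ) := by abel
  rw [e]

theorem continuous_slice {F : Rd d → Rd d → ℝ≥0∞} (hF : Continuous (Function.uncurry F))
    (ξ : Rd d) : Continuous fun x => F x ξ :=
  hF.comp (Continuous.prodMk_left ξ)

theorem measurable_comp_pair {α : Type*} [MeasurableSpace α] {F : Rd d → Rd d → ℝ≥0∞}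
    (hF : Continuous (Function.uncurry F)) {f g : α → Rd d} (hf : Measurable f)
    (hg : Measurable g) : Measurable fun a => F (f a) (g a) :=
  hF.measurable.comp (hf.prodMk hg)

theorem mixedNorm_le_const_mul {p q c : ℝ≥0∞} (hc : c ≠ ∞) {F G : Rd d → Rd d → ℝ≥0∞}
    (h : ∀ x ω, F x ω ≤ c * G x ω) : mixedNorm p q F ≤ c * mixedNorm p q G := by
  lift c to NNReal using hc
  refine eLpNorm_le_mul_eLpNorm_of_ae_le_mul' (Eventually.of_forall fun ω => ?_) q
  simp only [enorm_eq_self]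
  refine eLpNorm_le_mul_eLpNorm_of_ae_le_mul' (Eventually.of_forall fun x => ?_) p
  simpa only [enorm_eq_self] using h x ω

/-- The density on `(ℝᵈ)⁴` that governs the product estimates. -/
noncomputable def pairDensity (A : Rd d → ℝ≥0∞) (a : (Rd d × Rd d) × (Rd d × Rd d)) : ℝ≥0∞ :=
  ENNReal.ofReal (bracketPow (-(d + 1)) a.1.1) * A a.1.2 *
    (ENNReal.ofReal (bracketPow (-(d + 1)) a.2.1) * ENNReal.ofReal (bracketPow (-(d + 1)) a.2.2))

theorem measurable_pairDensity {A : Rd d → ℝ≥0∞} (hA : Measurable A) :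
    Measurable (pairDensity A) := by
  have hκ : Measurable fun x : Rd d => ENNReal.ofReal (bracketPow (-(d + 1)) x) :=
    (continuous_bracketPow _).measurable.ennreal_ofReal
  exact ((hκ.comp (measurable_fst.comp measurable_fst)).mul
    (hA.comp (measurable_snd.comp measurable_fst))).mul
    ((hκ.comp (measurable_fst.comp measurable_snd)).mul
    (hκ.comp (measurable_snd.comp measurable_snd)))

theorem lintegral_bracketPow_ne_top :
    ∫⁻ x : Rd d, ENNReal.ofReal (bracketPow (-(d + 1)) x) ≠ ∞ :=
  (integrable_bracketPow (d := d) (r := -(d + 1)) (by linarith)).lintegral_lt_top.ne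

theorem lintegral_pairDensity {A : Rd d → ℝ≥0∞} (hA : Measurable A) :
    ∫⁻ a, pairDensity A a
      = (∫⁻ x : Rd d, ENNReal.ofReal (bracketPow (-(d + 1)) x)) ^ 3 * ∫⁻ ξ, A ξ := by
  have hκ : Measurable fun x : Rd d => ENNReal.ofReal (bracketPow (-(d + 1)) x) :=
    (continuous_bracketPow _).measurable.ennreal_ofReal
  have h1 := lintegral_prod_mul (μ := (volume : Measure (Rd d))) (ν := volume)
    hκ.aemeasurable hA.aemeasurable
  have h2 := lintegral_prod_mul (μ := (volume : Measure (Rd d))) (ν := volume)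
    hκ.aemeasurable hκ.aemeasurable
  have h3 := lintegral_prod_mul (μ := (volume : Measure (Rd d × Rd d))) (ν := volume)
    ((hκ.comp measurable_fst).mul (hA.comp measurable_snd)).aemeasurable
    ((hκ.comp measurable_fst).mul (hκ.comp measurable_snd)).aemeasurable
  refine h3.trans ?_
  refine (congrArg₂ (· * ·) h1 h2).trans ?_
  ring

/-- Integration against integrable brackets in both variables is bounded in mixed norm. -/
theorem exists_lintegral_bracketPow_mul_bracketPow_mul_le {p q : ℝ≥0∞} (hp : 1 ≤ p)
    (hq : 1 ≤ q) : ∃ K : ℝ≥0∞, K ≠ ∞ ∧ ∀ F : Rd d → Rd d → ℝ≥0∞,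
      Continuous (Function.uncurry F) → ∀ η : Rd d,
      ∫⁻ t, ∫⁻ ω, ENNReal.ofReal (bracketPow (-(d + 1)) t) *
        ENNReal.ofReal (bracketPow (-(d + 1)) ω) * F t (ω - η) ≤ K * mixedNorm p q F := by
  obtain ⟨K₁, hK₁, h1⟩ := exists_lintegral_bracketPow_mul_le (d := d) (r := -(d + 1))
    (by linarith) (by linarith [(Nat.cast_nonneg d : (0 : ℝ) ≤ d)]) hp
  obtain ⟨K₂, hK₂, h2⟩ := exists_lintegral_bracketPow_mul_le (d := d) (r := -(d + 1))
    (by linarith) (by linarith [(Nat.cast_nonneg d : (0 : ℝ) ≤ d)]) hq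
  have hκ : Measurable fun x : Rd d => ENNReal.ofReal (bracketPow (-(d + 1)) x) :=
    (continuous_bracketPow _).measurable.ennreal_ofReal
  refine ⟨K₁ * K₂, ENNReal.mul_ne_top hK₁ hK₂, fun F hF η => ?_⟩
  have hn := measurable_eLpNorm_of_continuous hF p
  have hnη : Measurable fun ω => eLpNorm (fun x => F x (ω + -η)) p volume :=
    hn.comp (measurable_id.add_const (-η))
  have hFη : Measurable fun z : Rd d × Rd d => F z.1 (z.2 - η) :=
    measurable_comp_pair hF measurable_fst (measurable_snd.sub_const η)
  -- The order is reversed to match the mixed norm, whose inner norm is in the first variable.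
  rw [lintegral_lintegral_swap (f := fun t ω => ENNReal.ofReal (bracketPow (-(d + 1)) t) *
    ENNReal.ofReal (bracketPow (-(d + 1)) ω) * F t (ω - η)) (((hκ.comp measurable_fst).mul
      (hκ.comp measurable_snd)).mul hFη).aemeasurable]
  calc _ ≤ ∫⁻ ω, K₁ * (ENNReal.ofReal (bracketPow (-(d + 1)) ω) *
        eLpNorm (fun x => F x (ω + -η)) p volume) := by
        refine lintegral_mono fun ω => ?_
        have e : ∀ t, ENNReal.ofReal (bracketPow (-(d + 1)) t) *
            ENNReal.ofReal (bracketPow (-(d + 1)) ω) * F t (ω - η)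
            = ENNReal.ofReal (bracketPow (-(d + 1)) ω) *
              (ENNReal.ofReal (bracketPow (-(d + 1)) t) * F t (ω - η)) := fun t => by ring
        have h3 := h1 (fun t => F t (ω - η)) (continuous_slice hF _).measurable
        simp only [e]
        rw [lintegral_const_mul' _ _ ENNReal.ofReal_ne_top, mul_left_comm, ← sub_eq_add_neg]
        exact mul_le_mul_right h3 _
    _ = K₁ * ∫⁻ ω, ENNReal.ofReal (bracketPow (-(d + 1)) ω) *
        eLpNorm (fun x => F x (ω + -η)) p volume := lintegral_const_mul' _ _ hK₁
    _ ≤ K₁ * (K₂ * eLpNorm (fun ω => eLpNorm (fun x => F x (ω + -η)) p volume) q volume) :=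
        mul_le_mul_right (h2 _ hnη) _
    _ = _ := by
        have e := eLpNorm_comp_add_right hn q (-η)
        rw [e, mul_assoc]
        rfl

/-- The density integrates functions of finite mixed norm. -/
theorem exists_lintegral_pairDensity_mul_le {p q : ℝ≥0∞} (hp : 1 ≤ p) (hq : 1 ≤ q) :
    ∃ K : ℝ≥0∞, K ≠ ∞ ∧ ∀ (A : Rd d → ℝ≥0∞) (F : Rd d → Rd d → ℝ≥0∞), Measurable A →
      Continuous (Function.uncurry F) →
      ∫⁻ a, pairDensity A a * F a.2.1 (a.2.2 - a.1.2) ≤ K * (∫⁻ ξ, A ξ) * mixedNorm p q F := by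
  obtain ⟨K, hK, hle⟩ := exists_lintegral_bracketPow_mul_bracketPow_mul_le (d := d) hp hq
  have hκ : Measurable fun x : Rd d => ENNReal.ofReal (bracketPow (-(d + 1)) x) :=
    (continuous_bracketPow _).measurable.ennreal_ofReal
  refine ⟨(∫⁻ x : Rd d, ENNReal.ofReal (bracketPow (-(d + 1)) x)) * K,
    ENNReal.mul_ne_top lintegral_bracketPow_ne_top hK, fun A F hA hF => ?_⟩
  have hm : Measurable fun a : (Rd d × Rd d) × (Rd d × Rd d) =>
      pairDensity A a * F a.2.1 (a.2.2 - a.1.2) :=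
    (measurable_pairDensity hA).mul (measurable_comp_pair hF
      (f := fun a : (Rd d × Rd d) × (Rd d × Rd d) => a.2.1) (g := fun a => a.2.2 - a.1.2)
      (by fun_prop) (by fun_prop))
  rw [lintegral_pair hm]
  calc _ ≤ ∫⁻ x, ∫⁻ ξ, ENNReal.ofReal (bracketPow (-(d + 1)) x) * A ξ *
        (K * mixedNorm p q F) := by
        -- The bound for the integral over the last two variables is uniform in the shift `ξ`, so
        -- only the integrals of the bracket and of `A` remain.
        refine lintegral_mono fun x => lintegral_mono fun ξ => ?_
        have hm1 : Measurable fun z : Rd d × Rd d => ENNReal.ofReal (bracketPow (-(d + 1)) z.1) *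
            ENNReal.ofReal (bracketPow (-(d + 1)) z.2) * F z.1 (z.2 - ξ) :=
          ((hκ.comp measurable_fst).mul (hκ.comp measurable_snd)).mul
            (measurable_comp_pair hF measurable_fst (measurable_snd.sub_const ξ))
        have h1 : ∫⁻ t : Rd d, ∫⁻ ω : Rd d, ENNReal.ofReal (bracketPow (-(d + 1)) x) * A ξ *
            (ENNReal.ofReal (bracketPow (-(d + 1)) t) *
              ENNReal.ofReal (bracketPow (-(d + 1)) ω) * F t (ω - ξ))
            = ENNReal.ofReal (bracketPow (-(d + 1)) x) * A ξ * ∫⁻ t, ∫⁻ ω,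
              ENNReal.ofReal (bracketPow (-(d + 1)) t) *
              ENNReal.ofReal (bracketPow (-(d + 1)) ω) * F t (ω - ξ) := by
          have hm3 : Measurable fun t : Rd d => ∫⁻ ω, ENNReal.ofReal (bracketPow (-(d + 1)) t) *
              ENNReal.ofReal (bracketPow (-(d + 1)) ω) * F t (ω - ξ) :=
            hm1.lintegral_prod_right'
          refine Eq.trans ?_ (lintegral_const_mul _ hm3)
          refine lintegral_congr fun t => ?_
          have hm2 : Measurable fun ω => ENNReal.ofReal (bracketPow (-(d + 1)) t) *
              ENNReal.ofReal (bracketPow (-(d + 1)) ω) * F t (ω - ξ) :=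
            (hκ.const_mul _).mul (measurable_comp_pair hF measurable_const (measurable_id.sub_const ξ))
          exact lintegral_const_mul _ hm2
        refine Eq.trans_le ?_ (h1.le.trans (mul_le_mul_right (hle F hF ξ) _))
        refine lintegral_congr fun t => lintegral_congr fun ω => ?_
        simp only [pairDensity]
        ring
    _ = _ := by
        simp only [lintegral_mul_const _ (hA.const_mul _), lintegral_const_mul _ hA]
        rw [lintegral_mul_const _ (hκ.mul_const _), lintegral_mul_const _ hκ]
        ring

variable {E E₀ E₁ E₂ : Type*}
  [NormedAddCommGroup E] [NormedSpace ℂ E]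
  [NormedAddCommGroup E₀] [NormedSpace ℂ E₀] [NormedAddCommGroup E₁] [NormedSpace ℂ E₁]
  [NormedAddCommGroup E₂] [NormedSpace ℂ E₂]

/-- The short-time Fourier transform multiplied with a weight. -/
noncomputable def weightedSTFT (r s : ℝ) (γ : 𝓢(Rd d, ℂ)) (v : 𝓢(Rd d, ℂ) →L[ℂ] E)
    (x ξ : Rd d) : ℝ≥0∞ :=
  ENNReal.ofReal (bracketPow r x * bracketPow s ξ * ‖clmSTFT γ v (x, ξ)‖)

theorem continuous_weightedSTFT (r s : ℝ) (γ : 𝓢(Rd d, ℂ)) (v : 𝓢(Rd d, ℂ) →L[ℂ] E) :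
    Continuous (Function.uncurry (weightedSTFT r s γ v)) := by
  have h := continuous_clmSTFT γ v
  have h1 := continuous_bracketPow (d := d) r
  have h2 := continuous_bracketPow (d := d) s
  exact ENNReal.continuous_ofReal.comp
    (((h1.comp continuous_fst).mul (h2.comp continuous_snd)).mul h.norm)

variable (B : E₀ →L[ℂ] E₁ →L[ℂ] E₂)

/-- A Schwartz weight on a pair of short-time Fourier transforms is dominated by the translated
density. -/
theorem exists_lintegral_weight_mul_le (r s δ : ℝ) (γ₀ γ₁ : 𝓢(Rd d, ℂ)) :
    ∃ (N : ℕ) (c : ℝ), 0 ≤ c ∧ ∀ (u : 𝓢(Rd d, ℂ) →L[ℂ] E₀) (v : 𝓢(Rd d, ℂ) →L[ℂ] E₁)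
      (x₀ ξ₀ : Rd d),
      ∫⁻ p : (Rd d × Rd d) × (Rd d × Rd d), ENNReal.ofReal
        (bracketPow (r + δ) x₀ * bracketPow s ξ₀ *
        (bracketPow (-N) (p.1.1 - x₀) * bracketPow (-N) (p.2.1 - x₀) *
          bracketPow (-N) (p.1.2 + p.2.2 - ξ₀)) *
          (‖clmSTFT γ₀ u p.1‖ * ‖clmSTFT γ₁ v p.2‖))
      ≤ ENNReal.ofReal c * ∫⁻ a,
        pairDensity (fun ξ => eLpNorm (fun x => weightedSTFT δ |s| γ₀ u x ξ) ∞ volume) a *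
          weightedSTFT r s γ₁ v (x₀ + a.2.1) (ξ₀ + (a.2.2 - a.1.2)) := by
  obtain ⟨N, c, hc, hle⟩ := exists_weight_mul_le (d := d) r s δ
  refine ⟨N, c, hc, fun u v x₀ ξ₀ => ?_⟩
  let A : Rd d → ℝ≥0∞ := fun ξ => eLpNorm (fun x => weightedSTFT δ |s| γ₀ u x ξ) ∞ volume
  have hA : Measurable A := measurable_eLpNorm_of_continuous (continuous_weightedSTFT _ _ _ _) ∞
  let κ : Rd d → ℝ≥0∞ := fun x => ENNReal.ofReal (bracketPow (-(d + 1)) x)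
  have hκ : Measurable κ := (continuous_bracketPow _).measurable.ennreal_ofReal
  let G : (Rd d × Rd d) × (Rd d × Rd d) → ℝ≥0∞ := fun p =>
    κ (p.1.1 - x₀) * A p.1.2 * (κ (p.2.1 - x₀) * κ (p.1.2 + p.2.2 - ξ₀)) *
      weightedSTFT r s γ₁ v p.2.1 p.2.2
  have hG : Measurable G := by
    have hF := measurable_comp_pair (continuous_weightedSTFT r s γ₁ v)
      (f := fun p : (Rd d × Rd d) × (Rd d × Rd d) => p.2.1) (g := fun p => p.2.2)
      (by fun_prop) (by fun_prop)
    have m1 : Measurable fun p : (Rd d × Rd d) × (Rd d × Rd d) => p.1.1 - x₀ := by fun_prop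
    have m2 : Measurable fun p : (Rd d × Rd d) × (Rd d × Rd d) => p.1.2 := by fun_prop
    have m3 : Measurable fun p : (Rd d × Rd d) × (Rd d × Rd d) => p.2.1 - x₀ := by fun_prop
    have m4 : Measurable fun p : (Rd d × Rd d) × (Rd d × Rd d) => p.1.2 + p.2.2 - ξ₀ := by
      fun_prop
    exact (((hκ.comp m1).mul (hA.comp m2)).mul ((hκ.comp m3).mul (hκ.comp m4))).mul hF
  calc _ ≤ ∫⁻ p, ENNReal.ofReal c * G p := by
        refine lintegral_mono fun p => ?_
        obtain ⟨⟨x, ξ⟩, x', ξ'⟩ := p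
        have q := fun t y => bracketPow_nonneg (d := d) t y
        -- Continuity makes the essential supremum over `x` a bound at every point.
        have h1 : ENNReal.ofReal (bracketPow δ x * bracketPow |s| ξ * ‖clmSTFT γ₀ u (x, ξ)‖)
            ≤ A ξ := by
          refine le_eLpNorm_top_of_continuous (f := fun x => weightedSTFT δ |s| γ₀ u x ξ) ?_ x
          exact continuous_slice (continuous_weightedSTFT _ _ _ _) ξ
        calc _ ≤ ENNReal.ofReal (c * (bracketPow (-(d + 1)) (x - x₀) *
              (bracketPow δ x * bracketPow |s| ξ * ‖clmSTFT γ₀ u (x, ξ)‖) *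
              (bracketPow (-(d + 1)) (x' - x₀) * bracketPow (-(d + 1)) (ξ + ξ' - ξ₀)) *
              (bracketPow r x' * bracketPow s ξ' * ‖clmSTFT γ₁ v (x', ξ')‖))) := by
              refine ENNReal.ofReal_le_ofReal ?_
              refine (mul_le_mul_of_nonneg_right (hle x₀ ξ₀ x ξ x' ξ')
                (mul_nonneg (norm_nonneg (clmSTFT γ₀ u (x, ξ)))
                  (norm_nonneg (clmSTFT γ₁ v (x', ξ'))))).trans (le_of_eq ?_)
              ring
          _ = ENNReal.ofReal c * (κ (x - x₀) *
              ENNReal.ofReal (bracketPow δ x * bracketPow |s| ξ * ‖clmSTFT γ₀ u (x, ξ)‖) *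
              (κ (x' - x₀) * κ (ξ + ξ' - ξ₀)) * weightedSTFT r s γ₁ v x' ξ') := by
              have i1 := q (-(d + 1)) (x - x₀)
              have i2 := q (-(d + 1)) (x' - x₀)
              have i3 : 0 ≤ bracketPow δ x * bracketPow |s| ξ * ‖clmSTFT γ₀ u (x, ξ)‖ :=
                mul_nonneg (mul_nonneg (q _ _) (q _ _)) (norm_nonneg _)
              rw [ENNReal.ofReal_mul hc,
                ENNReal.ofReal_mul (mul_nonneg (mul_nonneg i1 i3) (mul_nonneg i2 (q _ _))),
                ENNReal.ofReal_mul (mul_nonneg i1 i3), ENNReal.ofReal_mul i1,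
                ENNReal.ofReal_mul i2]
              rfl
          _ ≤ _ := by
              simp only [G]
              gcongr
    _ = ENNReal.ofReal c * ∫⁻ p, G p := lintegral_const_mul _ hG
    _ = _ := by
        rw [lintegral_pair_translate hG x₀ ξ₀]
        congr 1
        refine lintegral_congr fun a => ?_
        simp only [G, pairDensity, κ, A]
        congr 6 <;> abel_nf

variable [CompleteSpace E₀] [CompleteSpace E₁] [CompleteSpace E₂]

/-- The product of a distribution in a modulation space with one of finite mixed norm. -/
theorem exists_isDistribProduct_mixedNorm_le {p q : ℝ≥0∞} (hp : 1 ≤ p) (hq : 1 ≤ q) (r s δ : ℝ)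
    {γ₀ γ₁ : 𝓢(Rd d, ℂ)} (hγ₀ : γ₀ ≠ 0) (hγ₁ : γ₁ ≠ 0) (γ₂ : 𝓢(Rd d, ℂ)) :
    ∃ C : ℝ≥0∞, C ≠ ∞ ∧ ∀ (u : 𝓢'(Rd d, E₀)) (v : 𝓢'(Rd d, E₁)),
      mixedNorm ∞ 1 (weightedSTFT δ |s| γ₀ u) ≠ ∞ →
      mixedNorm p q (weightedSTFT r s γ₁ v) ≠ ∞ →
      ∃ w : 𝓢'(Rd d, E₂), IsDistribProduct B u v w ∧
        mixedNorm p q (weightedSTFT (r + δ) s γ₂ w)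
          ≤ C * mixedNorm ∞ 1 (weightedSTFT δ |s| γ₀ u)
            * mixedNorm p q (weightedSTFT r s γ₁ v) := by
  obtain ⟨h₀, hh₀⟩ := exists_dual_window hγ₀
  obtain ⟨h₁, hh₁⟩ := exists_dual_window hγ₁
  obtain ⟨N, c, hc, hle⟩ := exists_lintegral_weight_mul_le (E₀ := E₀) (E₁ := E₁) r s δ γ₀ γ₁
  obtain ⟨K, hK, hKle⟩ := exists_lintegral_pairDensity_mul_le (d := d) hp hq
  obtain ⟨m, C, hC, hker⟩ := exists_norm_tfCoeff_mulShift_le h₀ h₁ N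
  let L : ℝ≥0∞ := ∫⁻ x : Rd d, ENNReal.ofReal (bracketPow (-(d + 1)) x)
  let D : ℝ := C * schwartzNorm d m γ₂ * ‖B‖
  have hD : 0 ≤ D := mul_nonneg (mul_nonneg hC (schwartzNorm_nonneg _ _)) (norm_nonneg B)
  refine ⟨ENNReal.ofReal D * ENNReal.ofReal c * L ^ 3, ?_, fun u v hu hv => ?_⟩
  · exact ENNReal.mul_ne_top (ENNReal.mul_ne_top ENNReal.ofReal_ne_top ENNReal.ofReal_ne_top)
      (ENNReal.pow_ne_top lintegral_bracketPow_ne_top)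
  let A : Rd d → ℝ≥0∞ := fun ξ => eLpNorm (fun x => weightedSTFT δ |s| γ₀ u x ξ) ∞ volume
  have hA : Measurable A := measurable_eLpNorm_of_continuous (continuous_weightedSTFT _ _ _ _) ∞
  have hAint : ∫⁻ ξ, A ξ = mixedNorm ∞ 1 (weightedSTFT δ |s| γ₀ u) := by
    simp only [mixedNorm, eLpNorm_one_eq_lintegral_enorm, enorm_eq_self, A]
  have hcF := continuous_weightedSTFT r s γ₁ (v : 𝓢(Rd d, ℂ) →L[ℂ] E₁)
  have hc₀ := continuous_clmSTFT γ₀ (u : 𝓢(Rd d, ℂ) →L[ℂ] E₀)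
  have hc₁ := continuous_clmSTFT γ₁ (v : 𝓢(Rd d, ℂ) →L[ℂ] E₁)
  have hint : Integrable fun p : (Rd d × Rd d) × (Rd d × Rd d) =>
      pairWeight (-N) p * (‖clmSTFT γ₀ u p.1‖ * ‖clmSTFT γ₁ v p.2‖) := by
    refine ⟨Continuous.aestronglyMeasurable ?_, ?_⟩
    · unfold pairWeight
      fun_prop
    · have h1 := hle u v 0 0
      have h2 := hKle A (weightedSTFT r s γ₁ v) hA hcF
      have hz : ∀ t : ℝ, bracketPow t (0 : Rd d) = 1 := fun t => by simp [bracketPow]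
      simp only [hz, sub_zero, zero_add, one_mul] at h1
      have h3 : ENNReal.ofReal c * (K * (∫⁻ ξ, A ξ) * mixedNorm p q (weightedSTFT r s γ₁ v))
          < ∞ := by
        rw [hAint]
        exact (ENNReal.mul_ne_top ENNReal.ofReal_ne_top
          (ENNReal.mul_ne_top (ENNReal.mul_ne_top hK hu) hv)).lt_top
      refine lt_of_le_of_lt (le_of_eq ?_) (h1.trans_lt ((mul_le_mul_right h2 _).trans_lt h3))
      refine lintegral_congr fun p => ?_
      rw [Real.enorm_of_nonneg]
      · rfl
      · exact mul_nonneg (pairWeight_nonneg _ _) (mul_nonneg (norm_nonneg _) (norm_nonneg _))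
  obtain ⟨w, hw, hwe⟩ := exists_isDistribProduct B u v hh₀ hh₁ hint
  refine ⟨w, hw, ?_⟩
  -- The total mass of this measure is `L ^ 3` times the norm of `u`, and averaging translates
  -- against it is bounded by that mass.
  let ν : Measure ((Rd d × Rd d) × (Rd d × Rd d)) := volume.withDensity (pairDensity A)
  have hθ := measurable_pairDensity hA
  have hpt : ∀ x₀ ξ₀, weightedSTFT (r + δ) s γ₂ w x₀ ξ₀
      ≤ ENNReal.ofReal D * ENNReal.ofReal c *
        ∫⁻ a, weightedSTFT r s γ₁ v (x₀ + a.2.1) (ξ₀ + (a.2.2 - a.1.2)) ∂ν := by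
    intro x₀ ξ₀
    have q := fun t y => bracketPow_nonneg (d := d) t y
    have hm : Measurable fun a : (Rd d × Rd d) × (Rd d × Rd d) =>
        weightedSTFT r s γ₁ v (x₀ + a.2.1) (ξ₀ + (a.2.2 - a.1.2)) := by
      exact measurable_comp_pair hcF (f := fun a : (Rd d × Rd d) × (Rd d × Rd d) => x₀ + a.2.1)
        (g := fun a => ξ₀ + (a.2.2 - a.1.2)) (by fun_prop) (by fun_prop)
    rw [lintegral_withDensity_eq_lintegral_mul _ hθ hm]
    have hω : 0 ≤ bracketPow (r + δ) x₀ * bracketPow s ξ₀ := mul_nonneg (q _ _) (q _ _)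
    calc weightedSTFT (r + δ) s γ₂ w x₀ ξ₀
        = ENNReal.ofReal (bracketPow (r + δ) x₀ * bracketPow s ξ₀) *
          ‖w (tfShift γ₂ x₀ ξ₀)‖ₑ := by
          simp only [weightedSTFT]
          rw [ENNReal.ofReal_mul hω, ofReal_norm]
          rfl
      _ ≤ ENNReal.ofReal (bracketPow (r + δ) x₀ * bracketPow s ξ₀) *
          ∫⁻ a : (Rd d × Rd d) × (Rd d × Rd d), ENNReal.ofReal (D * ((bracketPow (-N) (a.1.1 - x₀) *
            bracketPow (-N) (a.2.1 - x₀) * bracketPow (-N) (a.1.2 + a.2.2 - ξ₀)) *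
            (‖clmSTFT γ₀ u a.1‖ * ‖clmSTFT γ₁ v a.2‖))) := by
          rw [hwe]
          refine mul_le_mul_right ((enorm_integral_le_lintegral_enorm _).trans ?_) _
          refine lintegral_mono fun a => ?_
          rw [← ofReal_norm, norm_smul]
          refine ENNReal.ofReal_le_ofReal ?_
          obtain ⟨⟨x, ξ⟩, x', ξ'⟩ := a
          rw [norm_productKernel_tfShift]
          refine (mul_le_mul (hker γ₂ _ _ _) (norm_pairSTFT_le B u v γ₀ γ₁ _)
            (norm_nonneg _) ?_).trans (le_of_eq ?_)
          · exact mul_nonneg (mul_nonneg hC (schwartzNorm_nonneg _ _))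
              (mul_nonneg (mul_nonneg (q _ _) (q _ _)) (q _ _))
          · simp only [D]
            ring
      _ = ENNReal.ofReal D * ∫⁻ a : (Rd d × Rd d) × (Rd d × Rd d), ENNReal.ofReal
          (bracketPow (r + δ) x₀ * bracketPow s ξ₀ * (bracketPow (-N) (a.1.1 - x₀) *
            bracketPow (-N) (a.2.1 - x₀) * bracketPow (-N) (a.1.2 + a.2.2 - ξ₀)) *
            (‖clmSTFT γ₀ u a.1‖ * ‖clmSTFT γ₁ v a.2‖)) := by
          rw [← lintegral_const_mul' _ _ ENNReal.ofReal_ne_top,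
            ← lintegral_const_mul' _ _ ENNReal.ofReal_ne_top]
          refine lintegral_congr fun a => ?_
          rw [← ENNReal.ofReal_mul hω, ← ENNReal.ofReal_mul hD]
          congr 1
          ring
      _ ≤ ENNReal.ofReal D * (ENNReal.ofReal c * ∫⁻ a, pairDensity A a *
          weightedSTFT r s γ₁ v (x₀ + a.2.1) (ξ₀ + (a.2.2 - a.1.2))) :=
          mul_le_mul_right (hle u v x₀ ξ₀) _
      _ = _ := by
          rw [mul_assoc]
          rfl
  have htr := mixedNorm_lintegral_translate_le ν hcF
    (t := fun a => a.2.1) (o := fun a => a.2.2 - a.1.2) (by fun_prop) (by fun_prop) hp hq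
  have hν : ν Set.univ = L ^ 3 * ∫⁻ ξ, A ξ := by
    rw [withDensity_apply _ MeasurableSet.univ, Measure.restrict_univ, lintegral_pairDensity hA]
  calc _ ≤ ENNReal.ofReal D * ENNReal.ofReal c * mixedNorm p q (fun x ω =>
        ∫⁻ a, weightedSTFT r s γ₁ v (x + a.2.1) (ω + (a.2.2 - a.1.2)) ∂ν) :=
        mixedNorm_le_const_mul (ENNReal.mul_ne_top ENNReal.ofReal_ne_top ENNReal.ofReal_ne_top) hpt
    _ ≤ ENNReal.ofReal D * ENNReal.ofReal c *
        (mixedNorm p q (weightedSTFT r s γ₁ v) * ν Set.univ) := mul_le_mul_right htr _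
    _ = _ := by
        rw [hν, hAint]
        ring

end ProductEstimate

/-! ### Modulation and amalgam norms as mixed norms -/

section WindowNorms

variable {d : ℕ} {E E₀ E₁ E₂ : Type*}
  [NormedAddCommGroup E] [NormedSpace ℂ E]
  [NormedAddCommGroup E₀] [NormedSpace ℂ E₀] [NormedAddCommGroup E₁] [NormedSpace ℂ E₁]
  [NormedAddCommGroup E₂] [NormedSpace ℂ E₂]

/-- The complex conjugate of a Schwartz function. -/
noncomputable def conjSchwartz (g : 𝓢(Rd d, ℂ)) : 𝓢(Rd d, ℂ) :=
  postcompCLM (𝕜 := ℝ) (Complex.conjCLE : ℂ →L[ℝ] ℂ) g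

theorem conjSchwartz_ne_zero {g : 𝓢(Rd d, ℂ)} (hg : g ≠ 0) : conjSchwartz g ≠ 0 := by
  contrapose! hg
  ext y
  have h : (starRingEnd ℂ) (g y) = 0 := congrArg (fun φ : 𝓢(Rd d, ℂ) => φ y) hg
  simpa using h

theorem fourierInv_schwartz_ne_zero {g : 𝓢(Rd d, ℂ)} (hg : g ≠ 0) : 𝓕⁻ g ≠ 0 := by
  contrapose! hg
  have h : 𝓕 (𝓕⁻ g) = g := FourierTransform.fourier_fourierInv_eq g
  rw [← h, hg]
  exact map_zero (FourierTransform.fourierCLM ℂ 𝓢(Rd d, ℂ))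

theorem ofReal_mul_eLpNorm {a : ℝ} (ha : 0 ≤ a) {f : Rd d → ℝ} (hf : ∀ x, 0 ≤ f x)
    (p : ℝ≥0∞) : ENNReal.ofReal a * eLpNorm f p volume
      = eLpNorm (fun x => ENNReal.ofReal (a * f x)) p volume := by
  rw [← Real.enorm_of_nonneg ha, ← eLpNorm_const_smul]
  refine eLpNorm_congr_enorm_ae (Eventually.of_forall fun x => ?_)
  rw [enorm_eq_self, ← Real.enorm_of_nonneg (mul_nonneg ha (hf x))]
  rfl

theorem modulationNorm_eq_mixedNorm (p q : ℝ≥0∞) (r s : ℝ) (g : 𝓢(Rd d, ℂ)) (u : 𝓢'(Rd d, E)) :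
    modulationNorm p q r s g u = mixedNorm p q (weightedSTFT r s (conjSchwartz g) u) := by
  unfold modulationNorm mixedNorm
  congr 1
  funext ξ
  rw [ofReal_mul_eLpNorm (bracketPow_nonneg s ξ) fun x =>
    mul_nonneg (bracketPow_nonneg r x) (norm_nonneg _)]
  congr 1
  funext x
  have e : stft g u x ξ = clmSTFT (conjSchwartz g) u (x, ξ) := rfl
  rw [e]
  simp only [weightedSTFT]
  congr 1
  ring

/-- The inverse Fourier transform of a time-frequency shift is again one, with position and
frequency exchanged, one sign changed and a unimodular phase. -/
theorem norm_stft_fourierInv (g : 𝓢(Rd d, ℂ)) (v : 𝓢'(Rd d, E)) (x ξ : Rd d) :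
    ‖stft g (𝓕⁻ v) x ξ‖ = ‖clmSTFT (𝓕⁻ (conjSchwartz g)) v (ξ, -x)‖ := by
  have e : stft g (𝓕⁻ v) x ξ = v (𝓕⁻ (tfShift (conjSchwartz g) x ξ)) :=
    TemperedDistribution.fourierInv_apply v _
  rw [e, fourierInv_tfShift, map_smul, norm_smul, norm_negCharacter, one_mul]
  rfl

/-- The sign in `-x` is harmless: the weight is even and reflection preserves Lebesgue measure. -/
theorem amalgamNorm_fourierInv_eq_mixedNorm (p q : ℝ≥0∞) (r s : ℝ) (g : 𝓢(Rd d, ℂ))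
    (v : 𝓢'(Rd d, E)) :
    amalgamNorm p q r s g (𝓕⁻ v)
      = mixedNorm p q (weightedSTFT r s (𝓕⁻ (conjSchwartz g)) v) := by
  have hF := continuous_weightedSTFT r s (𝓕⁻ (conjSchwartz g)) (v : 𝓢(Rd d, ℂ) →L[ℂ] E)
  have hn := measurable_eLpNorm_of_continuous hF p
  have h := eLpNorm_comp_measurePreserving (p := q) hn.aestronglyMeasurable
    (Measure.measurePreserving_neg (volume : Measure (Rd d)))
  rw [mixedNorm, ← h, amalgamNorm]
  congr 1
  funext x
  rw [ofReal_mul_eLpNorm (bracketPow_nonneg s x) fun ξ =>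
    mul_nonneg (bracketPow_nonneg r ξ) (norm_nonneg _), Function.comp_apply]
  congr 1
  funext ξ
  rw [norm_stft_fourierInv]
  simp only [weightedSTFT, bracketPow_neg_arg]
  congr 1
  ring

theorem mixedNorm_weightedSTFT_zero (p q : ℝ≥0∞) (r s : ℝ) (γ : 𝓢(Rd d, ℂ)) :
    mixedNorm p q (weightedSTFT r s γ (0 : 𝓢(Rd d, ℂ) →L[ℂ] E)) = 0 := by
  have e : ∀ x ξ, weightedSTFT r s γ (0 : 𝓢(Rd d, ℂ) →L[ℂ] E) x ξ = 0 := fun x ξ => by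
    simp [weightedSTFT, clmSTFT]
  simp [mixedNorm, e]

theorem eq_zero_of_mixedNorm_eq_zero {p q : ℝ≥0∞} (hp : p ≠ 0) (hq : q ≠ 0)
    {F : Rd d → Rd d → ℝ≥0∞} (hF : Continuous (Function.uncurry F))
    (h : mixedNorm p q F = 0) (x ξ : Rd d) : F x ξ = 0 := by
  have hn := measurable_eLpNorm_of_continuous hF p
  rw [mixedNorm, eLpNorm_eq_zero_iff hn.aestronglyMeasurable hq] at h
  have h1 : (fun ω => F x ω) =ᵐ[volume] fun _ => 0 := by
    filter_upwards [h] with ω hω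
    have hc := continuous_slice hF ω
    have h2 : eLpNorm (fun x => F x ω) p volume = 0 := hω
    rw [eLpNorm_eq_zero_iff hc.measurable.aestronglyMeasurable hp] at h2
    exact congrFun ((hc.ae_eq_iff_eq volume continuous_const).1 h2) x
  have hc : Continuous fun ω => F x ω := hF.comp (Continuous.prodMk_right x)
  exact congrFun ((hc.ae_eq_iff_eq volume continuous_const).1 h1) ξ

/-- A continuous transform of norm zero vanishes everywhere, and the reproducing formula recovers
the distribution from it. This settles the cases `0 * ∞` in the final estimate. -/
theorem eq_zero_of_mixedNorm_weightedSTFT_eq_zero [CompleteSpace E] {p q : ℝ≥0∞} (hp : p ≠ 0)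
    (hq : q ≠ 0) {r s : ℝ} {γ : 𝓢(Rd d, ℂ)} (hγ : γ ≠ 0) {v : 𝓢'(Rd d, E)}
    (h : mixedNorm p q (weightedSTFT r s γ v) = 0) : v = 0 := by
  obtain ⟨k, hk⟩ := exists_dual_window hγ
  have h1 : ∀ x ξ, v (tfShift γ x ξ) = 0 := fun x ξ => by
    have h2 := eq_zero_of_mixedNorm_eq_zero hp hq (continuous_weightedSTFT r s γ v) h x ξ
    simp only [weightedSTFT, ENNReal.ofReal_eq_zero] at h2
    have h3 : 0 < bracketPow r x * bracketPow s ξ :=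
      mul_pos (bracketPow_pos r x) (bracketPow_pos s ξ)
    have h4 : ‖clmSTFT γ v (x, ξ)‖ ≤ 0 := nonpos_of_mul_nonpos_right h2 h3
    exact norm_le_zero_iff.1 h4
  ext φ
  have h5 := clm_apply_eq_integral_tfCoeff_smul (v : 𝓢(Rd d, ℂ) →L[ℂ] E) hk φ
  refine h5.trans ?_
  refine (integral_congr_ae (Eventually.of_forall fun z => ?_)).trans (integral_zero _ _)
  change _ • v (tfShift γ z.1 z.2) = 0
  rw [h1, smul_zero]

theorem IsDistribProduct.zero_left (B : E₀ →L[ℂ] E₁ →L[ℂ] E₂) (v : 𝓢'(Rd d, E₁)) :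
    IsDistribProduct B 0 v 0 := by
  intro ρ σ _ _ φ
  simp [regularize]

end WindowNorms

/-! ### The Fourier multiplier estimate -/

theorem mainTheorem11 {d : ℕ} {E₀ E₁ E₂ : Type*}
    [NormedAddCommGroup E₀] [NormedSpace ℂ E₀] [CompleteSpace E₀]
    [NormedAddCommGroup E₁] [NormedSpace ℂ E₁] [CompleteSpace E₁]
    [NormedAddCommGroup E₂] [NormedSpace ℂ E₂] [CompleteSpace E₂]
    (B : E₀ →L[ℂ] E₁ →L[ℂ] E₂) (hB : ‖B‖ ≤ 1)
    (p q : ℝ≥0∞) (hp : 1 ≤ p) (hq : 1 ≤ q) (r s δ : ℝ)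
    (g₀ g₁ g₂ : 𝓢(Rd d, ℂ)) (hg₀ : g₀ ≠ 0) (hg₁ : g₁ ≠ 0) (hg₂ : g₂ ≠ 0) :
    ∃ C : ℝ, 0 < C ∧
      ∀ μ : 𝓢'(Rd d, E₀), MemModulation ∞ 1 δ |s| μ →
      ∀ f : 𝓢'(Rd d, E₁), MemAmalgam p q r s f →
        ∃ hf : f ∈ (fourierMultiplier B μ).domain,
          MemAmalgam p q (r + δ) s (fourierMultiplier B μ ⟨f, hf⟩) ∧
          amalgamNorm p q (r + δ) s g₂ (fourierMultiplier B μ ⟨f, hf⟩) ≤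
            ENNReal.ofReal C * modulationNorm ∞ 1 δ |s| g₀ μ * amalgamNorm p q r s g₁ f := by
  have hp0 : p ≠ 0 := (zero_lt_one.trans_le hp).ne'
  have hq0 : q ≠ 0 := (zero_lt_one.trans_le hq).ne'
  have w₀ := conjSchwartz_ne_zero hg₀
  have w₁ := fourierInv_schwartz_ne_zero (conjSchwartz_ne_zero hg₁)
  -- The constant comes from the prescribed windows alone, before `μ` and `f` are chosen; adding `1`
  -- below makes it positive.
  obtain ⟨C, hC, hest⟩ := exists_isDistribProduct_mixedNorm_le B hp hq r s δ w₀ w₁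
    (𝓕⁻ (conjSchwartz g₂))
  refine ⟨C.toReal + 1, by positivity, fun μ ⟨k₀, hk₀, hμ⟩ f ⟨k₁, hk₁, hf⟩ => ?_⟩
  have hCle : C ≤ ENNReal.ofReal (C.toReal + 1) := by
    rw [ENNReal.ofReal_add ENNReal.toReal_nonneg zero_le_one, ENNReal.ofReal_toReal hC]
    exact le_self_add
  have hC0 : ENNReal.ofReal (C.toReal + 1) ≠ 0 := by
    rw [ne_eq, ENNReal.ofReal_eq_zero, not_le]
    positivity
  have hfe : 𝓕⁻ (𝓕 f) = f := FourierTransform.fourierInv_fourier_eq f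
  have hnf : ∀ k : 𝓢(Rd d, ℂ), amalgamNorm p q r s k f
      = mixedNorm p q (weightedSTFT r s (𝓕⁻ (conjSchwartz k)) (𝓕 f : 𝓢'(Rd d, E₁))) :=
    fun k => by rw [← amalgamNorm_fourierInv_eq_mixedNorm, hfe]
  -- Membership may be witnessed by other windows `k₀`, `k₁`. They give existence of the product and
  -- membership of the result, but their constant is not used in the final bound.
  obtain ⟨C', hC', hest'⟩ := exists_isDistribProduct_mixedNorm_le B hp hq r s δ
    (conjSchwartz_ne_zero hk₀) (fourierInv_schwartz_ne_zero (conjSchwartz_ne_zero hk₁))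
    (𝓕⁻ (conjSchwartz g₂))
  rw [modulationNorm_eq_mixedNorm] at hμ
  rw [hnf] at hf
  obtain ⟨w, hw, hle⟩ := hest' μ (𝓕 f) hμ.ne hf.ne
  have hfin := hle.trans_lt (ENNReal.mul_ne_top (ENNReal.mul_ne_top hC' hμ.ne) hf.ne).lt_top
  refine ⟨⟨w, hw⟩, ?_⟩
  rw [fourierMultiplier_eq hw]
  refine ⟨⟨g₂, hg₂, by rwa [amalgamNorm_fourierInv_eq_mixedNorm]⟩, ?_⟩
  rw [amalgamNorm_fourierInv_eq_mixedNorm, modulationNorm_eq_mixedNorm, hnf]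
  have hzero : w = 0 → mixedNorm p q
      (weightedSTFT (r + δ) s (𝓕⁻ (conjSchwartz g₂)) w) = 0 := by
    rintro rfl
    exact mixedNorm_weightedSTFT_zero _ _ _ _ _
  -- If a norm for the prescribed windows vanishes, the product is zero. If neither vanishes and one
  -- is infinite, the right side is infinite. Otherwise the estimate applies, and uniqueness of the
  -- product identifies `w'` with `w`.
  by_cases h0 : mixedNorm ∞ 1 (weightedSTFT δ |s| (conjSchwartz g₀) μ) = 0
  · have hμ0 : μ = 0 :=
      eq_zero_of_mixedNorm_weightedSTFT_eq_zero ENNReal.top_ne_zero one_ne_zero w₀ h0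
    subst hμ0
    rw [hzero (hw.unique (IsDistribProduct.zero_left B _))]
    exact zero_le
  by_cases h1 : mixedNorm p q
      (weightedSTFT r s (𝓕⁻ (conjSchwartz g₁)) (𝓕 f : 𝓢'(Rd d, E₁))) = 0
  · have hf0 := eq_zero_of_mixedNorm_weightedSTFT_eq_zero hp0 hq0 w₁ h1
    rw [hf0] at hw
    rw [hzero (hw.unique (IsDistribProduct.zero_right B _))]
    exact zero_le
  by_cases h2 : mixedNorm ∞ 1 (weightedSTFT δ |s| (conjSchwartz g₀) μ) = ∞
  · rw [h2, ENNReal.mul_top hC0, ENNReal.top_mul h1]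
    exact le_top
  by_cases h3 : mixedNorm p q
      (weightedSTFT r s (𝓕⁻ (conjSchwartz g₁)) (𝓕 f : 𝓢'(Rd d, E₁))) = ∞
  · rw [h3, ENNReal.mul_top (mul_ne_zero hC0 h0)]
    exact le_top
  obtain ⟨w', hw', hle'⟩ := hest μ (𝓕 f) h2 h3
  rw [hw.unique hw']
  exact hle'.trans (mul_le_mul_left (mul_le_mul_left hCle _) _)
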